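/- **Setting.** A two-player episodic stochastic team has a finite state space $\mathcal S$ ($S=|\mathcal S|$), finite action sets $\mathcal A^{(1)},\mathcal A^{(2)}$ ($A=|\mathcal A^{(1)}|$), episode length $H\ge 1$, mean rewards $r_h(s,a,b)\in[0,1]$ and transition kernels $P_h(\cdot\mid s,a,b)$, $h\in[H]$. A policy of agent $i$ for one episode is a map $\pi^{(i)}:[H]\times\mathcal S\to\Delta(\mathcal A^{(i)})$, and $V_h^{(\pi^{(1)},\pi^{(2)})}(s)=\mathbb E\big[\sum_{h'=h}^H r_{h'}(s_{h'},\pi^{(1)}_{h'}(s_{h'}),\pi^{(2)}_{h'}(s_{h'}))\mid s_h=s\big]$. A joint policy is team-optimal if it attains $\sup_{\pi^{(1)},\pi^{(2)}}V_h^{(\pi^{(1)},\pi^{(2)})}(s)$ for all $h,s$. The team is $(\lambda,\mu)$-smooth if there is a pair $(\pi^{(1)\star},\pi^{(2)\star})$ such that for all $(\pi^{(1)},\pi^{(2)})$, $h$ and $s$ $$V_h^{(\pi^{(1)\star},\pi^{(2)\star})}(s)\ge V_h^{(\pi^{(1)},\pi^{(2)})}(s),\qquad V_h^{(\pi^{(1)\star},\pi^{(2)})}(s)\ge\lambda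 V_h^{(\pi^{(1)\star},\pi^{(2)\star})}(s)-\mu V_h^{(\pi^{(1)},\pi^{(2)})}(s).$$ **Play.** There are $M$ episodes, $T=MH$. The initial states $s_1^1,\dots,s_1^M$ are fixed in advance. Before episode $m$, agent 2 fixes a policy $\pi^{(2),m}$, which may depend on the past and on private randomness in any way. At step $h$, agent 1 takes an action $a_h$, agent 2 draws its action $b_h$ from $\pi_h^{(2),m}(s_h)$, a random common reward $R_h\in[0,1]$ with conditional mean $r_h(s_h,a_h,b_h)$ is received, and the next state is drawn from $P_h(\cdot\mid s_h,a_h,b_h)$. Agent 1 observes only the states, its own actions and the rewards. The switching cost of agent 2 is $N_{\rm switch}=\sum_{m=1}^{M-1}|\{(h,s):\pi_h^{(2),m}(s)\ne\pi_h^{(2),m+1}(s)\}|$. **RestartQ-UCB** (no local variation budgets), with variation budget $\Delta>0$, input $\delta'\in(0,1)$ and constant $c>0$. Let $D=\lceil S^{-1/3}A^{-1/3}\Delta^{2/3}H^{-2/3}T^{1/3}\rceil$, $K=\lceil M/D\rceil$, $\iota=\log(2/\delta')$, $N_0=\lceil cSAH^6\iota\rceil$, $e_1=H$, $e_{i+1}=\lfloor(1+1/H)e_i\rfloor$,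 $\mathcal L=\{e_1+\dots+e_j:j\ge1\}$. The episodes are split into epochs of $K$ consecutive episodes. At the start of each epoch set, for all $(h,s,a)$, $Q_h(s,a)=V_h(s)=H-h+1$, $V^{\rm ref}_h(s)=H$, and all counters $N,\check N$ and sums $\check r,\check v,\check\mu,\check\sigma,\mu^{\rm ref},\sigma^{\rm ref}$ to $0$; $V_{H+1}=V_{H+1}^{\rm ref}=0$ throughout. At each step $h$ take $a_h\in\arg\max_aQ_h(s_h,a)$ (ties are broken by a fixed rule on the set of maximizers), observe $R_h,s_{h+1}$, and at the entry $(h,s_h,a_h)$ add to $\check r,\check v,\check\mu,\check\sigma,\mu^{\rm ref},\sigma^{\rm ref}$ the quantities $R_h$, $V_{h+1}(s_{h+1})$, $V_{h+1}(s_{h+1})-V^{\rm ref}_{h+1}(s_{h+1})$, the square of the latter, $V^{\rm ref}_{h+1}(s_{h+1})$, $V^{\rm ref}_{h+1}(s_{h+1})^2$, and add $1$ to $N$ and $\check N$, obtaining $n$ and $\check n$. If $n\in\mathcal L$, set, with $b=\sqrt{H^2\iota/\check n}+\sqrt{\iota/\check n}$, * (Hoeffding version) $Q_h(s_h,a_h)\leftarrow\min\{\check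 r/\check n+\check v/\check n+b,\;Q_h(s_h,a_h)\}$, * (Freedman version) $Q_h(s_h,a_h)\leftarrow\min\{\check r/\check n+\check v/\check n+b,\;\check r/\check n+\mu^{\rm ref}/n+\check\mu/\check n+2\underline b,\;Q_h(s_h,a_h)\}$, where $$\underline b=2\sqrt{\tfrac{\sigma^{\rm ref}/n-(\mu^{\rm ref}/n)^2}{n}\iota}+2\sqrt{\tfrac{\check\sigma/\check n-(\check\mu/\check n)^2}{\check n}\iota}+5\Big(\tfrac{H\iota}{n}+\tfrac{H\iota}{\check n}+\tfrac{H\iota^{3/4}}{n^{3/4}}+\tfrac{H\iota^{3/4}}{\check n^{3/4}}\Big)+\sqrt{\tfrac{\iota}{\check n}},$$ then $V_h(s_h)\leftarrow\max_aQ_h(s_h,a)$ and reset $\check N,\check r,\check v,\check\mu,\check\sigma$ to $0$ at $(h,s_h,a_h)$. Finally, if $\sum_aN_h(s_h,a)=N_0$, set $V_h^{\rm ref}(s_h)\leftarrow V_h(s_h)$. Let $\pi^{(1),m}$ be the (greedy) policy that the algorithm induces in episode $m$. **Theorem.** There are absolute constants $q_0,k\in\mathbb N$ such that the following holds. Fix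 $\mathcal S,\mathcal A^{(1)},H$, $\beta\in(0,1)$, $\lambda\ge0$, an integer $q\ge q_0$ and constants $c_{\rm sw}$, $c_B>0$, $c>0$. There are $C$ and $T_0$, depending only on these, such that for every $\mathcal A^{(2)}$, every $\mu>-1$, every $(\lambda,\mu)$-smooth team with these $\mathcal S,\mathcal A^{(1)},\mathcal A^{(2)},H$, every $M$ with $T=MH\ge T_0$, every $\delta\in(0,1)$ and every agent 2 with $N_{\rm switch}\le c_{\rm sw}T^\beta$ almost surely: if agent 1 runs either version of RestartQ-UCB with variation budget $\Delta=c_BT^\beta$, input $\delta'=\delta/(SAT)^q$ and constant $c$, then for any team-optimal $(\pi^{(1)\star},\pi^{(2)\star})$, with probability at least $1-\delta$, $$\sum_{m=1}^MV_1^{(\pi^{(1),m},\pi^{(2),m})}(s_1^m)\ \ge\ \frac{\lambda}{1+\mu}\left[\sum_{m=1}^MV_1^{(\pi^{(1)\star},\pi^{(2)\star})}(s_1^m)-C\,T^{\frac{\beta+2}{3}}\Big(\log\frac T\delta\Big)^k\right].$$ -/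

import Mathlib

open MeasureTheory

noncomputable section

namespace TeamRL

/-! ### Two-player episodic stochastic teams

Steps of an episode are numbered `0, …, H - 1` and episodes `0, …, M - 1`. Step-indexed objects
are indexed by `ℕ`; their components at steps `h ≥ H` play no role. -/

/-- A two-player episodic stochastic team with state space `S` and action spaces `A₁`, `A₂`:
the common mean rewards and the transition kernels of every step. -/
structure Team (S A₁ A₂ : Type*) [Fintype S] where
  r : ℕ → S → A₁ → A₂ → ℝ
  r_mem : ∀ h s a b, r h s a b ∈ Set.Icc (0 : ℝ) 1
  P : ℕ → S → A₁ → A₂ → stdSimplex ℝ S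

/-- The (possibly randomized) policy of one agent in one episode. -/
abbrev Policy (S A : Type*) [Fintype A] := ℕ → S → stdSimplex ℝ A

/-- A deterministic policy, seen as a randomized one. -/
def Policy.ofDet {S A : Type*} [Fintype A] [DecidableEq A] (f : ℕ → S → A) : Policy S A :=
  fun h s => stdSimplex.vertex (f h s)

section Value

variable {S A₁ A₂ : Type*} [Fintype S] [Fintype A₁] [Fintype A₂]

/-- Expected reward at step `h` in state `s` under a joint policy. -/
def Team.meanReward (G : Team S A₁ A₂) (π₁ : Policy S A₁) (π₂ : Policy S A₂)
    (h : ℕ) (s : S) : ℝ :=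
  ∑ a, ∑ b, π₁ h s a * π₂ h s b * G.r h s a b

/-- Probability of moving from `s` to `s'` at step `h` under a joint policy. -/
def Team.trans (G : Team S A₁ A₂) (π₁ : Policy S A₁) (π₂ : Policy S A₂)
    (h : ℕ) (s s' : S) : ℝ :=
  ∑ a, ∑ b, π₁ h s a * π₂ h s b * G.P h s a b s'

/-- `G.stateLaw π₁ π₂ h s n s'` is the probability of `s_{h+n} = s'` given `s_h = s`. -/
def Team.stateLaw [DecidableEq S] (G : Team S A₁ A₂) (π₁ : Policy S A₁) (π₂ : Policy S A₂)
    (h : ℕ) (s : S) : ℕ → S → ℝ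
  | 0 => fun s' => if s' = s then 1 else 0
  | n + 1 => fun s' => ∑ x, G.stateLaw π₁ π₂ h s n x * G.trans π₁ π₂ (h + n) x s'

/-- The value function: the expected sum of the rewards of the steps `h, …, H - 1`, given
`s_h = s`. -/
def Team.value [DecidableEq S] (G : Team S A₁ A₂) (H : ℕ) (π₁ : Policy S A₁) (π₂ : Policy S A₂)
    (h : ℕ) (s : S) : ℝ :=
  ∑ n ∈ Finset.range (H - h),
    ∑ x, G.stateLaw π₁ π₂ h s n x * G.meanReward π₁ π₂ (h + n) x

theorem Team.stateLaw_succ' [DecidableEq S] (G : Team S A₁ A₂) (π₁ : Policy S A₁)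
    (π₂ : Policy S A₂) (h : ℕ) (s : S) (n : ℕ) (s' : S) :
    G.stateLaw π₁ π₂ h s (n + 1) s' =
      ∑ x, G.trans π₁ π₂ h s x * G.stateLaw π₁ π₂ (h + 1) x n s' := by
  induction n generalizing s' with
  | zero => simp [Team.stateLaw]
  | succ n ih =>
    rw [Team.stateLaw]
    simp_rw [ih, Team.stateLaw, Finset.sum_mul, Finset.mul_sum]
    rw [Finset.sum_comm]
    refine Finset.sum_congr rfl fun x _ => Finset.sum_congr rfl fun y _ => ?_
    rw [show h + (n + 1) = h + 1 + n by omega, mul_assoc]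

/-- The Bellman equation. -/
theorem Team.value_eq [DecidableEq S] (G : Team S A₁ A₂) (H : ℕ) (π₁ : Policy S A₁)
    (π₂ : Policy S A₂) {h : ℕ} (hh : h < H) (s : S) :
    G.value H π₁ π₂ h s =
      G.meanReward π₁ π₂ h s + ∑ x, G.trans π₁ π₂ h s x * G.value H π₁ π₂ (h + 1) x := by
  unfold Team.value
  rw [show H - h = (H - (h + 1)) + 1 by omega, Finset.sum_range_succ', add_comm]
  congr 1
  · simp [Team.stateLaw]
  · simp_rw [G.stateLaw_succ', Finset.sum_mul, Finset.mul_sum]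
    conv_rhs => rw [Finset.sum_comm]
    refine Finset.sum_congr rfl fun n _ => ?_
    rw [Finset.sum_comm]
    refine Finset.sum_congr rfl fun y _ => Finset.sum_congr rfl fun x _ => ?_
    rw [show h + (n + 1) = h + 1 + n by omega, mul_assoc]

/-- A joint policy that attains the highest value from every step and state. -/
def Team.IsTeamOptimal [DecidableEq S] (G : Team S A₁ A₂) (H : ℕ)
    (σ₁ : Policy S A₁) (σ₂ : Policy S A₂) : Prop :=
  ∀ h < H, ∀ s, IsLUB
    (Set.range fun p : Policy S A₁ × Policy S A₂ => G.value H p.1 p.2 h s)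
    (G.value H σ₁ σ₂ h s)

/-- `(lam, mu)`-smoothness of a team. -/
def Team.IsSmooth [DecidableEq S] (G : Team S A₁ A₂) (H : ℕ) (lam mu : ℝ) : Prop :=
  ∃ (σ₁ : Policy S A₁) (σ₂ : Policy S A₂), ∀ (π₁ : Policy S A₁) (π₂ : Policy S A₂),
    ∀ h < H, ∀ s,
      G.value H π₁ π₂ h s ≤ G.value H σ₁ σ₂ h s ∧
      lam * G.value H σ₁ σ₂ h s - mu * G.value H π₁ π₂ h s ≤ G.value H σ₁ π₂ h s

end Value

/-- Switching cost between two policies: the number of pairs `(h, s)` with `h < H` on which they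
act differently. -/
def nSwitch {S A : Type*} [Fintype A] (H : ℕ) (π π' : Policy S A) : ℕ :=
  Set.ncard {p : ℕ × S | p.1 < H ∧ π p.1 p.2 ≠ π' p.1 p.2}

/-- Switching cost of the policy trajectory `π 0, …, π (M - 1)`. -/
def switchingCost {S A : Type*} [Fintype A] (H M : ℕ) (π : ℕ → Policy S A) : ℕ :=
  ∑ m ∈ Finset.range (M - 1), nSwitch H (π m) (π (m + 1))

/-! ### The RestartQ-UCB algorithm (without knowledge of local variation budgets) -/

/-- The two versions of the bonus terms. -/
inductive Bonus
  | hoeffding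
  | freedman

/-- Input parameters: the version, the number `K` of episodes per epoch, the logarithmic factor
`ι`, the number `N₀` of samples after which a reference value is fixed, and the tie-breaking rule,
which selects an action among the maximizers. -/
structure Params (A : Type*) where
  bonus : Bonus
  K : ℕ
  ι : ℝ
  N₀ : ℕ
  pick : Finset A → A

/-- The variables of the algorithm; `Nc`, `rc`, `vc`, `muc`, `sigc` are those marked with a check
(they only count the current stage), `muref`, `sigref`, `Vref` the reference ones (used by the
Freedman version only). -/
structure Tables (S A : Type*) where
  Q : ℕ → S → A → ℝ
  V : ℕ → S → ℝ
  N : ℕ → S → A → ℕ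
  Nc : ℕ → S → A → ℕ
  rc : ℕ → S → A → ℝ
  vc : ℕ → S → A → ℝ
  muc : ℕ → S → A → ℝ
  sigc : ℕ → S → A → ℝ
  muref : ℕ → S → A → ℝ
  sigref : ℕ → S → A → ℝ
  Vref : ℕ → S → ℝ

/-- Values of the variables at the beginning of an epoch. With steps numbered from `0`, the
optimistic initial value of step `h` is `H - h`; after the last step all values are `0`. -/
def Tables.init (S A : Type*) (H : ℕ) : Tables S A where
  Q := fun h _ _ => (H : ℝ) - h
  V := fun h _ => (H : ℝ) - h
  N := fun _ _ _ => 0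
  Nc := fun _ _ _ => 0
  rc := fun _ _ _ => 0
  vc := fun _ _ _ => 0
  muc := fun _ _ _ => 0
  sigc := fun _ _ _ => 0
  muref := fun _ _ _ => 0
  sigref := fun _ _ _ => 0
  Vref := fun h _ => if h < H then (H : ℝ) else 0

/-- Stage lengths: `e₁ = H`, `e_{i+1} = ⌊(1 + 1/H) e_i⌋` (here indexed from `0`). -/
def stageLength (H : ℕ) : ℕ → ℕ
  | 0 => H
  | i + 1 => ⌊(1 + 1 / (H : ℝ)) * (stageLength H i : ℝ)⌋₊

/-- The visit counts at which a stage ends: `e₁ + ⋯ + e_j` for `j ≥ 1`. -/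
def stageEnds (H : ℕ) : Set ℕ :=
  {n | ∃ j : ℕ, 1 ≤ j ∧ n = ∑ i ∈ Finset.range j, stageLength H i}

section Algorithm

variable {S A : Type*} [Fintype S] [DecidableEq S] [Fintype A] [DecidableEq A]

/-- Overwrite the entry `(h, s, a)` of a table. -/
def setEntry {α : Type*} (f : ℕ → S → A → α) (h : ℕ) (s : S) (a : A) (v : α) :
    ℕ → S → A → α :=
  fun h' s' a' => if h' = h ∧ s' = s ∧ a' = a then v else f h' s' a'

/-- Overwrite the entry `(h, s)` of a table. -/
def setEntry₂ (f : ℕ → S → ℝ) (h : ℕ) (s : S) (v : ℝ) : ℕ → S → ℝ :=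
  fun h' s' => if h' = h ∧ s' = s then v else f h' s'

/-- The accumulation of a new sample: action `a` was taken in state `s` at step `h`, the reward was
`R` and the next state `s'`. -/
def Tables.record (x : Tables S A) (h : ℕ) (s : S) (a : A) (R : ℝ) (s' : S) : Tables S A :=
  { x with
    rc := setEntry x.rc h s a (x.rc h s a + R)
    vc := setEntry x.vc h s a (x.vc h s a + x.V (h + 1) s')
    muc := setEntry x.muc h s a (x.muc h s a + (x.V (h + 1) s' - x.Vref (h + 1) s'))
    sigc := setEntry x.sigc h s a (x.sigc h s a + (x.V (h + 1) s' - x.Vref (h + 1) s') ^ 2)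
    muref := setEntry x.muref h s a (x.muref h s a + x.Vref (h + 1) s')
    sigref := setEntry x.sigref h s a (x.sigref h s a + x.Vref (h + 1) s' ^ 2)
    N := setEntry x.N h s a (x.N h s a + 1)
    Nc := setEntry x.Nc h s a (x.Nc h s a + 1) }

/-- The Hoeffding bonus, for a stage of `nc` visits. -/
def hoeffdingBonus (H : ℕ) (ι nc : ℝ) : ℝ :=
  √((H : ℝ) ^ 2 / nc * ι) + √(1 / nc * ι)

/-- The Freedman bonus at `(h, s, a)`. -/
def freedmanBonus (H : ℕ) (ι : ℝ) (x : Tables S A) (h : ℕ) (s : S) (a : A) : ℝ :=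
  let n : ℝ := x.N h s a
  let nc : ℝ := x.Nc h s a
  2 * √((x.sigref h s a / n - (x.muref h s a / n) ^ 2) / n * ι)
    + 2 * √((x.sigc h s a / nc - (x.muc h s a / nc) ^ 2) / nc * ι)
    + 5 * (H * ι / n + H * ι / nc + H * ι ^ (3 / 4 : ℝ) / n ^ (3 / 4 : ℝ)
        + H * ι ^ (3 / 4 : ℝ) / nc ^ (3 / 4 : ℝ))
    + √(1 / nc * ι)

/-- The new value of `Q_h(s, a)` at the end of a stage. -/
def newQ (H : ℕ) (p : Params A) (x : Tables S A) (h : ℕ) (s : S) (a : A) : ℝ :=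
  let n : ℝ := x.N h s a
  let nc : ℝ := x.Nc h s a
  let hoeff : ℝ := x.rc h s a / nc + x.vc h s a / nc + hoeffdingBonus H p.ι nc
  match p.bonus with
  | .hoeffding => min hoeff (x.Q h s a)
  | .freedman =>
      min hoeff
        (min (x.rc h s a / nc + x.muref h s a / n + x.muc h s a / nc
            + 2 * freedmanBonus H p.ι x h s a)
          (x.Q h s a))

/-- The updates at the end of a stage of `(h, s, a)`. -/
def Tables.endStage (H : ℕ) (p : Params A) (x : Tables S A) (h : ℕ) (s : S) (a : A) :
    Tables S A :=
  let Q' := setEntry x.Q h s a (newQ H p x h s a)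
  { x with
    Q := Q'
    V := setEntry₂ x.V h s (⨆ a', Q' h s a')
    Nc := setEntry x.Nc h s a 0
    rc := setEntry x.rc h s a 0
    vc := setEntry x.vc h s a 0
    muc := setEntry x.muc h s a 0
    sigc := setEntry x.sigc h s a 0 }

/-- Fixing the reference value of `(h, s)` once the state has been visited `N₀` times at step `h`
of the current epoch. -/
def Tables.learnRef (p : Params A) (x : Tables S A) (h : ℕ) (s : S) : Tables S A :=
  if ∑ a, x.N h s a = p.N₀ then { x with Vref := setEntry₂ x.Vref h s (x.V h s) } else x

open Classical in
/-- All the updates that follow one step of an episode. -/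
def Tables.update (H : ℕ) (p : Params A) (x : Tables S A) (h : ℕ) (s : S) (a : A) (R : ℝ)
    (s' : S) : Tables S A :=
  let y := x.record h s a R s'
  let z := if y.N h s a ∈ stageEnds H then y.endStage H p h s a else y
  z.learnRef p h s

/-- The variables just before step `h` of an episode that starts with `x` and in which the states
`s`, actions `a` and rewards `R` are observed. -/
def withinEpisode (H : ℕ) (p : Params A) (x : Tables S A) (s : ℕ → S) (a : ℕ → A) (R : ℕ → ℝ) :
    ℕ → Tables S A
  | 0 => x
  | h + 1 => (withinEpisode H p x s a R h).update H p h (s h) (a h) (R h) (s (h + 1))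

/-- The variables at the beginning of episode `m`, given the states, own actions and rewards
observed in the earlier episodes. Epochs consist of `K` consecutive episodes and each of them
restarts the algorithm. -/
def startOfEpisode (H : ℕ) (p : Params A) (s : ℕ → ℕ → S) (a : ℕ → ℕ → A) (R : ℕ → ℕ → ℝ) :
    ℕ → Tables S A
  | 0 => Tables.init S A H
  | m + 1 =>
      if p.K ∣ m + 1 then Tables.init S A H
      else withinEpisode H p (startOfEpisode H p s a R m) (s m) (a m) (R m) H

/-- The action that maximizes `Q_h(s, ·)`, ties being broken by the given rule. -/
def greedy (p : Params A) (x : Tables S A) (h : ℕ) (s : S) : A :=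
  p.pick {a | ∀ a', x.Q h s a' ≤ x.Q h s a}

/-- The policy that the algorithm induces in episode `m`. (The entries `Q_h` do not change in an
episode before step `h` has been taken.) -/
def inducedPolicy (H : ℕ) (p : Params A) (s : ℕ → ℕ → S) (a : ℕ → ℕ → A) (R : ℕ → ℕ → ℝ)
    (m : ℕ) : Policy S A :=
  Policy.ofDet (greedy p (startOfEpisode H p s a R m))

end Algorithm

/-- The number of epochs, `D = S^{-1/3} A^{-1/3} Δ^{2/3} H^{-2/3} T^{1/3}` rounded up, where
`T = M H`. -/
def numEpochs (nS nA H M : ℕ) (Δ : ℝ) : ℕ :=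
  ⌈(nS : ℝ) ^ (-(1 / 3) : ℝ) * (nA : ℝ) ^ (-(1 / 3) : ℝ) * Δ ^ (2 / 3 : ℝ)
    * (H : ℝ) ^ (-(2 / 3) : ℝ) * ((M * H : ℕ) : ℝ) ^ (1 / 3 : ℝ)⌉₊

/-- The parameters of RestartQ-UCB for `nS` states, `nA` own actions, `M` episodes of `H` steps,
variation budget `Δ`, input confidence parameter `δ` and reference sample constant `c`:
`K = ⌈M / D⌉`, `ι = log (2 / δ)`, `N₀ = ⌈c S A H⁶ ι⌉`. -/
def restartParams {A : Type*} (bonus : Bonus) (pick : Finset A → A) (nS nA H M : ℕ)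
    (Δ δ c : ℝ) : Params A where
  bonus := bonus
  K := ⌈(M : ℝ) / (numEpochs nS nA H M Δ : ℝ)⌉₊
  ι := Real.log (2 / δ)
  N₀ := ⌈c * nS * nA * (H : ℝ) ^ 6 * Real.log (2 / δ)⌉₊
  pick := pick

/-! ### The interaction -/

/-- The random quantities of a play: in episode `m`, the state before step `h`, the actions of the
two agents and the reward at step `h`, and the policy that agent 2 uses in episode `m`. -/
structure Play (S A₁ A₂ Ω : Type*) [Fintype A₂] where
  state : ℕ → ℕ → Ω → S
  act₁ : ℕ → ℕ → Ω → A₁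
  act₂ : ℕ → ℕ → Ω → A₂
  reward : ℕ → ℕ → Ω → ℝ
  pol₂ : ℕ → Ω → Policy S A₂

section Interaction

variable {S A₁ A₂ Ω : Type*} [Fintype S] [DecidableEq S] [Fintype A₁] [DecidableEq A₁]
  [Fintype A₂] [MeasurableSpace Ω]

/-- The policy that the algorithm induces for agent 1 in episode `m`; it only uses the states, own
actions and rewards of the earlier episodes. -/
def Play.pol₁ (X : Play S A₁ A₂ Ω) (H : ℕ) (p : Params A₁) (m : ℕ) (ω : Ω) : Policy S A₁ :=
  inducedPolicy H p (fun m h => X.state m h ω) (fun m h => X.act₁ m h ω)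
    (fun m h => X.reward m h ω) m

/-- `X` is a play of `M` episodes of the team `G` in which agent 1 runs RestartQ-UCB with parameters
`p`, the initial states `s₁` are chosen by an oblivious adversary, and agent 2 chooses its policy
for each episode in an arbitrary, possibly randomized, way from the past.
`ℱ (m * H + h)` is the information available when the actions of step `h` of episode `m` are
about to be taken. -/
structure IsPlay (G : Team S A₁ A₂) (H M : ℕ) (p : Params A₁) (s₁ : ℕ → S) (ℙ : Measure Ω)
    (ℱ : Filtration ℕ (inferInstance : MeasurableSpace Ω)) (X : Play S A₁ A₂ Ω) : Prop where
  state_meas : ∀ m < M, ∀ h ≤ H, ∀ x, MeasurableSet[ℱ (m * H + h)] {ω | X.state m h ω = x}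
  act₂_meas : ∀ m < M, ∀ h < H, ∀ b,
    MeasurableSet[ℱ (m * H + h + 1)] {ω | X.act₂ m h ω = b}
  reward_meas : ∀ m < M, ∀ h < H, Measurable[ℱ (m * H + h + 1)] (X.reward m h)
  reward_mem : ∀ m < M, ∀ h < H, ∀ ω, X.reward m h ω ∈ Set.Icc (0 : ℝ) 1
  /-- The policy of agent 2 for episode `m` is fixed before that episode. -/
  pol₂_meas : ∀ m < M, ∀ h < H, ∀ s b, Measurable[ℱ (m * H)] (fun ω => X.pol₂ m ω h s b)
  start : ∀ m < M, ∀ ω, X.state m 0 ω = s₁ m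
  /-- Agent 1 maximizes its current `Q_h(s_h, ·)`. -/
  act₁_eq : ∀ m < M, ∀ h < H, ∀ ω, X.act₁ m h ω =
    greedy p
      (withinEpisode H p
        (startOfEpisode H p (fun m h => X.state m h ω) (fun m h => X.act₁ m h ω)
          (fun m h => X.reward m h ω) m)
        (fun h => X.state m h ω) (fun h => X.act₁ m h ω) (fun h => X.reward m h ω) h)
      h (X.state m h ω)
  /-- Given the past, agent 2 draws its action from its policy, and then the next state is drawn
  from the transition kernel. -/
  step_law : ∀ m < M, ∀ h < H, ∀ b s',
    ℙ[Set.indicator {ω | X.act₂ m h ω = b ∧ X.state m (h + 1) ω = s'} (fun _ => (1 : ℝ)) |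
        ℱ (m * H + h)] =ᵐ[ℙ]
      fun ω => X.pol₂ m ω h (X.state m h ω) b *
        G.P h (X.state m h ω) (X.act₁ m h ω) b s'
  /-- Given the past and the actions, the mean of the reward is `r_h(s, a, b)`. -/
  reward_law : ∀ m < M, ∀ h < H, ∀ b,
    ℙ[Set.indicator {ω | X.act₂ m h ω = b} (X.reward m h) | ℱ (m * H + h)] =ᵐ[ℙ]
      fun ω => X.pol₂ m ω h (X.state m h ω) b *
        G.r h (X.state m h ω) (X.act₁ m h ω) b

end Interaction

end TeamRL

end

noncomputable section

namespace TeamRL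

/-! ### Concentration of sums of bounded adapted processes -/

/-! Against a fixed policy of agent 2, agent 1 faces an ordinary finite-horizon decision process
with rewards `Team.rbar` and kernels `Team.Pbar`. An epoch in which agent 2 does not switch is
therefore a stationary run of optimistic Q-learning, and its regret is O(√K) up to logarithms
(`IsRun.regret_le`, `IsPlay.epoch_regret_le`). An epoch with a switch is written off at cost at most
K·H, and there are at most as many of these as switches (`sum_le_of_epochs`). With D of order
T^((2β+1)/3), both D√K and T^β·K are O(T^((β+2)/3)) (`epoch_tuning`), so no analysis of drift inside
an epoch is needed.

Smoothness turns regret into value. The best response to agent 2's policy is worth at least what the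
optimal first policy earns against it, hence at least λV* − μV. Summing over episodes bounds λΣV* −
(1+μ)ΣV by the regret (`smooth_sum_le`).

For the stationary regret, `IsRun.optimism` shows that the tables dominate the optimal values: each
new estimate averages earlier dominating values and adds a bonus larger than the deviation. In the
Freedman estimate the reference average runs over all visits; this is harmless because reference
values only decrease. For the converse bound both versions are treated alike, since both minima
contain the Hoeffding estimate. During a stage the gap Q − Q* is at most the mean gap of the next
step over the preceding stage, plus a bonus (`IsRun.exists_stage_gap_le`). As stages at most double
in length, each step of the horizon at most doubles the accumulated gap. The resulting factor 2^H is
allowed because C may depend on H.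

All randomness is confined to the event `Play.Good`: Hoeffding and empirical Bernstein bounds,
uniformly over steps, processes, state-action pairs and windows of episodes. They apply because row
h+1 of the tables is not modified before step h+1, so the values averaged at step h were fixed at
the start of the episode. -/

/-- Makes exp(Σ(x_l − x_l²)) a supermartingale for centred increments with |x_l| ≤ 1/2. Fluctuations
are thus paid for by realized squares, which is the source of the variance-dependent bound. -/
theorem exp_sub_sq_le {x : ℝ} (hx : |x| ≤ 1 / 2) : Real.exp (x - x ^ 2) ≤ 1 + x := by
  obtain ⟨h1, h2⟩ := abs_le.1 hx
  rcases le_or_gt 0 x with h | h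
  · rw [← Real.le_log_iff_exp_le (by linarith)]
    refine le_trans ?_ (Real.le_log_one_add_of_nonneg h)
    rw [le_div_iff₀ (by linarith)]
    nlinarith [pow_nonneg h 3, sq_nonneg x]
  · have hy : 0 ≤ x ^ 2 - x := by nlinarith
    have hq := Real.quadratic_le_exp_of_nonneg hy
    have hpos : 0 < 1 + x := by linarith
    have e : x - x ^ 2 = -(x ^ 2 - x) := by ring
    rw [e, Real.exp_neg, inv_le_comm₀ (Real.exp_pos _) hpos]
    refine le_trans ?_ hq
    rw [inv_le_iff_one_le_mul₀ hpos]
    obtain ⟨t, rfl⟩ : ∃ t, x = -t := ⟨-x, by ring⟩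
    have ht0 : 0 ≤ t := by linarith
    have ht1 : t ≤ 1 / 2 := by linarith
    -- The quadratic lower bound for the exponential suffices: the factor `1 - t - t² - t³`
    -- decreases in `t ≥ 0` and is still `1/8` at `t = 1/2`.
    have key : (1 + ((-t) ^ 2 - -t) + ((-t) ^ 2 - -t) ^ 2 / 2) * (1 + -t) - 1
        = t ^ 2 / 2 * (1 - t - t ^ 2 - t ^ 3) := by ring
    have : 0 ≤ 1 - t - t ^ 2 - t ^ 3 := by nlinarith [mul_nonneg ht0 ht0]
    nlinarith [mul_nonneg (sq_nonneg t) this]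

/-- Hoeffding's lemma for a Bernoulli variable, read off the sub-Gaussian bound for a two-point law
on an interval of length one. -/
theorem bernoulli_mgf_le {p : ℝ} (hp : p ∈ Set.Icc (0 : ℝ) 1) (l : ℝ) :
    1 - p + p * Real.exp l ≤ Real.exp (l * p + l ^ 2 / 8) := by
  obtain ⟨h0, h1⟩ := hp
  set μ : Measure ℝ := ENNReal.ofReal (1 - p) • Measure.dirac 0 + ENNReal.ofReal p • Measure.dirac 1
    with hμ
  have hprob : IsProbabilityMeasure μ := by
    constructor
    simp only [hμ, Measure.coe_add, Measure.coe_smul, Pi.add_apply, Pi.smul_apply, measure_univ,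
      smul_eq_mul, mul_one]
    rw [← ENNReal.ofReal_add (by linarith) h0]
    simp
  have hint : ∀ f : ℝ → ℝ, Measurable f → ∫ x, f x ∂μ = (1 - p) * f 0 + p * f 1 := by
    intro f hf
    have i : ∀ (a : ENNReal) (b : ℝ), a ≠ ⊤ → Integrable f (a • Measure.dirac b) := fun a b ha =>
      ((integrable_dirac' (a := b) hf.stronglyMeasurable (by simp)).smul_measure ha)
    rw [hμ, integral_add_measure (i _ _ (by simp)) (i _ _ (by simp)), integral_smul_measure,
      integral_smul_measure, integral_dirac, integral_dirac, ENNReal.toReal_ofReal (by linarith),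
      ENNReal.toReal_ofReal h0]
    simp
  have hs := ProbabilityTheory.hasSubgaussianMGF_of_mem_Icc (μ := μ) (X := id) (a := 0) (b := 1)
    aemeasurable_id (by
      rw [hμ, ae_add_measure_iff]
      constructor
      · exact Measure.ae_smul_measure 
          ((ae_dirac_iff (p := fun x : ℝ => id x ∈ Set.Icc (0 : ℝ) 1) measurableSet_Icc).2 (by simp)) _
      · exact Measure.ae_smul_measure 
          ((ae_dirac_iff (p := fun x : ℝ => id x ∈ Set.Icc (0 : ℝ) 1) measurableSet_Icc).2 (by simp)) _)
  have h := hs.mgf_le l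
  rw [ProbabilityTheory.mgf] at h
  have hid : ∫ x, id x ∂μ = p := by rw [hint id measurable_id]; simp
  rw [hid, hint _ (by fun_prop)] at h
  simp only [id] at h
  have h2 : (1 - p) * Real.exp (l * (0 - p)) + p * Real.exp (l * (1 - p))
      = Real.exp (-(l * p)) * (1 - p + p * Real.exp l) := by
    rw [mul_add, mul_left_comm (Real.exp (-(l * p))) p, ← Real.exp_add]
    ring_nf
  rw [h2] at h
  have h3 := mul_le_mul_of_nonneg_left h (Real.exp_pos (l * p)).le
  rw [← mul_assoc, ← Real.exp_add, ← Real.exp_add] at h3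
  simp only [add_neg_cancel, Real.exp_zero, one_mul] at h3
  refine h3.trans (le_of_eq ?_)
  congr 1
  push_cast
  simp
  ring

/-- Convexity. The bound is affine in `U`, so conditioning replaces `U` by its conditional mean and
reduces a general unit variable to the Bernoulli case. -/
theorem exp_mul_le_chord {U : ℝ} (hU : U ∈ Set.Icc (0 : ℝ) 1) (l : ℝ) :
    Real.exp (l * U) ≤ 1 - U + U * Real.exp l := by
  have h := convexOn_exp.2 (Set.mem_univ 0) (Set.mem_univ l) (by linarith [hU.2] : 0 ≤ 1 - U) hU.1
    (by ring)
  simp only [smul_eq_mul, mul_zero, zero_add, Real.exp_zero, mul_one] at h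
  rwa [mul_comm U l] at h

/-! ### Exponential supermartingales and unit processes. -/

section Supermartingale

variable {Ω : Type*} {mΩ : MeasurableSpace Ω} {ℙ : Measure Ω} [IsProbabilityMeasure ℙ]

/-- Peel off the last factor by conditioning on `𝒢 n`. The bound `B` serves integrability only and
does not enter the conclusion. -/
theorem integral_exp_sum_le (𝒢 : Filtration ℕ mΩ) {M : ℕ} {Y : ℕ → Ω → ℝ} {B : ℝ}
    (hmeas : ∀ l < M, Measurable[𝒢 (l + 1)] (Y l)) (hbd : ∀ l < M, ∀ ω, |Y l ω| ≤ B)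
    (hcond : ∀ l < M, ℙ[fun ω => Real.exp (Y l ω) | 𝒢 l] ≤ᵐ[ℙ] fun _ => 1) :
    ∀ n ≤ M, ∫ ω, Real.exp (∑ l ∈ Finset.range n, Y l ω) ∂ℙ ≤ 1 := by
  intro n
  induction n with
  | zero => simp
  | succ n ih =>
    intro hn
    have hSm : ∀ k ≤ n, Measurable[𝒢 k] fun ω => ∑ l ∈ Finset.range k, Y l ω := by
      intro k hk
      refine Finset.measurable_sum _ fun l hl => ?_
      have hl' := Finset.mem_range.1 hl
      exact (hmeas l (by omega)).mono (𝒢.mono (by omega)) le_rfl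
    have hSn := hSm n le_rfl
    have hE : Measurable[𝒢 n] fun ω => Real.exp (∑ l ∈ Finset.range n, Y l ω) :=
      Real.measurable_exp.comp hSn
    have hYn : Measurable fun ω => Real.exp (Y n ω) :=
      Real.measurable_exp.comp ((hmeas n (by omega)).mono (𝒢.le _) le_rfl)
    have hSbd : ∀ ω, |∑ l ∈ Finset.range n, Y l ω| ≤ n * B := by
      intro ω
      refine (Finset.abs_sum_le_sum_abs _ _).trans ?_
      refine (Finset.sum_le_card_nsmul _ _ B fun l hl => hbd l (by
        have := Finset.mem_range.1 hl; omega) ω).trans ?_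
      simp
    have hiY : Integrable (fun ω => Real.exp (Y n ω)) ℙ := by
      refine Integrable.of_bound hYn.aestronglyMeasurable (Real.exp B) (ae_of_all _ fun ω => ?_)
      rw [Real.norm_eq_abs, Real.abs_exp]
      exact Real.exp_le_exp.2 ((le_abs_self _).trans (hbd n (by omega) ω))
    have hiS : Integrable (fun ω => Real.exp (∑ l ∈ Finset.range n, Y l ω)) ℙ := by
      refine Integrable.of_bound (hE.mono (𝒢.le _) le_rfl).aestronglyMeasurable (Real.exp (n * B))
        (ae_of_all _ fun ω => ?_)
      rw [Real.norm_eq_abs, Real.abs_exp]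
      exact Real.exp_le_exp.2 ((le_abs_self _).trans (hSbd ω))
    have hEb : ∀ᵐ ω ∂ℙ, ‖Real.exp (∑ l ∈ Finset.range n, Y l ω)‖ ≤ Real.exp (n * B) := by
      refine ae_of_all _ fun ω => ?_
      rw [Real.norm_eq_abs, Real.abs_exp]
      exact Real.exp_le_exp.2 ((le_abs_self _).trans (hSbd ω))
    have hpull := condExp_stronglyMeasurable_mul_of_bound (μ := ℙ) (𝒢.le n)
      hE.stronglyMeasurable hiY (Real.exp (n * B)) hEb
    have hsplit : (fun ω => Real.exp (∑ l ∈ Finset.range (n + 1), Y l ω)) =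
        (fun ω => Real.exp (∑ l ∈ Finset.range n, Y l ω)) * fun ω => Real.exp (Y n ω) := by
      funext ω
      simp [Finset.sum_range_succ, Real.exp_add]
    rw [hsplit, ← integral_condExp (𝒢.le n), integral_congr_ae hpull]
    refine (integral_mono_ae ?_ hiS ?_).trans (ih (by omega))
    · exact integrable_condExp.congr hpull
    · filter_upwards [hcond n (by omega)] with ω hω
      simp only [Pi.mul_apply]
      exact mul_le_of_le_one_right (Real.exp_pos _).le hω

theorem measureReal_le_sum_le (𝒢 : Filtration ℕ mΩ) {M : ℕ} {Y : ℕ → Ω → ℝ} {B : ℝ}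
    (hmeas : ∀ l < M, Measurable[𝒢 (l + 1)] (Y l)) (hbd : ∀ l < M, ∀ ω, |Y l ω| ≤ B)
    (hcond : ∀ l < M, ℙ[fun ω => Real.exp (Y l ω) | 𝒢 l] ≤ᵐ[ℙ] fun _ => 1) (ι : ℝ) :
    ℙ.real {ω | ι ≤ ∑ l ∈ Finset.range M, Y l ω} ≤ Real.exp (-ι) := by
  have h1 := integral_exp_sum_le 𝒢 hmeas hbd hcond M le_rfl
  have hm : Measurable fun ω => Real.exp (∑ l ∈ Finset.range M, Y l ω) :=
    Real.measurable_exp.comp (Finset.measurable_sum _ fun l hl =>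
      (hmeas l (Finset.mem_range.1 hl)).mono (𝒢.le _) le_rfl)
  have hi : Integrable (fun ω => Real.exp (∑ l ∈ Finset.range M, Y l ω)) ℙ := by
    refine Integrable.of_bound hm.aestronglyMeasurable (Real.exp (M * B)) (ae_of_all _ fun ω => ?_)
    rw [Real.norm_eq_abs, Real.abs_exp]
    refine Real.exp_le_exp.2 ((le_abs_self _).trans ((Finset.abs_sum_le_sum_abs _ _).trans ?_))
    refine (Finset.sum_le_card_nsmul _ _ B fun l hl => hbd l (Finset.mem_range.1 hl) ω).trans ?_
    simp
  have h2 := mul_meas_ge_le_integral_of_nonneg (ae_of_all ℙ fun ω => (Real.exp_pos _).le) hi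
    (Real.exp ι)
  simp only [Real.exp_le_exp] at h2
  have h3 := h2.trans h1
  rw [Real.exp_neg, ← one_div, le_div_iff₀' (Real.exp_pos _)]
  exact h3

/-- An adapted process with values in `[0, 1]`, together with its predictable compensator. -/
structure IsUnitProc (ℙ : Measure Ω) (𝒢 : Filtration ℕ mΩ) (M : ℕ) (U u : ℕ → Ω → ℝ) : Prop where
  U_meas : ∀ l < M, Measurable[𝒢 (l + 1)] (U l)
  U_mem : ∀ l < M, ∀ ω, U l ω ∈ Set.Icc (0 : ℝ) 1
  u_meas : ∀ l < M, Measurable[𝒢 l] (u l)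
  u_mem : ∀ l < M, ∀ ω, u l ω ∈ Set.Icc (0 : ℝ) 1
  cond : ∀ l < M, ℙ[U l | 𝒢 l] =ᵐ[ℙ] u l

namespace IsUnitProc

variable {𝒢 : Filtration ℕ mΩ} {M : ℕ} {U u : ℕ → Ω → ℝ}

theorem integrable (h : IsUnitProc ℙ 𝒢 M U u) {l : ℕ} (hl : l < M) : Integrable (U l) ℙ := by
  refine Integrable.of_bound ((h.U_meas l hl).mono (𝒢.le _) le_rfl).aestronglyMeasurable 1
    (ae_of_all _ fun ω => ?_)
  rw [Real.norm_eq_abs, abs_le]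
  constructor <;> linarith [(h.U_mem l hl ω).1, (h.U_mem l hl ω).2]

theorem one_sub (h : IsUnitProc ℙ 𝒢 M U u) :
    IsUnitProc ℙ 𝒢 M (fun l ω => 1 - U l ω) (fun l ω => 1 - u l ω) where
  U_meas l hl := measurable_const.sub (h.U_meas l hl)
  U_mem l hl ω := ⟨by linarith [(h.U_mem l hl ω).2], by linarith [(h.U_mem l hl ω).1]⟩
  u_meas l hl := measurable_const.sub (h.u_meas l hl)
  u_mem l hl ω := ⟨by linarith [(h.u_mem l hl ω).2], by linarith [(h.u_mem l hl ω).1]⟩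
  cond l hl := by
    have h1 := condExp_sub (μ := ℙ) (integrable_const (1 : ℝ)) (h.integrable hl) (𝒢 l)
    rw [condExp_const (𝒢.le l)] at h1
    filter_upwards [h1, h.cond l hl] with ω h1 h2
    have : ℙ[fun ω => 1 - U l ω | 𝒢 l] ω = 1 - ℙ[U l | 𝒢 l] ω := h1
    rw [this, h2]

/-- Comparing Σ(U − u)² with the empirical variance produces the cross term Σu(U − u). It is again
the deviation of a unit process, hence subject to the same Hoeffding bound. -/
theorem mul_compensator (h : IsUnitProc ℙ 𝒢 M U u) :
    IsUnitProc ℙ 𝒢 M (fun l ω => u l ω * U l ω) (fun l ω => u l ω * u l ω) where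
  U_meas l hl := ((h.u_meas l hl).mono (𝒢.mono (by omega)) le_rfl).mul (h.U_meas l hl)
  U_mem l hl ω := ⟨mul_nonneg (h.u_mem l hl ω).1 (h.U_mem l hl ω).1,
    mul_le_one₀ (h.u_mem l hl ω).2 (h.U_mem l hl ω).1 (h.U_mem l hl ω).2⟩
  u_meas l hl := (h.u_meas l hl).mul (h.u_meas l hl)
  u_mem l hl ω := ⟨mul_nonneg (h.u_mem l hl ω).1 (h.u_mem l hl ω).1,
    mul_le_one₀ (h.u_mem l hl ω).2 (h.u_mem l hl ω).1 (h.u_mem l hl ω).2⟩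
  cond l hl := by
    have hp := condExp_stronglyMeasurable_mul_of_bound (μ := ℙ) (𝒢.le l)
      (h.u_meas l hl).stronglyMeasurable (h.integrable hl) 1 (ae_of_all _ fun ω => by
        rw [Real.norm_eq_abs, abs_le]
        constructor <;> linarith [(h.u_mem l hl ω).1, (h.u_mem l hl ω).2])
    filter_upwards [hp, h.cond l hl] with ω h1 h2
    have : ℙ[fun ω => u l ω * U l ω | 𝒢 l] ω = u l ω * ℙ[U l | 𝒢 l] ω := h1
    rw [this, h2]

/-- One-step supermartingale condition: an affine majorant in `U l` with predictable coefficients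
can be integrated exactly, whatever the conditional law of `U l`. -/
theorem condExp_exp_le (h : IsUnitProc ℙ 𝒢 M U u) {l : ℕ} (hl : l < M) {Y c d : Ω → ℝ} {B : ℝ}
    (hY : Measurable[𝒢 (l + 1)] Y) (hYB : ∀ ω, |Y ω| ≤ B)
    (hc : Measurable[𝒢 l] c) (hd : Measurable[𝒢 l] d)
    (hcB : ∀ ω, |c ω| ≤ B) (hdB : ∀ ω, |d ω| ≤ B)
    (hle : ∀ ω, Real.exp (Y ω) ≤ c ω + d ω * U l ω) (hone : ∀ ω, c ω + d ω * u l ω ≤ 1) :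
    ℙ[fun ω => Real.exp (Y ω) | 𝒢 l] ≤ᵐ[ℙ] fun _ => 1 := by
  have hci : Integrable c ℙ := Integrable.of_bound
    (hc.mono (𝒢.le _) le_rfl).aestronglyMeasurable B (ae_of_all _ hcB)
  have hdi : Integrable (d * U l) ℙ := by
    refine Integrable.of_bound ((hd.mono (𝒢.le _) le_rfl).mul
      ((h.U_meas l hl).mono (𝒢.le _) le_rfl)).aestronglyMeasurable B (ae_of_all _ fun ω => ?_)
    rw [Pi.mul_apply, norm_mul, Real.norm_eq_abs, Real.norm_eq_abs]
    have h1 : |U l ω| ≤ 1 := by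
      rw [abs_le]; constructor <;> linarith [(h.U_mem l hl ω).1, (h.U_mem l hl ω).2]
    exact (mul_le_of_le_one_right (abs_nonneg _) h1).trans (hdB ω)
  have hYi : Integrable (fun ω => Real.exp (Y ω)) ℙ := by
    refine Integrable.of_bound (Real.measurable_exp.comp
      (hY.mono (𝒢.le _) le_rfl)).aestronglyMeasurable (Real.exp B) (ae_of_all _ fun ω => ?_)
    rw [Real.norm_eq_abs, Real.abs_exp]
    exact Real.exp_le_exp.2 ((le_abs_self _).trans (hYB ω))
  have hmono := condExp_mono (m := 𝒢 l) hYi (hci.add hdi) (ae_of_all _ hle)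
  have hadd := condExp_add hci hdi (𝒢 l)
  have hp := condExp_stronglyMeasurable_mul_of_bound (μ := ℙ) (𝒢.le l)
    hd.stronglyMeasurable (h.integrable hl) B (ae_of_all _ hdB)
  have hcc := condExp_of_stronglyMeasurable (μ := ℙ) (𝒢.le l) hc.stronglyMeasurable hci
  rw [hcc] at hadd
  filter_upwards [hmono, hadd, hp, h.cond l hl] with ω h1 h2 h3 h4
  refine h1.trans ?_
  rw [h2, Pi.add_apply, h3, Pi.mul_apply, h4]
  exact hone ω

end IsUnitProc
end Supermartingale

/-- The deviations of the sum of a unit process over `I` from its compensator are controlled, both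
in terms of the number of summands and in terms of their empirical variance. -/
def Conc (ι : ℝ) (I : Finset ℕ) (U u : ℕ → ℝ) : Prop :=
  |∑ l ∈ I, (U l - u l)| ≤ √(I.card * ι) ∧
  |∑ l ∈ I, (U l - u l)| ≤
    3 * √((∑ l ∈ I, U l ^ 2 - (∑ l ∈ I, U l) ^ 2 / I.card) * ι)
      + 6 * √(√(I.card * ι) * ι) + 4 * ι

/-- The empirical Bernstein inequality follows by choosing the best `k` in `h3`, and by replacing
the squares centred at the unobserved means `u l` with the observed variance; `h1` and `h2` bound
the price of that replacement. -/
theorem conc_of_bounds {ι : ℝ} (hι : 1 ≤ ι) {I : Finset ℕ} {M : ℕ} (hI : I ⊆ Finset.range M)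
    {U u : ℕ → ℝ} (hU : ∀ l ∈ I, U l ∈ Set.Icc (0 : ℝ) 1) (hu : ∀ l ∈ I, u l ∈ Set.Icc (0 : ℝ) 1)
    (h1 : |∑ l ∈ I, (U l - u l)| ≤ √(I.card * ι / 2))
    (h2 : |∑ l ∈ I, (u l * U l - u l * u l)| ≤ √(I.card * ι / 2))
    (h3 : ∀ k ∈ Finset.Icc 1 M, |∑ l ∈ I, (U l - u l)| ≤
      1 / (2 * k) * ∑ l ∈ I, (U l - u l) ^ 2 + 2 * k * ι) :
    Conc ι I U u := by
  rcases I.eq_empty_or_nonempty with rfl | hne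
  · constructor
    · simp
    · simp; linarith
  have hn : (0 : ℝ) < I.card := by exact_mod_cast hne.card_pos
  have hn1 : (1 : ℝ) ≤ I.card := by exact_mod_cast hne.card_pos
  have hcM : (I.card : ℝ) ≤ M := by exact_mod_cast (Finset.card_le_card hI).trans (by simp)
  have hsq : √(I.card * ι / 2) ≤ √(I.card * ι) :=
    Real.sqrt_le_sqrt (by nlinarith)
  refine ⟨h1.trans hsq, ?_⟩
  set n : ℝ := (I.card : ℝ) with hndef
  set W := ∑ l ∈ I, (U l - u l) ^ 2 with hW
  set SU := ∑ l ∈ I, U l with hSU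
  set Su := ∑ l ∈ I, u l with hSu
  set r := √(n * ι) with hr
  have hr0 : 0 ≤ r := Real.sqrt_nonneg _
  have hW0 : 0 ≤ W := Finset.sum_nonneg fun _ _ => sq_nonneg _
  have hWn : W ≤ n := by
    have : W ≤ ∑ l ∈ I, (1 : ℝ) := Finset.sum_le_sum fun l hl => by
      have a := hU l hl; have b := hu l hl
      rw [sq_le_one_iff_abs_le_one, abs_le]
      constructor <;> linarith [a.1, a.2, b.1, b.2]
    simpa using this
  have hX : ∑ l ∈ I, (U l - u l) = SU - Su := by rw [Finset.sum_sub_distrib]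
  have hWle : W ≤ (∑ l ∈ I, U l ^ 2 - SU ^ 2 / n) + 4 * r := by
    have e1 : W = ∑ l ∈ I, U l ^ 2 - 2 * ∑ l ∈ I, (u l * U l - u l * u l) - ∑ l ∈ I, u l ^ 2 := by
      rw [hW, Finset.mul_sum, ← Finset.sum_sub_distrib, ← Finset.sum_sub_distrib]
      exact Finset.sum_congr rfl fun l _ => by ring
    have e2 : Su ^ 2 / n ≤ ∑ l ∈ I, u l ^ 2 := by
      rw [div_le_iff₀ hn, mul_comm]
      exact sq_sum_le_card_mul_sum_sq
    have e3 : SU ^ 2 / n - Su ^ 2 / n ≤ 2 * r := by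
      rw [← sub_div, div_le_iff₀ hn]
      have b1 : SU ≤ n := by
        have : SU ≤ ∑ l ∈ I, (1 : ℝ) := Finset.sum_le_sum fun l hl => (hU l hl).2
        simpa using this
      have b2 : Su ≤ n := by
        have : Su ≤ ∑ l ∈ I, (1 : ℝ) := Finset.sum_le_sum fun l hl => (hu l hl).2
        simpa using this
      have b3 : 0 ≤ SU := Finset.sum_nonneg fun l hl => (hU l hl).1
      have b4 : 0 ≤ Su := Finset.sum_nonneg fun l hl => (hu l hl).1
      have b5 : SU - Su ≤ r := by rw [← hX]; exact (le_abs_self _).trans (h1.trans hsq)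
      nlinarith [mul_le_mul_of_nonneg_left b5 (add_nonneg b3 b4)]
    have e4 := (neg_le_of_abs_le (h2.trans hsq))
    linarith
  -- Optimization over the grid. If `W ≤ 4ι`, `k = 1` gives `4ι`. Otherwise take `k = ⌈z/2⌉` with `z
  -- = √(W/ι) > 2`: the two terms are at most `zι` and `2zι`, and `zι = √(Wι)`. Since `W ≤ n` and `ι
  -- ≥ 1`, `z ≤ n`, which keeps `k` within `M`.
  have hmain : |∑ l ∈ I, (U l - u l)| ≤ 3 * √(W * ι) + 4 * ι := by
    rcases le_or_gt W (4 * ι) with hc | hc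
    · have hM1 : 1 ≤ M := by
        have : (1 : ℝ) ≤ M := hn1.trans hcM
        exact_mod_cast this
      have := h3 1 (Finset.mem_Icc.2 ⟨le_rfl, hM1⟩)
      have h0 := Real.sqrt_nonneg (W * ι)
      rw [Nat.cast_one, mul_one] at this
      linarith
    · set z := √(W / ι) with hz
      have hz2 : 2 < z := by
        rw [hz, Real.lt_sqrt (by norm_num), lt_div_iff₀ (by linarith)]
        linarith
      have hzz : z ^ 2 = W / ι := Real.sq_sqrt (by positivity)
      have hWz : W = z ^ 2 * ι := by rw [hzz]; field_simp
      have hWι : √(W * ι) = z * ι := by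
        rw [hWz, show z ^ 2 * ι * ι = (z * ι) ^ 2 by ring]
        exact Real.sqrt_sq (by positivity)
      have hk1 : z / 2 ≤ ⌈z / 2⌉₊ := Nat.le_ceil _
      have hk2 : (⌈z / 2⌉₊ : ℝ) < z / 2 + 1 := Nat.ceil_lt_add_one (by linarith)
      have hzn : z ≤ n := by
        have : z ^ 2 ≤ n := by
          rw [hzz, div_le_iff₀ (by linarith)]
          nlinarith
        nlinarith
      have hkM : ⌈z / 2⌉₊ ≤ M := by
        have : (⌈z / 2⌉₊ : ℝ) ≤ M := by linarith
        exact_mod_cast this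
      have hk0 : 1 ≤ ⌈z / 2⌉₊ := Nat.one_le_iff_ne_zero.2 (by
        intro h0
        rw [h0] at hk1
        norm_num at hk1
        linarith)
      refine (h3 _ (Finset.mem_Icc.2 ⟨hk0, hkM⟩)).trans ?_
      rw [hWι]
      set k : ℝ := (⌈z / 2⌉₊ : ℝ)
      have t1 : 1 / (2 * k) * W ≤ z * ι := by
        rw [one_div, inv_mul_le_iff₀ (by linarith), hWz]
        have : 0 < z * ι := by positivity
        nlinarith
      have t2 : 2 * k * ι ≤ 2 * (z * ι) := by nlinarith
      linarith
  have hsub : √(W * ι) ≤ √((∑ l ∈ I, U l ^ 2 - SU ^ 2 / n) * ι) + 2 * √(r * ι) := by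
    have s1 : √(4 * (r * ι)) = 2 * √(r * ι) := by
      rw [Real.sqrt_mul (by norm_num), show (4 : ℝ) = 2 ^ 2 by norm_num,
        Real.sqrt_sq (by norm_num)]
    rw [← s1]
    have hA : W * ι ≤ (∑ l ∈ I, U l ^ 2 - SU ^ 2 / n) * ι + 4 * (r * ι) := by nlinarith
    refine (Real.sqrt_le_sqrt hA).trans ?_
    have hB0 : 0 ≤ 4 * (r * ι) := by positivity
    -- The sign of the empirical variance need not be known: `√` is `0` at negative arguments.
    rcases le_or_gt 0 ((∑ l ∈ I, U l ^ 2 - SU ^ 2 / n) * ι) with hp | hp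
    · rw [Real.sqrt_le_left (by positivity)]
      nlinarith [Real.sq_sqrt hp, Real.sq_sqrt hB0, mul_nonneg
        (Real.sqrt_nonneg ((∑ l ∈ I, U l ^ 2 - SU ^ 2 / n) * ι)) (Real.sqrt_nonneg (4 * (r * ι)))]
    · rw [Real.sqrt_eq_zero_of_nonpos hp.le, zero_add]
      exact Real.sqrt_le_sqrt (by linarith)
  linarith

/-! ### Tail bounds for sums over predictable random index sets. -/

section Prob

variable {Ω : Type*} {mΩ : MeasurableSpace Ω} {ℙ : Measure Ω} [IsProbabilityMeasure ℙ]
  {𝒢 : Filtration ℕ mΩ} {M : ℕ} {U u : ℕ → Ω → ℝ} {I : Ω → Finset ℕ}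

theorem sum_range_ite_mem {I : Finset ℕ} {M : ℕ} (hI : I ⊆ Finset.range M) (f : ℕ → ℝ) :
    ∑ l ∈ Finset.range M, (if l ∈ I then f l else 0) = ∑ l ∈ I, f l := by
  rw [← Finset.sum_filter, Finset.filter_mem_eq_inter, Finset.inter_eq_right.2 hI]

/-- The cardinality is frozen at `n` because the best exponent depends on it. With `x = √(8ι/n)`,
the deviation contributes `x√(nι/2) = 2ι` and the compensating term costs `n x²/8 = ι`, leaving `ι`.
-/
theorem IsUnitProc.hoeffding (h : IsUnitProc ℙ 𝒢 M U u) (hI : ∀ ω, I ω ⊆ Finset.range M)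
    (hIm : ∀ l < M, MeasurableSet[𝒢 l] {ω | l ∈ I ω}) {ι : ℝ} (hι : 1 ≤ ι) {n : ℕ} (hn : 1 ≤ n) :
    ℙ.real {ω | (I ω).card = n ∧ √(n * ι / 2) < ∑ l ∈ I ω, (U l ω - u l ω)} ≤ Real.exp (-ι) := by
  have hn0 : (0 : ℝ) < n := by exact_mod_cast hn
  set x := √(8 * ι / n) with hx
  have hx0 : 0 < x := Real.sqrt_pos.2 (by positivity)
  have hxx : x ^ 2 = 8 * ι / n := Real.sq_sqrt (by positivity)
  have hxs : x * √(n * ι / 2) = 2 * ι := by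
    rw [hx, ← Real.sqrt_mul (by positivity),
      show 8 * ι / n * (n * ι / 2) = (2 * ι) ^ 2 by field_simp; ring]
    exact Real.sqrt_sq (by linarith)
  classical
  -- Outside the index set the increment is `0`. Predictability of `I` makes the coefficients of the
  -- affine majorant predictable.
  set Y : ℕ → Ω → ℝ := fun l ω => if l ∈ I ω then x * (U l ω - u l ω) - x ^ 2 / 8 else 0 with hY
  have hUu : ∀ l < M, ∀ ω, |U l ω - u l ω| ≤ 1 := fun l hl ω => by
    rw [abs_le]
    constructor <;> linarith [(h.U_mem l hl ω).1, (h.U_mem l hl ω).2, (h.u_mem l hl ω).1,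
      (h.u_mem l hl ω).2]
  have hYm : ∀ l < M, Measurable[𝒢 (l + 1)] (Y l) := fun l hl => by
    refine Measurable.ite (𝒢.mono (Nat.le_succ l) _ (hIm l hl)) ?_ measurable_const
    exact (((h.U_meas l hl).sub ((h.u_meas l hl).mono (𝒢.mono (Nat.le_succ l)) le_rfl)).const_mul
      x).sub measurable_const
  have hYb : ∀ l < M, ∀ ω, |Y l ω| ≤ x + x ^ 2 / 8 := fun l hl ω => by
    simp only [hY]
    split_ifs
    · refine (abs_sub _ _).trans ?_
      rw [abs_mul, abs_of_pos hx0, abs_of_nonneg (by positivity : 0 ≤ x ^ 2 / 8)]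
      nlinarith [hUu l hl ω]
    · rw [abs_zero]; positivity
  refine le_trans (measureReal_mono ?_) (measureReal_le_sum_le 𝒢 hYm hYb ?_ ι)
  · rintro ω ⟨hc, hω⟩
    simp only [Set.mem_ofPred_eq, hY]
    rw [sum_range_ite_mem (hI ω), Finset.sum_sub_distrib, ← Finset.mul_sum, Finset.sum_const, hc,
      nsmul_eq_mul, hxx]
    have h1 := mul_le_mul_of_nonneg_left hω.le hx0.le
    rw [hxs] at h1
    have : (n : ℝ) * (8 * ι / n / 8) = ι := by field_simp
    linarith
  · intro l hl
    set c : Ω → ℝ := fun ω => if l ∈ I ω then Real.exp (-(x * u l ω) - x ^ 2 / 8) else 1 with hc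
    set d : Ω → ℝ := fun ω => if l ∈ I ω then
      Real.exp (-(x * u l ω) - x ^ 2 / 8) * (Real.exp x - 1) else 0 with hd
    have hem : Measurable[𝒢 l] fun ω => Real.exp (-(x * u l ω) - x ^ 2 / 8) :=
      Real.measurable_exp.comp ((((h.u_meas l hl).const_mul x).neg).sub measurable_const)
    have hle1 : ∀ ω, Real.exp (-(x * u l ω) - x ^ 2 / 8) ≤ 1 := fun ω => by
      rw [Real.exp_le_one_iff]
      nlinarith [(h.u_mem l hl ω).1, sq_nonneg x, mul_nonneg hx0.le (h.u_mem l hl ω).1]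
    have hex : 1 ≤ Real.exp x := Real.one_le_exp hx0.le
    refine h.condExp_exp_le hl (c := c) (d := d) (B := x + x ^ 2 / 8 + Real.exp x) (hYm l hl)
      (fun ω => (hYb l hl ω).trans (by linarith)) (Measurable.ite (hIm l hl) hem measurable_const)
      (Measurable.ite (hIm l hl) (hem.mul_const _) measurable_const) ?_ ?_ ?_ ?_
    · intro ω
      simp only [hc]
      split_ifs
      · rw [Real.abs_exp]; nlinarith [hle1 ω]
      · rw [abs_one]; nlinarith
    · intro ω
      simp only [hd]
      split_ifs
      · rw [abs_mul, Real.abs_exp, abs_of_nonneg (by linarith)]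
        nlinarith [hle1 ω, mul_le_of_le_one_left (sub_nonneg.2 hex) (hle1 ω)]
      · rw [abs_zero]; positivity
    · intro ω
      simp only [hY, hc, hd]
      split_ifs
      · have := exp_mul_le_chord (h.U_mem l hl ω) x
        rw [show x * (U l ω - u l ω) - x ^ 2 / 8 = (-(x * u l ω) - x ^ 2 / 8) + x * U l ω by ring,
          Real.exp_add]
        have := mul_le_mul_of_nonneg_left this (Real.exp_pos (-(x * u l ω) - x ^ 2 / 8)).le
        linarith
      · simp
    · intro ω
      simp only [hc, hd]
      split_ifs
      · have := bernoulli_mgf_le (h.u_mem l hl ω) x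
        have := mul_le_mul_of_nonneg_left this (Real.exp_pos (-(x * u l ω) - x ^ 2 / 8)).le
        rw [← Real.exp_add, show -(x * u l ω) - x ^ 2 / 8 + (x * u l ω + x ^ 2 / 8) = 0 by ring,
          Real.exp_zero] at this
        linarith
      · simp

/-- The exponent `1/(2k)` is deterministic and at most `1/2`, as `exp_sub_sq_le` requires. Letting
`k` range over a grid later replaces an illegitimate choice of exponent depending on the outcome. -/
theorem IsUnitProc.bernstein (h : IsUnitProc ℙ 𝒢 M U u) (hI : ∀ ω, I ω ⊆ Finset.range M)
    (hIm : ∀ l < M, MeasurableSet[𝒢 l] {ω | l ∈ I ω}) {ι : ℝ} {k : ℕ} (hk : 1 ≤ k) :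
    ℙ.real {ω | 1 / (2 * k) * ∑ l ∈ I ω, (U l ω - u l ω) ^ 2 + 2 * k * ι
      < ∑ l ∈ I ω, (U l ω - u l ω)} ≤ Real.exp (-ι) := by
  have hk0 : (1 : ℝ) ≤ k := by exact_mod_cast hk
  set x : ℝ := 1 / (2 * k) with hx
  have hx0 : 0 < x := by positivity
  have hx2 : x ≤ 1 / 2 := by
    rw [hx]
    exact one_div_le_one_div_of_le (by norm_num) (by linarith)
  have hxk : x * (2 * k) = 1 := by rw [hx]; field_simp
  classical
  set Y : ℕ → Ω → ℝ := fun l ω => if l ∈ I ω then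
    x * (U l ω - u l ω) - (x * (U l ω - u l ω)) ^ 2 else 0 with hY
  have hUu : ∀ l < M, ∀ ω, |x * (U l ω - u l ω)| ≤ 1 / 2 := fun l hl ω => by
    have : |U l ω - u l ω| ≤ 1 := by
      rw [abs_le]
      constructor <;> linarith [(h.U_mem l hl ω).1, (h.U_mem l hl ω).2, (h.u_mem l hl ω).1,
        (h.u_mem l hl ω).2]
    rw [abs_mul, abs_of_pos hx0]
    nlinarith [abs_nonneg (U l ω - u l ω)]
  have hYm : ∀ l < M, Measurable[𝒢 (l + 1)] (Y l) := fun l hl => by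
    refine Measurable.ite (𝒢.mono (Nat.le_succ l) _ (hIm l hl)) ?_ measurable_const
    have := ((h.U_meas l hl).sub ((h.u_meas l hl).mono (𝒢.mono (Nat.le_succ l)) le_rfl)).const_mul x
    exact this.sub (this.pow_const 2)
  have hYb : ∀ l < M, ∀ ω, |Y l ω| ≤ 1 := fun l hl ω => by
    simp only [hY]
    split_ifs
    · have := abs_le.1 (hUu l hl ω)
      rw [abs_le]
      constructor <;> nlinarith
    · simp
  refine le_trans (measureReal_mono ?_) (measureReal_le_sum_le 𝒢 hYm hYb ?_ ι)
  · intro ω hω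
    simp only [Set.mem_ofPred_eq, hY] at hω ⊢
    rw [sum_range_ite_mem (hI ω), Finset.sum_sub_distrib, ← Finset.mul_sum]
    simp_rw [mul_pow]
    rw [← Finset.mul_sum]
    have h1 := mul_le_mul_of_nonneg_left hω.le hx0.le
    have e : x * (x * ∑ l ∈ I ω, (U l ω - u l ω) ^ 2 + 2 * k * ι)
        = x ^ 2 * ∑ l ∈ I ω, (U l ω - u l ω) ^ 2 + (x * (2 * k)) * ι := by ring
    rw [e, hxk] at h1
    linarith
  · intro l hl
    set c : Ω → ℝ := fun ω => if l ∈ I ω then 1 - x * u l ω else 1 with hc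
    set d : Ω → ℝ := fun ω => if l ∈ I ω then x else 0 with hd
    have hux : ∀ ω, 0 ≤ x * u l ω ∧ x * u l ω ≤ 1 := fun ω => by
      constructor <;> nlinarith [(h.u_mem l hl ω).1, (h.u_mem l hl ω).2]
    refine h.condExp_exp_le hl (c := c) (d := d) (B := 1) (hYm l hl)
      (hYb l hl) (Measurable.ite (hIm l hl) (measurable_const.sub ((h.u_meas l hl).const_mul x))
        measurable_const)
      (Measurable.ite (hIm l hl) measurable_const measurable_const) ?_ ?_ ?_ ?_
    · intro ω
      simp only [hc]
      split_ifs
      · rw [abs_le]; constructor <;> linarith [(hux ω).1, (hux ω).2]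
      · simp
    · intro ω
      simp only [hd]
      split_ifs
      · rw [abs_of_pos hx0]; linarith
      · simp
    · intro ω
      simp only [hY, hc, hd]
      split_ifs
      · refine (exp_sub_sq_le (hUu l hl ω)).trans (le_of_eq ?_)
        ring
      · simp
    · intro ω
      simp only [hc, hd]
      split_ifs
      · linarith
      · simp

/-- The factor `6M` counts both tails of three families (Hoeffding for `U`, Hoeffding for `u·U`,
Bernstein for `U`), each over `M` values of the cardinality or of `k`. -/
theorem IsUnitProc.measureReal_not_conc_le (h : IsUnitProc ℙ 𝒢 M U u)
    (hI : ∀ ω, I ω ⊆ Finset.range M) (hIm : ∀ l < M, MeasurableSet[𝒢 l] {ω | l ∈ I ω})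
    {ι : ℝ} (hι : 1 ≤ ι) :
    ℙ.real {ω | ¬ Conc ι (I ω) (fun l => U l ω) (fun l => u l ω)} ≤ 6 * M * Real.exp (-ι) := by
  let ev : Fin 6 → ℕ → Set Ω := fun i n => match i with
    | 0 => {ω | (I ω).card = n ∧ √(n * ι / 2) < ∑ l ∈ I ω, (U l ω - u l ω)}
    | 1 => {ω | (I ω).card = n ∧ √(n * ι / 2) < ∑ l ∈ I ω, ((1 - U l ω) - (1 - u l ω))}
    | 2 => {ω | (I ω).card = n ∧ √(n * ι / 2) < ∑ l ∈ I ω, (u l ω * U l ω - u l ω * u l ω)}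
    | 3 => {ω | (I ω).card = n ∧
        √(n * ι / 2) < ∑ l ∈ I ω, ((1 - u l ω * U l ω) - (1 - u l ω * u l ω))}
    | 4 => {ω | 1 / (2 * n) * ∑ l ∈ I ω, (U l ω - u l ω) ^ 2 + 2 * n * ι
        < ∑ l ∈ I ω, (U l ω - u l ω)}
    | 5 => {ω | 1 / (2 * n) * ∑ l ∈ I ω, ((1 - U l ω) - (1 - u l ω)) ^ 2 + 2 * n * ι
        < ∑ l ∈ I ω, ((1 - U l ω) - (1 - u l ω))}
  have hev : ∀ i, ∀ n ∈ Finset.Icc 1 M, ℙ.real (ev i n) ≤ Real.exp (-ι) := by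
    intro i n hn
    have hn1 := (Finset.mem_Icc.1 hn).1
    fin_cases i
    · exact h.hoeffding hI hIm hι hn1
    · exact h.one_sub.hoeffding hI hIm hι hn1
    · exact h.mul_compensator.hoeffding hI hIm hι hn1
    · exact h.mul_compensator.one_sub.hoeffding hI hIm hι hn1
    · exact h.bernstein hI hIm hn1
    · exact h.one_sub.bernstein hI hIm hn1
  have hsub : {ω | ¬ Conc ι (I ω) (fun l => U l ω) (fun l => u l ω)} ⊆
      ⋃ x ∈ (Finset.univ : Finset (Fin 6)) ×ˢ Finset.Icc 1 M, ev x.1 x.2 := by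
    intro ω hω
    by_contra hcon
    simp only [Set.mem_iUnion, Finset.mem_product, Finset.mem_univ, true_and, not_exists,
      Prod.forall] at hcon
    apply hω
    have hneg : ∀ f g : ℕ → ℝ, ∑ l ∈ I ω, ((1 - f l) - (1 - g l)) = -∑ l ∈ I ω, (f l - g l) := by
      intro f g
      rw [← Finset.sum_neg_distrib]
      exact Finset.sum_congr rfl fun _ _ => by ring
    rcases Nat.eq_zero_or_pos (I ω).card with h0 | hpos
    · rw [Finset.card_eq_zero] at h0
      rw [h0]
      constructor
      · simp
      · simp; linarith
    have hcard : (I ω).card ∈ Finset.Icc 1 M :=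
      Finset.mem_Icc.2 ⟨hpos, (Finset.card_le_card (hI ω)).trans (by simp)⟩
    refine conc_of_bounds hι (hI ω) (fun l hl => h.U_mem l (Finset.mem_range.1 (hI ω hl)) ω)
      (fun l hl => h.u_mem l (Finset.mem_range.1 (hI ω hl)) ω) ?_ ?_ ?_
    · have a0 := hcon 0 _ hcard
      have a1 := hcon 1 _ hcard
      simp only [ev, Set.mem_ofPred_eq, true_and, not_lt, hneg] at a0 a1
      exact abs_le.2 ⟨by linarith, a0⟩
    · have a0 := hcon 2 _ hcard
      have a1 := hcon 3 _ hcard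
      simp only [ev, Set.mem_ofPred_eq, true_and, not_lt] at a0 a1
      rw [hneg (fun l => u l ω * U l ω)] at a1
      exact abs_le.2 ⟨by linarith, a0⟩
    · intro k hk
      have a0 := hcon 4 _ hk
      have a1 := hcon 5 _ hk
      simp only [ev, Set.mem_ofPred_eq, not_lt, hneg] at a0 a1
      have e : ∑ l ∈ I ω, ((1 - U l ω) - (1 - u l ω)) ^ 2 = ∑ l ∈ I ω, (U l ω - u l ω) ^ 2 :=
        Finset.sum_congr rfl fun _ _ => by ring
      rw [e] at a1
      exact abs_le.2 ⟨by linarith, a0⟩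
  refine (measureReal_mono hsub (measure_ne_top _ _)).trans ((measureReal_biUnion_finset_le _ _).trans ?_)
  refine (Finset.sum_le_card_nsmul _ _ (Real.exp (-ι)) fun x hx => hev x.1 x.2
    (Finset.mem_product.1 hx).2).trans (le_of_eq ?_)
  simp [mul_assoc]

end Prob

/-! ### The effect of one episode on one step of the tables -/

section Rows

set_option linter.unusedSectionVars false

variable {S A : Type*} [Fintype S] [DecidableEq S] [Fintype A] [DecidableEq A]

/-- The two tables have the same entries at step `h`. -/
structure Tables.RowAgree (x y : Tables S A) (h : ℕ) : Prop where
  Q : x.Q h = y.Q h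
  V : x.V h = y.V h
  N : x.N h = y.N h
  Nc : x.Nc h = y.Nc h
  rc : x.rc h = y.rc h
  vc : x.vc h = y.vc h
  muc : x.muc h = y.muc h
  sigc : x.sigc h = y.sigc h
  muref : x.muref h = y.muref h
  sigref : x.sigref h = y.sigref h
  Vref : x.Vref h = y.Vref h

theorem Tables.RowAgree.refl (x : Tables S A) (h : ℕ) : x.RowAgree x h := by
  constructor <;> rfl

theorem Tables.RowAgree.symm {x y : Tables S A} {h : ℕ} (g : x.RowAgree y h) : y.RowAgree x h :=
  ⟨g.Q.symm, g.V.symm, g.N.symm, g.Nc.symm, g.rc.symm, g.vc.symm, g.muc.symm, g.sigc.symm,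
    g.muref.symm, g.sigref.symm, g.Vref.symm⟩

theorem Tables.RowAgree.trans {x y z : Tables S A} {h : ℕ} (g : x.RowAgree y h)
    (k : y.RowAgree z h) : x.RowAgree z h :=
  ⟨g.Q.trans k.Q, g.V.trans k.V, g.N.trans k.N, g.Nc.trans k.Nc, g.rc.trans k.rc, g.vc.trans k.vc,
    g.muc.trans k.muc, g.sigc.trans k.sigc, g.muref.trans k.muref, g.sigref.trans k.sigref,
    g.Vref.trans k.Vref⟩

open Classical in
/-- `x'` is, at step `h`, the result of updating `x` with a sample of step `h`. -/
structure RowStep (H : ℕ) (p : Params A) (x x' : Tables S A) (h : ℕ) (s : S) (a : A) (R : ℝ)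
    (s' : S) : Prop where
  N : ∀ t b, x'.N h t b = if t = s ∧ b = a then x.N h s a + 1 else x.N h t b
  Nc : ∀ t b, x'.Nc h t b = if t = s ∧ b = a then
    (if x.N h s a + 1 ∈ stageEnds H then 0 else x.Nc h s a + 1) else x.Nc h t b
  rc : ∀ t b, x'.rc h t b = if t = s ∧ b = a then
    (if x.N h s a + 1 ∈ stageEnds H then 0 else x.rc h s a + R) else x.rc h t b
  vc : ∀ t b, x'.vc h t b = if t = s ∧ b = a then
    (if x.N h s a + 1 ∈ stageEnds H then 0 else x.vc h s a + x.V (h + 1) s') else x.vc h t b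
  muc : ∀ t b, x'.muc h t b = if t = s ∧ b = a then
    (if x.N h s a + 1 ∈ stageEnds H then 0 else x.muc h s a + (x.V (h + 1) s' - x.Vref (h + 1) s'))
      else x.muc h t b
  sigc : ∀ t b, x'.sigc h t b = if t = s ∧ b = a then
    (if x.N h s a + 1 ∈ stageEnds H then 0
      else x.sigc h s a + (x.V (h + 1) s' - x.Vref (h + 1) s') ^ 2) else x.sigc h t b
  muref : ∀ t b, x'.muref h t b = if t = s ∧ b = a then
    x.muref h s a + x.Vref (h + 1) s' else x.muref h t b
  sigref : ∀ t b, x'.sigref h t b = if t = s ∧ b = a then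
    x.sigref h s a + x.Vref (h + 1) s' ^ 2 else x.sigref h t b
  Q : ∀ t b, x'.Q h t b = if t = s ∧ b = a ∧ x.N h s a + 1 ∈ stageEnds H then
    newQ H p (x.record h s a R s') h s a else x.Q h t b
  V : ∀ t, x'.V h t = if t = s ∧ x.N h s a + 1 ∈ stageEnds H then ⨆ b, x'.Q h s b else x.V h t
  Vref : ∀ t, x'.Vref h t = if t = s ∧ ∑ b, x'.N h s b = p.N₀ then x'.V h s else x.Vref h t

theorem newQ_congr {H : ℕ} {p : Params A} {x y : Tables S A} {h : ℕ} (g : x.RowAgree y h) (s : S)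
    (a : A) : newQ H p x h s a = newQ H p y h s a := by
  simp only [newQ, freedmanBonus, g.Q, g.N, g.Nc, g.rc, g.vc, g.muc, g.sigc, g.muref, g.sigref]

theorem Tables.RowAgree.record {x y : Tables S A} {h : ℕ} (g : x.RowAgree y h)
    (gV : x.V (h + 1) = y.V (h + 1)) (gR : x.Vref (h + 1) = y.Vref (h + 1)) (s : S) (a : A) (R : ℝ)
    (s' : S) : (x.record h s a R s').RowAgree (y.record h s a R s') h := by
  constructor <;> first
    | exact g.Q
    | exact g.V
    | exact g.Vref
    | (funext t b
       simp [Tables.record, setEntry, g.N, g.Nc, g.rc, g.vc, g.muc, g.sigc, g.muref, g.sigref, gV,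
        gR])

/-- An update of row `h` reads nothing but row `h` and the entries `V` and `Vref` of row `h + 1`. -/
theorem RowStep.congr {H : ℕ} {p : Params A} {x x' y y' : Tables S A} {h : ℕ} {s : S} {a : A}
    {R : ℝ} {s' : S} (r : RowStep H p x x' h s a R s') (g : x.RowAgree y h)
    (gV : x.V (h + 1) = y.V (h + 1)) (gR : x.Vref (h + 1) = y.Vref (h + 1))
    (g' : x'.RowAgree y' h) : RowStep H p y y' h s a R s' := by
  have hq := newQ_congr (H := H) (p := p) (g.record gV gR s a R s') s a
  have eN : x.N h s a = y.N h s a := by rw [g.N]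
  obtain ⟨r1, r2, r3, r4, r5, r6, r7, r8, r9, r10, r11⟩ := r
  rw [eN] at r1 r2 r3 r4 r5 r6 r9 r10
  constructor
  · simpa only [g.N, g'.N] using r1
  · simpa only [g.N, g.Nc, g'.Nc] using r2
  · simpa only [g.N, g.rc, g'.rc] using r3
  · simpa only [g.N, g.vc, g'.vc, gV] using r4
  · simpa only [g.N, g.muc, g'.muc, gV, gR] using r5
  · simpa only [g.N, g.sigc, g'.sigc, gV, gR] using r6
  · simpa only [g.N, g.muref, g'.muref, gR] using r7
  · simpa only [g.N, g.sigref, g'.sigref, gR] using r8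
  · simpa only [g.Q, g'.Q, hq] using r9
  · simpa only [g.V, g'.V, g'.Q] using r10
  · simpa only [g'.N, g'.V, g.Vref, g'.Vref] using r11

theorem Tables.update_rowAgree (H : ℕ) (p : Params A) (x : Tables S A) {h h' : ℕ} (hne : h' ≠ h)
    (s : S) (a : A) (R : ℝ) (s' : S) : (x.update H p h s a R s').RowAgree x h' := by
  have e1 : ∀ {α : Type} (f : ℕ → S → A → α) (v : α), setEntry f h s a v h' = f h' := by
    intro α f v
    funext t b
    simp [setEntry, hne]
  have e2 : ∀ (f : ℕ → S → ℝ) (v : ℝ), setEntry₂ f h s v h' = f h' := by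
    intro f v
    funext t
    simp [setEntry₂, hne]
  unfold Tables.update Tables.learnRef
  constructor <;> (dsimp only; split_ifs <;>
    simp only [Tables.endStage, Tables.record, e1, e2])

theorem Tables.rowStep_update (H : ℕ) (p : Params A) (x : Tables S A) (h : ℕ)
    (s : S) (a : A) (R : ℝ) (s' : S) : RowStep H p x (x.update H p h s a R s') h s a R s' := by
  have hN : (x.record h s a R s').N h s a = x.N h s a + 1 := by simp [Tables.record, setEntry]
  unfold Tables.update Tables.learnRef
  dsimp only
  rw [hN]
  constructor
  case Vref =>
    intro t
    by_cases hE : x.N h s a + 1 ∈ stageEnds H <;> simp only [hE, if_true, if_false]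
    · by_cases hS : ∑ b, ((x.record h s a R s').endStage H p h s a).N h s b = p.N₀ <;>
        simp only [hS, if_true, if_false, and_true, and_false]
      · simp [setEntry₂, Tables.endStage, Tables.record]
      · simp [Tables.endStage, Tables.record]
    · by_cases hS : ∑ b, (x.record h s a R s').N h s b = p.N₀ <;>
        simp only [hS, if_true, if_false, and_true, and_false]
      · simp [setEntry₂, Tables.record]
      · simp [Tables.record]
  all_goals
    by_cases hE : x.N h s a + 1 ∈ stageEnds H <;> simp only [hE, if_true, if_false] <;>
    split_ifs <;> simp [Tables.endStage, Tables.record, setEntry, setEntry₂] <;>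
    intro t <;> (try intro b) <;> split_ifs <;> simp_all

theorem withinEpisode_rowAgree_of_le (H : ℕ) (p : Params A) (x : Tables S A) (s : ℕ → S)
    (a : ℕ → A) (R : ℕ → ℝ) {j h : ℕ} (hj : j ≤ h) :
    (withinEpisode H p x s a R j).RowAgree x h := by
  induction j with
  | zero => exact .refl _ _
  | succ j ih =>
    exact (Tables.update_rowAgree H p _ (by omega) _ _ _ _).trans (ih (by omega))

theorem withinEpisode_rowAgree_of_gt (H : ℕ) (p : Params A) (x : Tables S A) (s : ℕ → S)
    (a : ℕ → A) (R : ℕ → ℝ) {j h : ℕ} (hj : h + 1 ≤ j) :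
    (withinEpisode H p x s a R j).RowAgree (withinEpisode H p x s a R (h + 1)) h := by
  induction j, hj using Nat.le_induction with
  | base => exact .refl _ _
  | succ j hj ih =>
    exact (Tables.update_rowAgree H p _ (by omega) _ _ _ _).trans ih

/-- Row `h` changes only at step `h`, when row `h + 1` is still as at the start of the episode. A
whole episode therefore acts on row `h` as one update of the initial tables. -/
theorem rowStep_withinEpisode (H : ℕ) (p : Params A) (x : Tables S A) (s : ℕ → S)
    (a : ℕ → A) (R : ℕ → ℝ) {h : ℕ} (hh : h < H) :
    RowStep H p x (withinEpisode H p x s a R H) h (s h) (a h) (R h) (s (h + 1)) := by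
  have g := withinEpisode_rowAgree_of_le H p x s a R (le_refl h)
  have g1 := withinEpisode_rowAgree_of_le H p x s a R (Nat.le_succ h)
  exact (Tables.rowStep_update H p (withinEpisode H p x s a R h) h (s h) (a h) (R h)
    (s (h + 1))).congr g g1.V g1.Vref (withinEpisode_rowAgree_of_gt H p x s a R hh).symm

theorem withinEpisode_V_ge (H : ℕ) (p : Params A) (x : Tables S A) (s : ℕ → S)
    (a : ℕ → A) (R : ℕ → ℝ) {h : ℕ} (hh : H ≤ h) :
    (withinEpisode H p x s a R H).RowAgree x h :=
  withinEpisode_rowAgree_of_le H p x s a R hh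

theorem greedy_congr (p : Params A) {x y : Tables S A} {h : ℕ} (g : x.RowAgree y h) (s : S) :
    greedy p x h s = greedy p y h s := by
  simp only [greedy, g.Q]

end Rows

/-! ### Stages -/

/-- The number of visits before stage `j` (stages being numbered from `0`). -/
def stageStart (H j : ℕ) : ℕ := ∑ i ∈ Finset.range j, stageLength H i

theorem stageStart_succ (H j : ℕ) : stageStart H (j + 1) = stageStart H j + stageLength H j :=
  Finset.sum_range_succ _ _

theorem le_stageLength {H : ℕ} (j : ℕ) : H ≤ stageLength H j := by
  induction j with
  | zero => exact le_rfl
  | succ j ih =>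
    refine ih.trans (Nat.le_floor ?_)
    have : (0 : ℝ) ≤ 1 / (H : ℝ) * stageLength H j := by positivity
    linarith

theorem stageLength_succ_le {H : ℕ} (hH : 0 < H) (j : ℕ) :
    stageLength H (j + 1) ≤ 2 * stageLength H j := by
  have h1 : (1 : ℝ) ≤ H := by exact_mod_cast hH
  have h2 : 1 / (H : ℝ) ≤ 1 := by rw [div_le_one (by linarith)]; exact h1
  have h3 : ((stageLength H (j + 1) : ℕ) : ℝ) ≤ (1 + 1 / (H : ℝ)) * stageLength H j :=
    Nat.floor_le (by positivity)
  have h4 : ((stageLength H (j + 1) : ℕ) : ℝ) ≤ 2 * stageLength H j := by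
    have : (0 : ℝ) ≤ stageLength H j := by positivity
    nlinarith
  exact_mod_cast h4

/-- The floor costs at most half of the increment: as `e ≥ H`, `⌊e/H⌋ ≥ 1`, and so `⌊e/H⌋ ≥ e/(2H)`.
-/
theorem stageLength_growth {H : ℕ} (hH : 0 < H) (j : ℕ) :
    (1 + 1 / (2 * H : ℝ)) * stageLength H j ≤ stageLength H (j + 1) := by
  have h1 : (1 : ℝ) ≤ H := by exact_mod_cast hH
  have h2 : (H : ℝ) ≤ stageLength H j := by exact_mod_cast le_stageLength j
  set e : ℝ := ((stageLength H j : ℕ) : ℝ) with he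
  have hd : (stageLength H j / H + stageLength H j : ℕ) ≤ stageLength H (j + 1) := by
    refine Nat.le_floor ?_
    push_cast
    have : ((stageLength H j / H : ℕ) : ℝ) ≤ e / H := Nat.cast_div_le
    rw [add_mul, one_mul, one_div_mul_eq_div]
    linarith
  have hd' : ((stageLength H j / H : ℕ) : ℝ) + e ≤ stageLength H (j + 1) := by
    rw [he]
    exact_mod_cast hd
  have hq : e / (2 * H) ≤ ((stageLength H j / H : ℕ) : ℝ) := by
    have h3 : 1 ≤ stageLength H j / H := (Nat.one_le_div_iff hH).2 (le_stageLength j)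
    have h4 : stageLength H j < H * (stageLength H j / H + 1) := Nat.lt_mul_div_succ _ hH
    have h5 : stageLength H j ≤ 2 * H * (stageLength H j / H) := by nlinarith
    have h6 : e ≤ 2 * H * ((stageLength H j / H : ℕ) : ℝ) := by
      rw [he]
      exact_mod_cast h5
    rw [div_le_iff₀ (by linarith)]
    linarith
  have : (1 + 1 / (2 * H : ℝ)) * e = e + e / (2 * H) := by ring
  linarith

/-- Stages grow geometrically with ratio at least `1 + 1/(2H)`, so the time elapsed is at most `2H`
times the current stage. -/
theorem stageStart_le {H : ℕ} (hH : 0 < H) (j : ℕ) :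
    (stageStart H j : ℝ) ≤ 2 * H * stageLength H j := by
  have h1 : (1 : ℝ) ≤ H := by exact_mod_cast hH
  induction j with
  | zero =>
    rw [stageStart, Finset.range_zero, Finset.sum_empty, Nat.cast_zero]
    positivity
  | succ j ih =>
    have hg := stageLength_growth hH j
    rw [stageStart_succ]
    push_cast
    have h2 : 2 * (H : ℝ) * ((1 + 1 / (2 * H : ℝ)) * stageLength H j)
        = 2 * H * stageLength H j + stageLength H j := by field_simp
    nlinarith

/-- Telescoping: each `√e_j` is at most `4H` times the increment of the square root of the elapsed
visits. -/
theorem sum_sqrt_stageLength_le {H : ℕ} (hH : 0 < H) (j : ℕ) :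
    ∑ i ∈ Finset.range j, √(stageLength H i) ≤ 4 * H * √(stageStart H j) := by
  have h1 : (1 : ℝ) ≤ H := by exact_mod_cast hH
  induction j with
  | zero => simp [stageStart]
  | succ j ih =>
    rw [Finset.sum_range_succ]
    have hs : (stageStart H (j + 1) : ℝ) = stageStart H j + stageLength H j := by
      rw [stageStart_succ]; push_cast; ring
    set a := √(stageStart H j : ℝ)
    set b := √(stageStart H (j + 1) : ℝ)
    set c := √(stageLength H j : ℝ)
    have ha : a ^ 2 = stageStart H j := Real.sq_sqrt (by positivity)
    have hb : b ^ 2 = stageStart H (j + 1) := Real.sq_sqrt (by positivity)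
    have hc : c ^ 2 = stageLength H j := Real.sq_sqrt (by positivity)
    have ha0 : 0 ≤ a := Real.sqrt_nonneg _
    have hb0 : 0 ≤ b := Real.sqrt_nonneg _
    have hc0 : 0 < c := Real.sqrt_pos.2 (by
      have : 0 < stageLength H j := lt_of_lt_of_le hH (le_stageLength j)
      exact_mod_cast this)
    have hab : b ^ 2 = a ^ 2 + c ^ 2 := by rw [ha, hb, hc, hs]
    have hle : b ^ 2 ≤ 4 * H * c ^ 2 := by
      have hl := stageStart_le hH (j + 1)
      have h2 : ((stageLength H (j + 1) : ℕ) : ℝ) ≤ 2 * stageLength H j := by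
        exact_mod_cast stageLength_succ_le hH j
      rw [hb, hc]
      nlinarith
    have hab' : a ≤ b := by nlinarith
    have hbc : b ≤ 2 * H * c := by
      have : b ^ 2 ≤ (2 * H * c) ^ 2 := by nlinarith [mul_nonneg (sub_nonneg.2 h1) (sq_nonneg c)]
      exact (sq_le_sq₀ hb0 (by positivity)).1 this
    -- Difference of squares: `(b - a)(b + a) = c²`, while `a ≤ b ≤ 2Hc` bounds the second factor by
    -- `4Hc`.
    have hkey : c ≤ 4 * H * (b - a) := by
      have e1 : (b - a) * (b + a) = c ^ 2 := by linarith
      have e2 : b + a ≤ 4 * H * c := by linarith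
      have e3 : 0 ≤ b - a := by linarith
      have e4 : c * c ≤ 4 * H * (b - a) * c := by nlinarith
      exact le_of_mul_le_mul_right e4 hc0
    linarith

theorem stageStart_strictMono {H : ℕ} (hH : 0 < H) : StrictMono (stageStart H) :=
  strictMono_nat_of_lt_succ fun j => by
    rw [stageStart_succ]
    have := lt_of_lt_of_le hH (le_stageLength (H := H) j)
    omega

theorem stageStart_add_mem_stageEnds_iff {H : ℕ} (hH : 0 < H) {j c : ℕ} (hc : c < stageLength H j) :
    stageStart H j + c + 1 ∈ stageEnds H ↔ c + 1 = stageLength H j := by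
  have hm := stageStart_strictMono hH
  constructor
  · rintro ⟨i, -, hi⟩
    change _ = stageStart H i at hi
    have h1 : stageStart H j < stageStart H i := by omega
    have h2 : stageStart H i ≤ stageStart H (j + 1) := by rw [stageStart_succ]; omega
    have h3 := hm.lt_iff_lt.1 h1
    have h4 := hm.le_iff_le.1 h2
    obtain rfl : i = j + 1 := by omega
    rw [stageStart_succ] at hi
    omega
  · intro h
    refine ⟨j + 1, by omega, ?_⟩
    change _ = stageStart H (j + 1)
    rw [stageStart_succ]
    omega

/-! ### The episodes in which a state-action pair is visited. -/

section Visits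

variable {S A : Type*} [DecidableEq S] [DecidableEq A]

/-- The episodes `l ∈ [l₀, m)` in which action `b` is taken in state `t` at step `h`. -/
def visits (s : ℕ → ℕ → S) (a : ℕ → ℕ → A) (h : ℕ) (t : S) (b : A) (l₀ m : ℕ) : Finset ℕ :=
  (Finset.Ico l₀ m).filter fun l => t = s l h ∧ b = a l h

variable {s : ℕ → ℕ → S} {a : ℕ → ℕ → A} {h : ℕ} {t : S} {b : A} {l₀ m : ℕ}

theorem mem_visits {l : ℕ} :
    l ∈ visits s a h t b l₀ m ↔ (l₀ ≤ l ∧ l < m) ∧ t = s l h ∧ b = a l h := by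
  simp [visits]

theorem visits_self : visits s a h t b m m = ∅ := by simp [visits]

theorem visits_succ_of_not (hv : ¬(t = s m h ∧ b = a m h)) :
    visits s a h t b l₀ (m + 1) = visits s a h t b l₀ m := by
  ext l
  simp only [mem_visits]
  constructor
  · rintro ⟨⟨h1, h2⟩, h3⟩
    refine ⟨⟨h1, ?_⟩, h3⟩
    rcases Nat.lt_succ_iff_lt_or_eq.1 h2 with h4 | rfl
    · exact h4
    · exact absurd h3 hv
  · rintro ⟨⟨h1, h2⟩, h3⟩
    exact ⟨⟨h1, by omega⟩, h3⟩

theorem visits_succ (hl : l₀ ≤ m) (hv : t = s m h ∧ b = a m h) :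
    visits s a h t b l₀ (m + 1) = insert m (visits s a h t b l₀ m) := by
  ext l
  simp only [mem_visits, Finset.mem_insert]
  constructor
  · rintro ⟨⟨h1, h2⟩, h3⟩
    rcases Nat.lt_succ_iff_lt_or_eq.1 h2 with h4 | rfl
    · exact Or.inr ⟨⟨h1, h4⟩, h3⟩
    · exact Or.inl rfl
  · rintro (rfl | ⟨⟨h1, h2⟩, h3⟩)
    · exact ⟨⟨hl, by omega⟩, hv⟩
    · exact ⟨⟨h1, by omega⟩, h3⟩

theorem notMem_visits : m ∉ visits s a h t b l₀ m := by simp [mem_visits]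

theorem card_visits_succ (hl : l₀ ≤ m) (hv : t = s m h ∧ b = a m h) :
    (visits s a h t b l₀ (m + 1)).card = (visits s a h t b l₀ m).card + 1 := by
  rw [visits_succ hl hv, Finset.card_insert_of_notMem notMem_visits]

theorem sum_visits_succ (hl : l₀ ≤ m) (hv : t = s m h ∧ b = a m h) (f : ℕ → ℝ) :
    ∑ l ∈ visits s a h t b l₀ (m + 1), f l = ∑ l ∈ visits s a h t b l₀ m, f l + f m := by
  rw [visits_succ hl hv, Finset.sum_insert notMem_visits, add_comm]

theorem visits_union {m₀ : ℕ} (h1 : m₀ ≤ l₀) (h2 : l₀ ≤ m) :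
    visits s a h t b m₀ m = visits s a h t b m₀ l₀ ∪ visits s a h t b l₀ m := by
  rw [visits, visits, visits, ← Finset.filter_union, Finset.Ico_union_Ico_eq_Ico h1 h2]

theorem disjoint_visits {m₀ : ℕ} :
    Disjoint (visits s a h t b m₀ l₀) (visits s a h t b l₀ m) := by
  rw [Finset.disjoint_left]
  intro l h1 h2
  have := (mem_visits.1 h1).1.2
  have := (mem_visits.1 h2).1.1
  omega

theorem sum_visits_consecutive {m₀ : ℕ} (h1 : m₀ ≤ l₀) (h2 : l₀ ≤ m) (f : ℕ → ℝ) :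
    ∑ l ∈ visits s a h t b m₀ m, f l
      = ∑ l ∈ visits s a h t b m₀ l₀, f l + ∑ l ∈ visits s a h t b l₀ m, f l := by
  rw [visits_union h1 h2, Finset.sum_union disjoint_visits]

theorem card_visits_consecutive {m₀ : ℕ} (h1 : m₀ ≤ l₀) (h2 : l₀ ≤ m) :
    (visits s a h t b m₀ m).card
      = (visits s a h t b m₀ l₀).card + (visits s a h t b l₀ m).card := by
  rw [visits_union h1 h2, Finset.card_union_of_disjoint disjoint_visits]

end Visits

/-! ### The tables in one epoch -/

section Run

variable {S A : Type*} [Fintype S] [DecidableEq S] [Fintype A] [DecidableEq A]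

set_option linter.unusedSectionVars false

/-- `x m` are the tables at the beginning of episode `m` of an epoch that starts in episode `m₀`
(continued without restarts). -/
structure IsRun (H : ℕ) (p : Params A) (m₀ : ℕ) (x : ℕ → Tables S A) (s : ℕ → ℕ → S)
    (a : ℕ → ℕ → A) (R : ℕ → ℕ → ℝ) : Prop where
  init : x m₀ = Tables.init S A H
  step : ∀ m, m₀ ≤ m → ∀ h < H,
    RowStep H p (x m) (x (m + 1)) h (s m h) (a m h) (R m h) (s m (h + 1))
  last : ∀ m, m₀ ≤ m → (x (m + 1)).RowAgree (x m) H

/-- The accumulators of `(h, t, b)` before episode `m`, stage `j` being in progress since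
episode `l₀`. -/
structure StageInfo (H : ℕ) (m₀ : ℕ) (x : ℕ → Tables S A) (s : ℕ → ℕ → S)
    (a : ℕ → ℕ → A) (R : ℕ → ℕ → ℝ) (h : ℕ) (t : S) (b : A) (m l₀ j : ℕ) : Prop where
  ge : m₀ ≤ l₀
  le : l₀ ≤ m
  N_eq : (x m).N h t b = stageStart H j + (x m).Nc h t b
  Nc_lt : (x m).Nc h t b < stageLength H j
  N : (x m).N h t b = (visits s a h t b m₀ m).card
  Nc : (x m).Nc h t b = (visits s a h t b l₀ m).card
  rc : (x m).rc h t b = ∑ l ∈ visits s a h t b l₀ m, R l h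
  vc : (x m).vc h t b = ∑ l ∈ visits s a h t b l₀ m, (x l).V (h + 1) (s l (h + 1))
  muc : (x m).muc h t b = ∑ l ∈ visits s a h t b l₀ m,
    ((x l).V (h + 1) (s l (h + 1)) - (x l).Vref (h + 1) (s l (h + 1)))
  sigc : (x m).sigc h t b = ∑ l ∈ visits s a h t b l₀ m,
    ((x l).V (h + 1) (s l (h + 1)) - (x l).Vref (h + 1) (s l (h + 1))) ^ 2
  muref : (x m).muref h t b = ∑ l ∈ visits s a h t b m₀ m, (x l).Vref (h + 1) (s l (h + 1))
  sigref : (x m).sigref h t b = ∑ l ∈ visits s a h t b m₀ m, (x l).Vref (h + 1) (s l (h + 1)) ^ 2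

variable {H : ℕ} {p : Params A} {m₀ : ℕ} {x : ℕ → Tables S A} {s : ℕ → ℕ → S} {a : ℕ → ℕ → A}
  {R : ℕ → ℕ → ℝ}

namespace IsRun

theorem stageInfo_start (r : IsRun H p m₀ x s a R) (hH : 0 < H) (h : ℕ) (t : S) (b : A) :
    StageInfo H m₀ x s a R h t b m₀ m₀ 0 := by
  constructor <;> simp [r.init, Tables.init, visits_self, stageStart, stageLength, hH]

theorem stageInfo_of_not (r : IsRun H p m₀ x s a R) {h : ℕ} (hh : h < H) {t : S} {b : A}
    {m l₀ j : ℕ} (i : StageInfo H m₀ x s a R h t b m l₀ j) (hv : ¬(t = s m h ∧ b = a m h)) :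
    StageInfo H m₀ x s a R h t b (m + 1) l₀ j := by
  have st := r.step m (i.ge.trans i.le) h hh
  constructor
  · exact i.ge
  · exact i.le.trans (by omega)
  · rw [st.N, st.Nc, if_neg hv, if_neg hv]; exact i.N_eq
  · rw [st.Nc, if_neg hv]; exact i.Nc_lt
  · rw [st.N, if_neg hv, visits_succ_of_not hv]; exact i.N
  · rw [st.Nc, if_neg hv, visits_succ_of_not hv]; exact i.Nc
  · rw [st.rc, if_neg hv, visits_succ_of_not hv]; exact i.rc
  · rw [st.vc, if_neg hv, visits_succ_of_not hv]; exact i.vc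
  · rw [st.muc, if_neg hv, visits_succ_of_not hv]; exact i.muc
  · rw [st.sigc, if_neg hv, visits_succ_of_not hv]; exact i.sigc
  · rw [st.muref, if_neg hv, visits_succ_of_not hv]; exact i.muref
  · rw [st.sigref, if_neg hv, visits_succ_of_not hv]; exact i.sigref

theorem _root_.TeamRL.StageInfo.mem_stageEnds_iff (hH : 0 < H) {h : ℕ} {t : S} {b : A}
    {m l₀ j : ℕ} (i : StageInfo H m₀ x s a R h t b m l₀ j) :
    (x m).N h t b + 1 ∈ stageEnds H ↔ (x m).Nc h t b + 1 = stageLength H j := by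
  rw [i.N_eq]
  exact stageStart_add_mem_stageEnds_iff hH i.Nc_lt

theorem stageInfo_of_visit (r : IsRun H p m₀ x s a R) (hH : 0 < H) {h : ℕ} (hh : h < H)
    {m l₀ j : ℕ} (i : StageInfo H m₀ x s a R h (s m h) (a m h) m l₀ j)
    (hE : (x m).Nc h (s m h) (a m h) + 1 ≠ stageLength H j) :
    StageInfo H m₀ x s a R h (s m h) (a m h) (m + 1) l₀ j := by
  have st := r.step m (i.ge.trans i.le) h hh
  have hE' := mt (i.mem_stageEnds_iff hH).1 hE
  have hv : s m h = s m h ∧ a m h = a m h := ⟨rfl, rfl⟩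
  have h1 := i.ge.trans i.le
  have hlt := i.Nc_lt
  constructor
  · exact i.ge
  · exact i.le.trans (by omega)
  · rw [st.N, st.Nc, if_pos hv, if_pos hv, if_neg hE', i.N_eq]; ring
  · rw [st.Nc, if_pos hv, if_neg hE']; omega
  · rw [st.N, if_pos hv, card_visits_succ h1 hv, ← i.N]
  · rw [st.Nc, if_pos hv, if_neg hE', card_visits_succ i.le hv, ← i.Nc]
  · rw [st.rc, if_pos hv, if_neg hE', sum_visits_succ i.le hv, ← i.rc]
  · rw [st.vc, if_pos hv, if_neg hE', sum_visits_succ i.le hv, ← i.vc]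
  · rw [st.muc, if_pos hv, if_neg hE', sum_visits_succ i.le hv, ← i.muc]
  · rw [st.sigc, if_pos hv, if_neg hE', sum_visits_succ i.le hv, ← i.sigc]
  · rw [st.muref, if_pos hv, sum_visits_succ h1 hv, ← i.muref]
  · rw [st.sigref, if_pos hv, sum_visits_succ h1 hv, ← i.sigref]

theorem stageInfo_of_end (r : IsRun H p m₀ x s a R) (hH : 0 < H) {h : ℕ} (hh : h < H)
    {m l₀ j : ℕ} (i : StageInfo H m₀ x s a R h (s m h) (a m h) m l₀ j)
    (hE : (x m).Nc h (s m h) (a m h) + 1 = stageLength H j) :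
    StageInfo H m₀ x s a R h (s m h) (a m h) (m + 1) (m + 1) (j + 1) := by
  have st := r.step m (i.ge.trans i.le) h hh
  have hE' := (i.mem_stageEnds_iff hH).2 hE
  have hv : s m h = s m h ∧ a m h = a m h := ⟨rfl, rfl⟩
  have h1 := i.ge.trans i.le
  constructor
  · omega
  · exact le_rfl
  · rw [st.N, st.Nc, if_pos hv, if_pos hv, if_pos hE', i.N_eq, stageStart_succ]; omega
  · rw [st.Nc, if_pos hv, if_pos hE']
    exact lt_of_lt_of_le hH (le_stageLength _)
  · rw [st.N, if_pos hv, card_visits_succ h1 hv, ← i.N]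
  · rw [st.Nc, if_pos hv, if_pos hE', visits_self, Finset.card_empty]
  · rw [st.rc, if_pos hv, if_pos hE', visits_self, Finset.sum_empty]
  · rw [st.vc, if_pos hv, if_pos hE', visits_self, Finset.sum_empty]
  · rw [st.muc, if_pos hv, if_pos hE', visits_self, Finset.sum_empty]
  · rw [st.sigc, if_pos hv, if_pos hE', visits_self, Finset.sum_empty]
  · rw [st.muref, if_pos hv, sum_visits_succ h1 hv, ← i.muref]
  · rw [st.sigref, if_pos hv, sum_visits_succ h1 hv, ← i.sigref]

/-- The stage start `l₀` depends on the history, which is why concentration is later required for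
every window `[l₀, m)`. -/
theorem exists_stageInfo (r : IsRun H p m₀ x s a R) (hH : 0 < H) {h : ℕ} (hh : h < H) (t : S)
    (b : A) {m : ℕ} (hm : m₀ ≤ m) : ∃ l₀ j, StageInfo H m₀ x s a R h t b m l₀ j := by
  induction m, hm using Nat.le_induction with
  | base => exact ⟨_, _, r.stageInfo_start hH h t b⟩
  | succ m hm ih =>
    obtain ⟨l₀, j, i⟩ := ih
    by_cases hv : t = s m h ∧ b = a m h
    · obtain ⟨rfl, rfl⟩ := hv
      by_cases hE : (x m).Nc h (s m h) (a m h) + 1 = stageLength H j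
      · exact ⟨_, _, r.stageInfo_of_end hH hh i hE⟩
      · exact ⟨_, _, r.stageInfo_of_visit hH hh i hE⟩
    · exact ⟨_, _, r.stageInfo_of_not hh i hv⟩

/-! #### Monotonicity -/

theorem _root_.TeamRL.newQ_le_Q (H : ℕ) (p : Params A) (y : Tables S A) (h : ℕ) (s : S) (a : A) :
    newQ H p y h s a ≤ y.Q h s a := by
  unfold newQ
  dsimp only
  split
  · exact min_le_right _ _
  · exact (min_le_right _ _).trans (min_le_right _ _)

theorem Q_succ_le (r : IsRun H p m₀ x s a R) {m : ℕ} (hm : m₀ ≤ m) {h : ℕ} (hh : h < H) (t : S)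
    (b : A) : (x (m + 1)).Q h t b ≤ (x m).Q h t b := by
  rw [(r.step m hm h hh).Q]
  split_ifs with hc
  · obtain ⟨rfl, rfl, -⟩ := hc
    exact newQ_le_Q _ _ _ _ _ _
  · exact le_rfl

/-- `V` is refreshed only at the end of a stage, but `Q` does not change at any other time either.
-/
theorem V_eq_iSup [Nonempty A] (r : IsRun H p m₀ x s a R) {m : ℕ} (hm : m₀ ≤ m) {h : ℕ}
    (hh : h < H) (t : S) : (x m).V h t = ⨆ b, (x m).Q h t b := by
  induction m, hm using Nat.le_induction with
  | base => simp [r.init, Tables.init]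
  | succ m hm ih =>
    have st := r.step m hm h hh
    rw [st.V]
    split_ifs with hc
    · rw [hc.1]
    · rw [ih]
      congr 1
      funext b
      rw [st.Q, if_neg]
      rintro ⟨h1, h2, h3⟩
      exact hc ⟨h1, h3⟩

theorem V_last (r : IsRun H p m₀ x s a R) {m : ℕ} (hm : m₀ ≤ m) (t : S) : (x m).V H t = 0 := by
  induction m, hm using Nat.le_induction with
  | base => simp [r.init, Tables.init]
  | succ m hm ih => rw [(r.last m hm).V, ih]

theorem Vref_last (r : IsRun H p m₀ x s a R) {m : ℕ} (hm : m₀ ≤ m) (t : S) :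
    (x m).Vref H t = 0 := by
  induction m, hm using Nat.le_induction with
  | base => simp [r.init, Tables.init]
  | succ m hm ih => rw [(r.last m hm).Vref, ih]

theorem V_succ_le [Nonempty A] (r : IsRun H p m₀ x s a R) {m : ℕ} (hm : m₀ ≤ m) {h : ℕ}
    (hh : h ≤ H) (t : S) : (x (m + 1)).V h t ≤ (x m).V h t := by
  rcases hh.lt_or_eq with hh | rfl
  · rw [r.V_eq_iSup hm hh, r.V_eq_iSup (hm.trans (Nat.le_succ m)) hh]
    exact ciSup_mono (Finite.bddAbove_range _) fun b => r.Q_succ_le hm hh t b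
  · rw [r.V_last hm, r.V_last (hm.trans (Nat.le_succ m))]

/-- A reference value is an earlier value of `V` or the initial one, and `V` only decreases.
Advantages `Vref - V` are therefore nonnegative. -/
theorem V_le_Vref [Nonempty A] (r : IsRun H p m₀ x s a R) {m : ℕ} (hm : m₀ ≤ m) {h : ℕ}
    (hh : h ≤ H) (t : S) : (x m).V h t ≤ (x m).Vref h t := by
  rcases hh.lt_or_eq with hh | rfl
  · induction m, hm using Nat.le_induction with
    | base => simp [r.init, Tables.init, hh]
    | succ m hm ih =>
      rw [(r.step m hm h hh).Vref]
      split_ifs with hc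
      · rw [hc.1]
      · exact (r.V_succ_le hm hh.le t).trans ih
  · rw [r.V_last hm, r.Vref_last hm]

theorem Vref_succ_le [Nonempty A] (r : IsRun H p m₀ x s a R) {m : ℕ} (hm : m₀ ≤ m) {h : ℕ}
    (hh : h ≤ H) (t : S) : (x (m + 1)).Vref h t ≤ (x m).Vref h t := by
  rcases hh.lt_or_eq with hh | rfl
  · rw [(r.step m hm h hh).Vref]
    split_ifs with hc
    · rw [hc.1]
      exact (r.V_succ_le hm hh.le _).trans (r.V_le_Vref hm hh.le _)
    · exact le_rfl
  · rw [r.Vref_last hm, r.Vref_last (hm.trans (Nat.le_succ m))]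

theorem Vref_anti [Nonempty A] (r : IsRun H p m₀ x s a R) {l m : ℕ} (hl : m₀ ≤ l) (hlm : l ≤ m)
    {h : ℕ} (hh : h ≤ H) (t : S) : (x m).Vref h t ≤ (x l).Vref h t := by
  induction m, hlm using Nat.le_induction with
  | base => exact le_rfl
  | succ m hm ih => exact (r.Vref_succ_le (hl.trans hm) hh t).trans ih

theorem Vref_le [Nonempty A] (r : IsRun H p m₀ x s a R) {m : ℕ} (hm : m₀ ≤ m) {h : ℕ}
    (hh : h ≤ H) (t : S) : (x m).Vref h t ≤ H := by
  refine (r.Vref_anti le_rfl hm hh t).trans ?_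
  simp only [r.init, Tables.init]
  split_ifs <;> simp

end IsRun

end Run

/-! ### The optimal values of a Markov decision process -/

section MDP

variable {S A : Type*} [Fintype S]

/-- Optimal value of the last `n` of `H` steps. -/
def optTail (H : ℕ) (rb : ℕ → S → A → ℝ) (Pb : ℕ → S → A → S → ℝ) : ℕ → S → ℝ
  | 0 => fun _ => 0
  | n + 1 => fun t => ⨆ b, (rb (H - (n + 1)) t b
      + ∑ y, Pb (H - (n + 1)) t b y * optTail H rb Pb n y)

/-- Optimal value function. -/
def optV (H : ℕ) (rb : ℕ → S → A → ℝ) (Pb : ℕ → S → A → S → ℝ) (h : ℕ) : S → ℝ :=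
  optTail H rb Pb (H - h)

/-- Optimal action value function. -/
def optQ (H : ℕ) (rb : ℕ → S → A → ℝ) (Pb : ℕ → S → A → S → ℝ) (h : ℕ) (t : S) (b : A) : ℝ :=
  rb h t b + ∑ y, Pb h t b y * optV H rb Pb (h + 1) y

/-- Rewards in `[0, 1]` and transition probabilities at every step. -/
structure IsMDP (rb : ℕ → S → A → ℝ) (Pb : ℕ → S → A → S → ℝ) : Prop where
  r_nonneg : ∀ h t b, 0 ≤ rb h t b
  r_le : ∀ h t b, rb h t b ≤ 1
  P_nonneg : ∀ h t b y, 0 ≤ Pb h t b y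
  P_sum : ∀ h t b, ∑ y, Pb h t b y = 1

variable {H : ℕ} {rb : ℕ → S → A → ℝ} {Pb : ℕ → S → A → S → ℝ}

theorem optV_last : optV H rb Pb H = fun _ => 0 := by simp [optV, optTail]

theorem optV_eq {h : ℕ} (hh : h < H) (t : S) : optV H rb Pb h t = ⨆ b, optQ H rb Pb h t b := by
  unfold optV optQ
  rw [show H - h = (H - (h + 1)) + 1 by omega, optTail,
    show H - (H - (h + 1) + 1) = h by omega]
  rfl

theorem optQ_le_optV [Finite A] {h : ℕ} (hh : h < H) (t : S) (b : A) :
    optQ H rb Pb h t b ≤ optV H rb Pb h t := by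
  rw [optV_eq hh]
  exact le_ciSup (Set.finite_range _).bddAbove b

theorem IsMDP.mean_le (g : IsMDP rb Pb) {f : S → ℝ} {c : ℝ} (hf : ∀ y, f y ≤ c) (h : ℕ) (t : S)
    (b : A) : ∑ y, Pb h t b y * f y ≤ c := by
  calc ∑ y, Pb h t b y * f y ≤ ∑ y, Pb h t b y * c :=
        Finset.sum_le_sum fun y _ => mul_le_mul_of_nonneg_left (hf y) (g.P_nonneg h t b y)
    _ = c := by rw [← Finset.sum_mul, g.P_sum, one_mul]

theorem IsMDP.le_mean (g : IsMDP rb Pb) {f : S → ℝ} {c : ℝ} (hf : ∀ y, c ≤ f y) (h : ℕ) (t : S)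
    (b : A) : c ≤ ∑ y, Pb h t b y * f y := by
  calc c = ∑ y, Pb h t b y * c := by rw [← Finset.sum_mul, g.P_sum, one_mul]
    _ ≤ _ := Finset.sum_le_sum fun y _ => mul_le_mul_of_nonneg_left (hf y) (g.P_nonneg h t b y)

theorem IsMDP.mean_mono (g : IsMDP rb Pb) {f f' : S → ℝ} (hf : ∀ y, f y ≤ f' y) (h : ℕ) (t : S)
    (b : A) : ∑ y, Pb h t b y * f y ≤ ∑ y, Pb h t b y * f' y :=
  Finset.sum_le_sum fun y _ => mul_le_mul_of_nonneg_left (hf y) (g.P_nonneg h t b y)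

theorem IsMDP.optV_mem [Finite A] [Nonempty A] (g : IsMDP rb Pb) {h : ℕ} (hh : h ≤ H) (t : S) :
    0 ≤ optV H rb Pb h t ∧ optV H rb Pb h t ≤ (H : ℝ) - h := by
  induction hh using Nat.decreasingInduction generalizing t with
  | self => simp [optV_last]
  | of_succ h hh ih =>
    constructor
    · obtain ⟨b⟩ := (inferInstance : Nonempty A)
      refine le_trans ?_ (optQ_le_optV hh t b)
      exact add_nonneg (g.r_nonneg _ _ _) (g.le_mean (fun y => (ih y).1) _ _ _)
    · rw [optV_eq hh]
      refine ciSup_le fun b => ?_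
      have := g.mean_le (fun y => (ih y).2) h t b
      have h2 := g.r_le h t b
      push_cast at this
      unfold optQ
      linarith

theorem IsMDP.optQ_nonneg [Finite A] [Nonempty A] (g : IsMDP rb Pb) {h : ℕ} (hh : h < H) (t : S)
    (b : A) : 0 ≤ optQ H rb Pb h t b :=
  add_nonneg (g.r_nonneg _ _ _) (g.le_mean (fun y => (g.optV_mem (by omega) y).1) _ _ _)

theorem IsMDP.optV_le [Finite A] [Nonempty A] (g : IsMDP rb Pb) {h : ℕ} (hh : h ≤ H) (t : S) :
    optV H rb Pb h t ≤ H := by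
  have := (g.optV_mem hh t).2
  have h0 : (0 : ℝ) ≤ h := Nat.cast_nonneg h
  linarith

end MDP

/-! ### Averages of concentrated processes -/

theorem sqrt_mul_div_self {n ι : ℝ} (hn : 0 < n) : √(n * ι) / n = √(1 / n * ι) := by
  have h1 : n * ι / n ^ 2 = 1 / n * ι := by field_simp
  rw [← h1, Real.sqrt_div' _ (by positivity), Real.sqrt_sq hn.le]

/-- Explains the exponents `3/4` in the Freedman bonus: they come from replacing the true variance
by the empirical one. -/
theorem sqrt_sqrt_mul_div {n ι : ℝ} (hn : 0 < n) (hι : 0 < ι) :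
    √(√(n * ι) * ι) / n = ι ^ (3 / 4 : ℝ) / n ^ (3 / 4 : ℝ) := by
  rw [Real.sqrt_eq_rpow, Real.sqrt_eq_rpow, Real.mul_rpow hn.le hι.le,
    Real.mul_rpow (by positivity) hι.le, Real.mul_rpow (by positivity) (by positivity),
    ← Real.rpow_mul hn.le, ← Real.rpow_mul hι.le]
  have e1 : ι ^ (1 / 2 * (1 / 2) : ℝ) * ι ^ (1 / 2 : ℝ) = ι ^ (3 / 4 : ℝ) := by
    rw [← Real.rpow_add hι]; norm_num
  have e2 : n ^ (1 / 2 * (1 / 2) : ℝ) * n ^ (3 / 4 : ℝ) = n := by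
    rw [← Real.rpow_add hn]; norm_num
  rw [mul_assoc, e1, div_eq_div_iff hn.ne' (by positivity)]
  rw [mul_right_comm, e2, mul_comm]

/-- Rescaling of unit processes to processes with range `k`. The constants 3, 6, 4 are dominated by
the 4, 10, 10 in twice the Freedman bonus. -/
theorem Conc.average {ι : ℝ} (hι : 0 < ι) {I : Finset ℕ} (hI : I.Nonempty) {U u : ℕ → ℝ}
    (c : Conc ι I U u) {k : ℝ} (hk : 0 < k) {F f : ℕ → ℝ} (hF : ∀ l ∈ I, F l = k * U l)
    (hf : ∀ l ∈ I, f l = k * u l) :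
    |(∑ l ∈ I, F l) / I.card - (∑ l ∈ I, f l) / I.card| ≤ k * √(1 / I.card * ι) ∧
    |(∑ l ∈ I, F l) / I.card - (∑ l ∈ I, f l) / I.card| ≤
      3 * √(((∑ l ∈ I, F l ^ 2) / I.card - ((∑ l ∈ I, F l) / I.card) ^ 2) / I.card * ι)
        + 6 * (k * ι ^ (3 / 4 : ℝ) / (I.card : ℝ) ^ (3 / 4 : ℝ)) + 4 * (k * ι / I.card) := by
  have hn : (0 : ℝ) < I.card := by exact_mod_cast hI.card_pos
  set n : ℝ := (I.card : ℝ) with hndef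
  have e1 : (∑ l ∈ I, F l) / n - (∑ l ∈ I, f l) / n = k * (∑ l ∈ I, (U l - u l)) / n := by
    rw [← sub_div, ← Finset.sum_sub_distrib, Finset.mul_sum]
    congr 1
    exact Finset.sum_congr rfl fun l hl => by rw [hF l hl, hf l hl]; ring
  rw [e1, abs_div, abs_mul, abs_of_pos hk, abs_of_pos hn]
  have eF : ∑ l ∈ I, F l = k * ∑ l ∈ I, U l := by
    rw [Finset.mul_sum]; exact Finset.sum_congr rfl hF
  have eF2 : ∑ l ∈ I, F l ^ 2 = k ^ 2 * ∑ l ∈ I, U l ^ 2 := by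
    rw [Finset.mul_sum]
    exact Finset.sum_congr rfl fun l hl => by rw [hF l hl]; ring
  constructor
  · rw [mul_div_assoc, ← sqrt_mul_div_self hn]
    exact mul_le_mul_of_nonneg_left (div_le_div_of_nonneg_right c.1 hn.le) hk.le
  · have h2 := mul_le_mul_of_nonneg_left (div_le_div_of_nonneg_right c.2 hn.le) hk.le
    rw [← hndef] at h2
    rw [mul_div_assoc]
    refine h2.trans (le_of_eq ?_)
    rw [eF, eF2]
    set v := ∑ l ∈ I, U l ^ 2
    set w := ∑ l ∈ I, U l
    have e3 : √((k ^ 2 * v / n - (k * w / n) ^ 2) / n * ι) = k * (√((v - w ^ 2 / n) * ι) / n) := by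
      have : (k ^ 2 * v / n - (k * w / n) ^ 2) / n * ι = (v - w ^ 2 / n) * ι * (k / n) ^ 2 := by
        field_simp
      rw [this, Real.sqrt_mul' _ (by positivity), Real.sqrt_sq (by positivity)]
      ring
    rw [e3, add_div, add_div, mul_div_assoc 6, sqrt_sqrt_mul_div hn hι]
    ring


/-! ### Optimism -/

section Optimism

variable {S A : Type*} [Fintype S] [DecidableEq S] [Fintype A] [DecidableEq A]

set_option linter.unusedSectionVars false

/-- Truncation to `[0, 1]`. -/
def clip (z : ℝ) : ℝ := max 0 (min 1 z)

/-- Clipping makes the reference and advantage processes bounded at every outcome, where nothing is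
known about the tables. Optimism shows that it is inactive on the good event. -/
theorem clip_mem (z : ℝ) : clip z ∈ Set.Icc (0 : ℝ) 1 :=
  ⟨le_max_left _ _, max_le zero_le_one (min_le_left _ _)⟩

theorem clip_eq {z : ℝ} (h0 : 0 ≤ z) (h1 : z ≤ 1) : clip z = z := by
  rw [clip, min_eq_right h1, max_eq_right h0]

/-- The concentration inequalities needed for the analysis of the episodes `[m₀, m₁)`, in which
agent 1 faces the decision process `(rb, Pb)`. -/
structure GoodEpoch (H : ℕ) (ι : ℝ) (m₀ m₁ : ℕ) (x : ℕ → Tables S A) (s : ℕ → ℕ → S)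
    (a : ℕ → ℕ → A) (R : ℕ → ℕ → ℝ) (rb : ℕ → S → A → ℝ) (Pb : ℕ → S → A → S → ℝ) : Prop where
  reward : ∀ h < H, ∀ t b l₀ m, m₀ ≤ l₀ → m ≤ m₁ →
    Conc ι (visits s a h t b l₀ m) (fun l => R l h) (fun _ => rb h t b)
  opt : ∀ h < H, ∀ t b l₀ m, m₀ ≤ l₀ → m ≤ m₁ →
    Conc ι (visits s a h t b l₀ m) (fun l => optV H rb Pb (h + 1) (s l (h + 1)) / H)
      (fun _ => ∑ y, Pb h t b y * (optV H rb Pb (h + 1) y / H))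
  ref : ∀ h < H, ∀ t b l₀ m, m₀ ≤ l₀ → m ≤ m₁ →
    Conc ι (visits s a h t b l₀ m) (fun l => clip ((x l).Vref (h + 1) (s l (h + 1)) / H))
      (fun l => ∑ y, Pb h t b y * clip ((x l).Vref (h + 1) y / H))
  adv : ∀ h < H, ∀ t b l₀ m, m₀ ≤ l₀ → m ≤ m₁ →
    Conc ι (visits s a h t b l₀ m)
      (fun l => clip (((x l).Vref (h + 1) (s l (h + 1)) - (x l).V (h + 1) (s l (h + 1))) / H))
      (fun l => ∑ y, Pb h t b y * clip (((x l).Vref (h + 1) y - (x l).V (h + 1) y) / H))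

/-- The Hoeffding estimate, from the visits `I` of a stage. -/
def hoeffdingTarget (H : ℕ) (ι : ℝ) (I : Finset ℕ) (r v : ℕ → ℝ) : ℝ :=
  (∑ l ∈ I, r l) / I.card + (∑ l ∈ I, v l) / I.card + hoeffdingBonus H ι I.card

/-- The Freedman estimate, from the visits `I` of a stage and all visits `J`. -/
def freedmanTarget (H : ℕ) (ι : ℝ) (J I : Finset ℕ) (r w g : ℕ → ℝ) : ℝ :=
  (∑ l ∈ I, r l) / I.card + (∑ l ∈ J, w l) / J.card + (∑ l ∈ I, g l) / I.card
    + 2 * (2 * √(((∑ l ∈ J, w l ^ 2) / J.card - ((∑ l ∈ J, w l) / J.card) ^ 2) / J.card * ι)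
    + 2 * √(((∑ l ∈ I, g l ^ 2) / I.card - ((∑ l ∈ I, g l) / I.card) ^ 2) / I.card * ι)
    + 5 * (H * ι / J.card + H * ι / I.card + H * ι ^ (3 / 4 : ℝ) / (J.card : ℝ) ^ (3 / 4 : ℝ)
        + H * ι ^ (3 / 4 : ℝ) / (I.card : ℝ) ^ (3 / 4 : ℝ))
    + √(1 / I.card * ι))

variable {H : ℕ} {p : Params A} {m₀ m₁ : ℕ} {x : ℕ → Tables S A} {s : ℕ → ℕ → S} {a : ℕ → ℕ → A}
  {R : ℕ → ℕ → ℝ} {rb : ℕ → S → A → ℝ} {Pb : ℕ → S → A → S → ℝ}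

/-- Replaces accumulators by sums over visits. The windows end at `m + 1` because the sample of
episode `m` is recorded before the estimate is formed. -/
theorem IsRun.newQ_record_eq (_ : IsRun H p m₀ x s a R) {h m l₀ j : ℕ}
    (i : StageInfo H m₀ x s a R h (s m h) (a m h) m l₀ j) :
    newQ H p ((x m).record h (s m h) (a m h) (R m h) (s m (h + 1))) h (s m h) (a m h) =
      match p.bonus with
      | .hoeffding => min
          (hoeffdingTarget H p.ι (visits s a h (s m h) (a m h) l₀ (m + 1)) (fun l => R l h)
            (fun l => (x l).V (h + 1) (s l (h + 1)))) ((x m).Q h (s m h) (a m h))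
      | .freedman => min
          (hoeffdingTarget H p.ι (visits s a h (s m h) (a m h) l₀ (m + 1)) (fun l => R l h)
            (fun l => (x l).V (h + 1) (s l (h + 1))))
          (min (freedmanTarget H p.ι (visits s a h (s m h) (a m h) m₀ (m + 1))
            (visits s a h (s m h) (a m h) l₀ (m + 1)) (fun l => R l h)
            (fun l => (x l).Vref (h + 1) (s l (h + 1)))
            (fun l => (x l).V (h + 1) (s l (h + 1)) - (x l).Vref (h + 1) (s l (h + 1))))
            ((x m).Q h (s m h) (a m h))) := by
  have hv : s m h = s m h ∧ a m h = a m h := ⟨rfl, rfl⟩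
  have h1 := i.ge.trans i.le
  unfold newQ hoeffdingTarget freedmanTarget freedmanBonus
  simp only [Tables.record, setEntry, and_self, if_true]
  rw [sum_visits_succ i.le hv, sum_visits_succ i.le hv, sum_visits_succ i.le hv,
    sum_visits_succ i.le hv, sum_visits_succ h1 hv, sum_visits_succ h1 hv, card_visits_succ i.le hv,
    card_visits_succ h1 hv, i.N, i.Nc, i.rc, i.vc, i.muc, i.sigc, i.muref, i.sigref]

theorem hoeffdingBonus_eq (H : ℕ) (ι n : ℝ) :
    hoeffdingBonus H ι n = H * √(1 / n * ι) + √(1 / n * ι) := by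
  rw [hoeffdingBonus, show (H : ℝ) ^ 2 / n * ι = (1 / n * ι) * (H : ℝ) ^ 2 by ring,
    Real.sqrt_mul' _ (by positivity), Real.sqrt_sq (by positivity)]
  ring

theorem average_const {I : Finset ℕ} (hI : I.Nonempty) (c : ℝ) :
    (∑ _l ∈ I, c) / I.card = c := by
  have hn : (0 : ℝ) < I.card := by exact_mod_cast hI.card_pos
  rw [Finset.sum_const, nsmul_eq_mul]
  field_simp

theorem average_mono {I : Finset ℕ} {f g : ℕ → ℝ} (hfg : ∀ l ∈ I, f l ≤ g l) :
    (∑ l ∈ I, f l) / I.card ≤ (∑ l ∈ I, g l) / I.card :=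
  div_le_div_of_nonneg_right (Finset.sum_le_sum hfg) (Nat.cast_nonneg _)

/-- For an antitone function, the average over the late visits is at most that over all visits. -/
theorem average_late_le {h : ℕ} {t : S} {b : A} {l₀ m : ℕ} (h1 : m₀ ≤ l₀) (h2 : l₀ ≤ m)
    {f : ℕ → ℝ} (hf : ∀ l k, m₀ ≤ l → l ≤ k → f k ≤ f l)
    (hne : (visits s a h t b l₀ m).Nonempty) :
    (∑ l ∈ visits s a h t b l₀ m, f l) / (visits s a h t b l₀ m).card
      ≤ (∑ l ∈ visits s a h t b m₀ m, f l) / (visits s a h t b m₀ m).card := by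
  rw [sum_visits_consecutive h1 h2, card_visits_consecutive h1 h2]
  have e1 : ∑ l ∈ visits s a h t b l₀ m, f l ≤ (visits s a h t b l₀ m).card * f l₀ := by
    rw [← nsmul_eq_mul]
    exact Finset.sum_le_card_nsmul _ _ _ fun l hl => hf _ _ h1 (mem_visits.1 hl).1.1
  have e2 : (visits s a h t b m₀ l₀).card * f l₀ ≤ ∑ l ∈ visits s a h t b m₀ l₀, f l := by
    rw [← nsmul_eq_mul]
    exact Finset.card_nsmul_le_sum _ _ _ fun l hl =>
      hf _ _ (mem_visits.1 hl).1.1 (mem_visits.1 hl).1.2.le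
  have hn : (0 : ℝ) < (visits s a h t b l₀ m).card := by exact_mod_cast hne.card_pos
  have hn' : (0 : ℝ) ≤ (visits s a h t b m₀ l₀).card := Nat.cast_nonneg _
  push_cast
  rw [div_le_div_iff₀ hn (by linarith)]
  nlinarith [mul_le_mul_of_nonneg_left e1 hn', mul_le_mul_of_nonneg_left e2 hn.le]

namespace IsRun

variable [Nonempty A]

theorem V_anti (r : IsRun H p m₀ x s a R) {l m : ℕ} (hl : m₀ ≤ l) (hlm : l ≤ m)
    {h : ℕ} (hh : h ≤ H) (t : S) : (x m).V h t ≤ (x l).V h t := by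
  induction m, hlm using Nat.le_induction with
  | base => exact le_rfl
  | succ m hm ih => exact (r.V_succ_le (hl.trans hm) hh t).trans ih

variable (r : IsRun H p m₀ x s a R) (hH : 0 < H) (g : IsMDP rb Pb) (hι : 0 < p.ι)
  (good : GoodEpoch H p.ι m₀ m₁ x s a R rb Pb)

include hι good in
theorem reward_average {h : ℕ} (hh : h < H) {t : S} {b : A} {l₀ m : ℕ} (h1 : m₀ ≤ l₀)
    (h2 : m ≤ m₁) (hne : (visits s a h t b l₀ m).Nonempty) :
    |(∑ l ∈ visits s a h t b l₀ m, R l h) / (visits s a h t b l₀ m).card - rb h t b|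
      ≤ √(1 / (visits s a h t b l₀ m).card * p.ι) := by
  have := ((good.reward h hh t b l₀ m h1 h2).average hι hne one_pos (F := fun l => R l h)
    (f := fun _ => rb h t b) (by simp) (by simp)).1
  rwa [average_const hne, one_mul] at this

include hH hι good in
theorem opt_average {h : ℕ} (hh : h < H) {t : S} {b : A} {l₀ m : ℕ} (h1 : m₀ ≤ l₀)
    (h2 : m ≤ m₁) (hne : (visits s a h t b l₀ m).Nonempty) :
    |(∑ l ∈ visits s a h t b l₀ m, optV H rb Pb (h + 1) (s l (h + 1)))
        / (visits s a h t b l₀ m).card - ∑ y, Pb h t b y * optV H rb Pb (h + 1) y|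
      ≤ H * √(1 / (visits s a h t b l₀ m).card * p.ι) := by
  have hH0 : (0 : ℝ) < H := by exact_mod_cast hH
  have := ((good.opt h hh t b l₀ m h1 h2).average hι hne hH0
    (F := fun l => optV H rb Pb (h + 1) (s l (h + 1)))
    (f := fun _ => ∑ y, Pb h t b y * optV H rb Pb (h + 1) y)
    (fun l _ => by field_simp) (fun l _ => by
      rw [Finset.mul_sum]
      exact Finset.sum_congr rfl fun y _ => by field_simp)).1
  rwa [average_const hne] at this

include hH hι good in
theorem le_hoeffdingTarget {h : ℕ} (hh : h < H) {t : S} {b : A} {l₀ m : ℕ} (h1 : m₀ ≤ l₀)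
    (h2 : m ≤ m₁) (hne : (visits s a h t b l₀ m).Nonempty)
    (hV : ∀ l ∈ visits s a h t b l₀ m, ∀ y, optV H rb Pb (h + 1) y ≤ (x l).V (h + 1) y) :
    optQ H rb Pb h t b ≤ hoeffdingTarget H p.ι (visits s a h t b l₀ m) (fun l => R l h)
      (fun l => (x l).V (h + 1) (s l (h + 1))) := by
  have e1 := (abs_le.1 (reward_average hι good hh h1 h2 hne)).1
  have e2 := (abs_le.1 (opt_average hH hι good hh h1 h2 hne)).1
  have e3 := average_mono fun l hl => hV l hl (s l (h + 1))
  rw [hoeffdingTarget, hoeffdingBonus_eq, optQ]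
  linarith

include hH hι good in
-- The factor 2 counts `(H + 1)√(ι/n)` twice: once as the bonus in the estimate, once as the
-- deviation.
theorem hoeffdingTarget_le {h : ℕ} (hh : h < H) {t : S} {b : A} {l₀ m : ℕ} (h1 : m₀ ≤ l₀)
    (h2 : m ≤ m₁) (hne : (visits s a h t b l₀ m).Nonempty) :
    hoeffdingTarget H p.ι (visits s a h t b l₀ m) (fun l => R l h)
      (fun l => (x l).V (h + 1) (s l (h + 1))) ≤ optQ H rb Pb h t b +
      (∑ l ∈ visits s a h t b l₀ m, ((x l).V (h + 1) (s l (h + 1))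
        - optV H rb Pb (h + 1) (s l (h + 1)))) / (visits s a h t b l₀ m).card
      + 2 * (H + 1) * √(1 / (visits s a h t b l₀ m).card * p.ι) := by
  have e1 := (abs_le.1 (reward_average hι good hh h1 h2 hne)).2
  have e2 := (abs_le.1 (opt_average hH hι good hh h1 h2 hne)).2
  rw [hoeffdingTarget, hoeffdingBonus_eq, optQ, Finset.sum_sub_distrib, sub_div]
  linarith

include r hH g hι good in
-- The conditional means of the two parts would recombine to that of `V` if both averages ran over
-- the stage. Averaging `Vref` over all visits only increases its part, since reference values
-- decrease with time. The bonus covers the deviations of both parts and of the rewards.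
theorem le_freedmanTarget {h : ℕ} (hh : h < H) {t : S} {b : A} {l₀ m : ℕ} (h1 : m₀ ≤ l₀)
    (h3 : l₀ ≤ m) (h2 : m ≤ m₁) (hne : (visits s a h t b l₀ m).Nonempty)
    (hV : ∀ l, m₀ ≤ l → l < m → ∀ y, optV H rb Pb (h + 1) y ≤ (x l).V (h + 1) y) :
    optQ H rb Pb h t b ≤ freedmanTarget H p.ι (visits s a h t b m₀ m) (visits s a h t b l₀ m)
      (fun l => R l h) (fun l => (x l).Vref (h + 1) (s l (h + 1)))
      (fun l => (x l).V (h + 1) (s l (h + 1)) - (x l).Vref (h + 1) (s l (h + 1))) := by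
  have hH0 : (0 : ℝ) < H := by exact_mod_cast hH
  have hneJ : (visits s a h t b m₀ m).Nonempty := by
    rw [visits_union h1 h3]
    exact hne.mono Finset.subset_union_right
  have hV0 : ∀ l, m₀ ≤ l → l < m → ∀ y, 0 ≤ (x l).V (h + 1) y := fun l hl hl' y =>
    (g.optV_mem (show h + 1 ≤ H by omega) y).1.trans (hV l hl hl' y)
  have hVR : ∀ l, m₀ ≤ l → ∀ y, (x l).V (h + 1) y ≤ (x l).Vref (h + 1) y := fun l hl y =>
    r.V_le_Vref hl (by omega) y
  have hRH : ∀ l, m₀ ≤ l → ∀ y, (x l).Vref (h + 1) y ≤ H := fun l hl y =>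
    r.Vref_le hl (by omega) y
  -- Optimism in the earlier episodes gives `0 ≤ V ≤ Vref ≤ H`, so neither truncation has any effect
  -- here.
  have c1 : ∀ l, m₀ ≤ l → l < m → ∀ y,
      (x l).Vref (h + 1) y = H * clip ((x l).Vref (h + 1) y / H) := fun l hl hl' y => by
    rw [clip_eq]
    · field_simp
    · exact div_nonneg ((hV0 l hl hl' y).trans (hVR l hl y)) hH0.le
    · rw [div_le_one hH0]; exact hRH l hl y
  have c2 : ∀ l, m₀ ≤ l → l < m → ∀ y, (x l).Vref (h + 1) y - (x l).V (h + 1) y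
      = H * clip (((x l).Vref (h + 1) y - (x l).V (h + 1) y) / H) := fun l hl hl' y => by
    rw [clip_eq]
    · field_simp
    · exact div_nonneg (sub_nonneg.2 (hVR l hl y)) hH0.le
    · rw [div_le_one hH0]; linarith [hRH l hl y, hV0 l hl hl' y]
  have memJ : ∀ l ∈ visits s a h t b m₀ m, m₀ ≤ l ∧ l < m := fun l hl => (mem_visits.1 hl).1
  have memI : ∀ l ∈ visits s a h t b l₀ m, m₀ ≤ l ∧ l < m := fun l hl =>
    ⟨h1.trans (mem_visits.1 hl).1.1, (mem_visits.1 hl).1.2⟩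
  have d0 := (abs_le.1 (reward_average hι good hh h1 h2 hne)).1
  have d1 := (abs_le.1 ((good.ref h hh t b m₀ m le_rfl h2).average hι hneJ hH0
    (F := fun l => (x l).Vref (h + 1) (s l (h + 1)))
    (f := fun l => ∑ y, Pb h t b y * (x l).Vref (h + 1) y)
    (fun l hl => c1 l (memJ l hl).1 (memJ l hl).2 _) (fun l hl => by
      rw [Finset.mul_sum]
      refine Finset.sum_congr rfl fun y _ => ?_
      rw [mul_left_comm, ← c1 l (memJ l hl).1 (memJ l hl).2 y])).2).1
  have d2 := (abs_le.1 ((good.adv h hh t b l₀ m h1 h2).average hι hne hH0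
    (F := fun l => (x l).Vref (h + 1) (s l (h + 1)) - (x l).V (h + 1) (s l (h + 1)))
    (f := fun l => ∑ y, Pb h t b y * ((x l).Vref (h + 1) y - (x l).V (h + 1) y))
    (fun l hl => c2 l (memI l hl).1 (memI l hl).2 _) (fun l hl => by
      rw [Finset.mul_sum]
      refine Finset.sum_congr rfl fun y _ => ?_
      rw [mul_left_comm, ← c2 l (memI l hl).1 (memI l hl).2 y])).2).2
  have d3 := average_late_le (s := s) (a := a) (h := h) (t := t) (b := b) h1 h3
    (f := fun l => ∑ y, Pb h t b y * (x l).Vref (h + 1) y)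
    (fun l k hl hk => g.mean_mono (fun y => r.Vref_anti hl hk (by omega) y) h t b) hne
  have d4 : ∑ y, Pb h t b y * optV H rb Pb (h + 1) y ≤
      (∑ l ∈ visits s a h t b l₀ m, ∑ y, Pb h t b y * (x l).V (h + 1) y)
        / (visits s a h t b l₀ m).card := by
    rw [← average_const hne (∑ y, Pb h t b y * optV H rb Pb (h + 1) y)]
    exact average_mono fun l hl => g.mean_mono (hV l (memI l hl).1 (memI l hl).2) h t b
  have d5 : (∑ l ∈ visits s a h t b l₀ m,
      ∑ y, Pb h t b y * ((x l).Vref (h + 1) y - (x l).V (h + 1) y)) / (visits s a h t b l₀ m).card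
      = (∑ l ∈ visits s a h t b l₀ m, ∑ y, Pb h t b y * (x l).Vref (h + 1) y)
          / (visits s a h t b l₀ m).card
        - (∑ l ∈ visits s a h t b l₀ m, ∑ y, Pb h t b y * (x l).V (h + 1) y)
          / (visits s a h t b l₀ m).card := by
    rw [← sub_div, ← Finset.sum_sub_distrib]
    simp_rw [mul_sub, Finset.sum_sub_distrib]
  -- The algorithm accumulates `V - Vref ≤ 0`, the unit process is built on `Vref - V`. The sign is
  -- immaterial for the empirical variance.
  have e1 : ∑ l ∈ visits s a h t b l₀ m,
      ((x l).V (h + 1) (s l (h + 1)) - (x l).Vref (h + 1) (s l (h + 1)))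
      = -∑ l ∈ visits s a h t b l₀ m,
        ((x l).Vref (h + 1) (s l (h + 1)) - (x l).V (h + 1) (s l (h + 1))) := by
    rw [← Finset.sum_neg_distrib]
    exact Finset.sum_congr rfl fun _ _ => by ring
  have e2 : ∑ l ∈ visits s a h t b l₀ m,
      ((x l).V (h + 1) (s l (h + 1)) - (x l).Vref (h + 1) (s l (h + 1))) ^ 2
      = ∑ l ∈ visits s a h t b l₀ m,
        ((x l).Vref (h + 1) (s l (h + 1)) - (x l).V (h + 1) (s l (h + 1))) ^ 2 :=
    Finset.sum_congr rfl fun _ _ => by ring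
  rw [freedmanTarget, optQ, e1, e2, neg_div, neg_sq]
  rw [d5] at d2
  have q1 : 0 ≤ H * p.ι / (visits s a h t b m₀ m).card := by positivity
  have q2 : 0 ≤ H * p.ι / (visits s a h t b l₀ m).card := by positivity
  have q3 : 0 ≤ H * p.ι ^ (3 / 4 : ℝ) / ((visits s a h t b m₀ m).card : ℝ) ^ (3 / 4 : ℝ) := by
    positivity
  have q4 : 0 ≤ H * p.ι ^ (3 / 4 : ℝ) / ((visits s a h t b l₀ m).card : ℝ) ^ (3 / 4 : ℝ) := by
    positivity
  have q5 := Real.sqrt_nonneg (1 / ((visits s a h t b l₀ m).card : ℝ) * p.ι)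
  have q6 := Real.sqrt_nonneg (((∑ l ∈ visits s a h t b m₀ m,
    (x l).Vref (h + 1) (s l (h + 1)) ^ 2) / ((visits s a h t b m₀ m).card : ℝ)
    - ((∑ l ∈ visits s a h t b m₀ m, (x l).Vref (h + 1) (s l (h + 1)))
      / (visits s a h t b m₀ m).card) ^ 2) / (visits s a h t b m₀ m).card * p.ι)
  have q7 := Real.sqrt_nonneg (((∑ l ∈ visits s a h t b l₀ m,
    ((x l).Vref (h + 1) (s l (h + 1)) - (x l).V (h + 1) (s l (h + 1))) ^ 2)
      / ((visits s a h t b l₀ m).card : ℝ)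
    - ((∑ l ∈ visits s a h t b l₀ m, ((x l).Vref (h + 1) (s l (h + 1))
      - (x l).V (h + 1) (s l (h + 1)))) / (visits s a h t b l₀ m).card) ^ 2)
      / (visits s a h t b l₀ m).card * p.ι)
  linarith

include r hH g hι good in
-- Induction on episodes, for all steps at once: an update at step `h` uses only next-step values of
-- the tables up to the current episode, so no backward induction is needed. Older values are larger
-- still, by `V_anti`.
theorem optimism {m : ℕ} (hm : m₀ ≤ m) (hm1 : m ≤ m₁) :
    (∀ h < H, ∀ t b, optQ H rb Pb h t b ≤ (x m).Q h t b) ∧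
    ∀ h ≤ H, ∀ t, optV H rb Pb h t ≤ (x m).V h t := by
  have hVQ : ∀ m, m₀ ≤ m → (∀ h < H, ∀ t b, optQ H rb Pb h t b ≤ (x m).Q h t b) →
      ∀ h ≤ H, ∀ t, optV H rb Pb h t ≤ (x m).V h t := by
    intro m hm hQ h hh t
    rcases hh.lt_or_eq with hh | rfl
    · rw [optV_eq hh, r.V_eq_iSup hm hh]
      exact ciSup_mono (Finite.bddAbove_range _) fun b => hQ h hh t b
    · rw [optV_last, r.V_last hm]
  induction m, hm using Nat.le_induction with
  | base =>
    have hQ : ∀ h < H, ∀ t b, optQ H rb Pb h t b ≤ (x m₀).Q h t b := by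
      intro h hh t b
      simp only [r.init, Tables.init]
      exact (optQ_le_optV hh t b).trans (g.optV_mem hh.le t).2
    exact ⟨hQ, hVQ _ le_rfl hQ⟩
  | succ m hm ih =>
    obtain ⟨ihQ, ihV⟩ := ih (by omega)
    have hQ : ∀ h < H, ∀ t b, optQ H rb Pb h t b ≤ (x (m + 1)).Q h t b := by
      intro h hh t b
      rw [(r.step m hm h hh).Q]
      split_ifs with hc
      · obtain ⟨rfl, rfl, hE⟩ := hc
        obtain ⟨l₀, j, i⟩ := r.exists_stageInfo hH hh (s m h) (a m h) hm
        rw [r.newQ_record_eq i]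
        have hne : (visits s a h (s m h) (a m h) l₀ (m + 1)).Nonempty :=
          ⟨m, mem_visits.2 ⟨⟨i.le, by omega⟩, rfl, rfl⟩⟩
        have hV : ∀ l, m₀ ≤ l → l < m + 1 → ∀ y,
            optV H rb Pb (h + 1) y ≤ (x l).V (h + 1) y := fun l hl hl' y =>
          (ihV (h + 1) (by omega) y).trans (r.V_anti hl (by omega) (by omega) y)
        have t1 := le_hoeffdingTarget hH hι good hh i.ge hm1 hne fun l hl =>
          hV l (i.ge.trans (mem_visits.1 hl).1.1) (mem_visits.1 hl).1.2
        have t2 := le_freedmanTarget r hH g hι good hh i.ge (i.le.trans (by omega)) hm1 hne hV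
        cases p.bonus
        · exact le_min t1 (ihQ _ hh _ _)
        · exact le_min t1 (le_min t2 (ihQ _ hh _ _))
      · exact ihQ h hh t b
    exact ⟨hQ, hVQ _ (by omega) hQ⟩

end IsRun

end Optimism

/-! ### The regret of one stationary epoch -/

/-- Bound for the total bonus of the stages `0, …, j` of one state-action pair. -/
def stageBonus (H : ℕ) (ι : ℝ) : ℕ → ℝ
  | 0 => (H : ℝ) * H
  | j + 1 => stageBonus H ι j
      + stageLength H (j + 1) * (2 * (H + 1) * √(1 / stageLength H j * ι))

/-- Since stages at most double, the total bonus of stage `j + 1` is at most `4(H + 1)√ι√e_j`, and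
`sum_sqrt_stageLength_le` adds these up. -/
theorem stageBonus_le {H : ℕ} (hH : 0 < H) {ι : ℝ} (hι : 0 < ι) (j : ℕ) :
    stageBonus H ι j ≤ H ^ 2 + 16 * H * (H + 1) * √ι * √(stageStart H j) := by
  have h1 : ∀ j, stageBonus H ι j
      ≤ H ^ 2 + 4 * (H + 1) * √ι * ∑ i ∈ Finset.range j, √(stageLength H i) := by
    intro j
    induction j with
    | zero => simp [stageBonus, sq]
    | succ j ih =>
      rw [stageBonus, Finset.sum_range_succ]
      have h2 : ((stageLength H (j + 1) : ℕ) : ℝ) ≤ 2 * stageLength H j := by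
        exact_mod_cast stageLength_succ_le hH j
      have h3 : (0 : ℝ) < stageLength H j := by
        exact_mod_cast lt_of_lt_of_le hH (le_stageLength j)
      have h4 : √(1 / stageLength H j * ι) = √ι / √(stageLength H j) := by
        rw [one_div_mul_eq_div, Real.sqrt_div hι.le]
      have h5 : 2 * (stageLength H j : ℝ) * (2 * (H + 1) * (√ι / √(stageLength H j)))
          = 4 * (H + 1) * √ι * √(stageLength H j) := by
        have h6 : √(stageLength H j : ℝ) ≠ 0 := (Real.sqrt_pos.2 h3).ne'
        have h7 : (stageLength H j : ℝ) = √(stageLength H j) * √(stageLength H j) :=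
          (Real.mul_self_sqrt h3.le).symm
        rw [mul_div_assoc', mul_div_assoc', div_eq_iff h6]
        nth_rewrite 1 [h7]
        ring
      rw [h4]
      have h8 := mul_le_mul_of_nonneg_right h2
        (by positivity : (0 : ℝ) ≤ 2 * (H + 1) * (√ι / √(stageLength H j)))
      rw [h5] at h8
      linarith
  refine (h1 j).trans ?_
  have h2 := mul_le_mul_of_nonneg_left (sum_sqrt_stageLength_le hH j)
    (by positivity : (0 : ℝ) ≤ 4 * (H + 1) * √ι)
  linarith

section Regret

variable {S A : Type*} [Fintype S] [DecidableEq S] [Fintype A] [DecidableEq A]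

set_option linter.unusedSectionVars false

theorem sum_visits_univ (s : ℕ → ℕ → S) (a : ℕ → ℕ → A) (h l₀ m : ℕ) (f : ℕ → S → A → ℝ) :
    ∑ t, ∑ b, ∑ l ∈ visits s a h t b l₀ m, f l t b
      = ∑ l ∈ Finset.Ico l₀ m, f l (s l h) (a l h) := by
  simp_rw [visits, Finset.sum_filter]
  calc _ = ∑ t, ∑ l ∈ Finset.Ico l₀ m, ∑ b, (if t = s l h ∧ b = a l h then f l t b else 0) :=
        Finset.sum_congr rfl fun t _ => Finset.sum_comm
    _ = ∑ l ∈ Finset.Ico l₀ m, ∑ t, ∑ b, (if t = s l h ∧ b = a l h then f l t b else 0) :=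
        Finset.sum_comm
    _ = _ := by
        refine Finset.sum_congr rfl fun l _ => ?_
        rw [Finset.sum_eq_single (s l h) (fun t _ ht => by simp [ht]) (by simp)]
        rw [Finset.sum_eq_single (a l h) (fun b _ hb => by simp [hb]) (by simp)]
        simp

variable {H : ℕ} {p : Params A} {m₀ m₁ : ℕ} {x : ℕ → Tables S A} {s : ℕ → ℕ → S} {a : ℕ → ℕ → A}
  {R : ℕ → ℕ → ℝ} {rb : ℕ → S → A → ℝ} {Pb : ℕ → S → A → S → ℝ}

namespace IsRun

variable [Nonempty A]
variable (r : IsRun H p m₀ x s a R) (hH : 0 < H) (g : IsMDP rb Pb) (hι : 0 < p.ι)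
  (good : GoodEpoch H p.ι m₀ m₁ x s a R rb Pb)

include r hH g hι good in
-- Amortization: the remaining visits of the current stage are charged in advance at the current
-- gap, which is constant during the stage. A visit inside a stage merely moves one unit from the
-- advance to the sum; only the end of a stage creates new cost. The first stage has `H` visits with
-- gap at most `H`.
theorem exists_stage_gap_le {h : ℕ} (hh : h < H) (t : S) (b : A) {m : ℕ} (hm : m₀ ≤ m)
    (hm1 : m ≤ m₁) : ∃ l₀ j, StageInfo H m₀ x s a R h t b m l₀ j ∧
      ∑ l ∈ visits s a h t b m₀ m, ((x l).Q h t b - optQ H rb Pb h t b)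
        + (stageLength H j - (x m).Nc h t b) * ((x m).Q h t b - optQ H rb Pb h t b)
      ≤ 2 * ∑ l ∈ visits s a h t b m₀ l₀,
          ((x l).V (h + 1) (s l (h + 1)) - optV H rb Pb (h + 1) (s l (h + 1)))
        + stageBonus H p.ι j := by
  have hH0 : (0 : ℝ) < H := by exact_mod_cast hH
  induction m, hm using Nat.le_induction with
  | base =>
    refine ⟨_, _, r.stageInfo_start hH h t b, ?_⟩
    simp only [visits_self, Finset.sum_empty, r.init, Tables.init, stageLength, stageBonus]
    have := g.optQ_nonneg hh t b
    have h0 : (0 : ℝ) ≤ h := Nat.cast_nonneg h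
    push_cast
    nlinarith
  | succ m hm ih =>
    obtain ⟨l₀, j, i, hi⟩ := ih (by omega)
    have st := r.step m hm h hh
    by_cases hv : t = s m h ∧ b = a m h
    · have hQ := st.Q t b
      have hNc := st.Nc t b
      obtain ⟨rfl, rfl⟩ := hv
      have hv : s m h = s m h ∧ a m h = a m h := ⟨rfl, rfl⟩
      by_cases hE : (x m).Nc h (s m h) (a m h) + 1 = stageLength H j
      · refine ⟨_, _, r.stageInfo_of_end hH hh i hE, ?_⟩
        have hE' := (i.mem_stageEnds_iff hH).2 hE
        rw [if_pos ⟨rfl, rfl, hE'⟩, r.newQ_record_eq i] at hQ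
        rw [if_pos hv, if_pos hE'] at hNc
        have hne : (visits s a h (s m h) (a m h) l₀ (m + 1)).Nonempty :=
          ⟨m, mem_visits.2 ⟨⟨i.le, by omega⟩, rfl, rfl⟩⟩
        have hcard : (visits s a h (s m h) (a m h) l₀ (m + 1)).card = stageLength H j := by
          rw [card_visits_succ i.le hv, ← i.Nc, hE]
        -- Both versions take a minimum containing the Hoeffding estimate, so the Freedman bonus
        -- never needs an upper bound.
        have hQle : (x (m + 1)).Q h (s m h) (a m h) ≤ _ :=
          (show (x (m + 1)).Q h (s m h) (a m h) ≤ hoeffdingTarget H p.ι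
            (visits s a h (s m h) (a m h) l₀ (m + 1)) (fun l => R l h)
            (fun l => (x l).V (h + 1) (s l (h + 1))) by
              rw [hQ]
              cases p.bonus
              · exact min_le_left _ _
              · exact min_le_left _ _).trans
            (hoeffdingTarget_le hH hι good hh i.ge hm1 hne)
        rw [hcard] at hQle
        rw [sum_visits_succ hm hv,
          sum_visits_consecutive i.ge (i.le.trans (Nat.le_succ m)) fun l =>
            (x l).V (h + 1) (s l (h + 1)) - optV H rb Pb (h + 1) (s l (h + 1)), hNc, stageBonus]
        have hy : ∀ l ∈ visits s a h (s m h) (a m h) l₀ (m + 1),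
            0 ≤ (x l).V (h + 1) (s l (h + 1)) - optV H rb Pb (h + 1) (s l (h + 1)) := by
          intro l hl
          have hl' := (mem_visits.1 hl).1
          exact sub_nonneg.2 ((r.optimism hH g hι good (i.ge.trans hl'.1) (by omega)).2 (h + 1)
            (by omega) _)
        have hy0 := Finset.sum_nonneg hy
        set Y := ∑ l ∈ visits s a h (s m h) (a m h) l₀ (m + 1),
          ((x l).V (h + 1) (s l (h + 1)) - optV H rb Pb (h + 1) (s l (h + 1)))
        have hEr : ((x m).Nc h (s m h) (a m h) : ℝ) + 1 = stageLength H j := by exact_mod_cast hE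
        have hfac : (stageLength H j : ℝ) - (x m).Nc h (s m h) (a m h) = 1 := by linarith
        rw [hfac, one_mul] at hi
        have hej : (0 : ℝ) < stageLength H j := by
          exact_mod_cast lt_of_lt_of_le hH (le_stageLength j)
        have hej1 : (0 : ℝ) ≤ stageLength H (j + 1) := Nat.cast_nonneg _
        have hej2 : ((stageLength H (j + 1) : ℕ) : ℝ) ≤ 2 * stageLength H j := by
          exact_mod_cast stageLength_succ_le hH j
        -- The mean gap of the finished stage is paid `e_{j+1} ≤ 2e_j` times; this is where the
        -- factor 2 arises.
        have k1 : (stageLength H (j + 1) : ℝ) * (Y / stageLength H j) ≤ 2 * Y := by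
          rw [mul_div_assoc', div_le_iff₀ hej]
          nlinarith
        have k2 : (stageLength H (j + 1) : ℝ)
            * ((x (m + 1)).Q h (s m h) (a m h) - optQ H rb Pb h (s m h) (a m h))
            ≤ stageLength H (j + 1)
              * (Y / stageLength H j + 2 * (H + 1) * √(1 / stageLength H j * p.ι)) :=
          mul_le_mul_of_nonneg_left (by linarith) hej1
        rw [mul_add] at k2
        push_cast
        rw [sub_zero]
        linarith
      · refine ⟨_, _, r.stageInfo_of_visit hH hh i hE, ?_⟩
        have hE' := mt (i.mem_stageEnds_iff hH).1 hE
        rw [if_neg (by tauto)] at hQ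
        rw [if_pos hv, if_neg hE'] at hNc
        rw [sum_visits_succ hm hv, hQ, hNc]
        push_cast
        linarith
    · refine ⟨_, _, r.stageInfo_of_not hh i hv, ?_⟩
      rw [visits_succ_of_not hv, st.Nc, if_neg hv, st.Q, if_neg (by tauto)]
      exact hi

/-- Bound for the total bonus of one state-action pair in an epoch of `n` episodes. -/
def _root_.TeamRL.epochBonus (H : ℕ) (ι n : ℝ) : ℝ := H ^ 2 + 16 * H * (H + 1) * √ι * √n

include r hH g hι good in
-- Optimism allows the advance to be dropped and the sum of next-step gaps to be extended to the
-- unfinished stage.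
theorem sum_visits_gap_le {h : ℕ} (hh : h < H) (t : S) (b : A) (hm : m₀ ≤ m₁) :
    ∑ l ∈ visits s a h t b m₀ m₁, ((x l).Q h t b - optQ H rb Pb h t b)
      ≤ 2 * ∑ l ∈ visits s a h t b m₀ m₁,
          ((x l).V (h + 1) (s l (h + 1)) - optV H rb Pb (h + 1) (s l (h + 1)))
        + epochBonus H p.ι (m₁ - m₀ : ℕ) := by
  obtain ⟨l₀, j, i, hi⟩ := r.exists_stage_gap_le hH g hι good hh t b hm le_rfl
  have hq := sub_nonneg.2 ((r.optimism hH g hι good hm le_rfl).1 h hh t b)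
  have hc : (0 : ℝ) ≤ stageLength H j - (x m₁).Nc h t b :=
    sub_nonneg.2 (by exact_mod_cast i.Nc_lt.le)
  have h1 := mul_nonneg hc hq
  have h2 : ∑ l ∈ visits s a h t b m₀ l₀,
        ((x l).V (h + 1) (s l (h + 1)) - optV H rb Pb (h + 1) (s l (h + 1)))
      ≤ ∑ l ∈ visits s a h t b m₀ m₁,
        ((x l).V (h + 1) (s l (h + 1)) - optV H rb Pb (h + 1) (s l (h + 1))) := by
    refine Finset.sum_le_sum_of_subset_of_nonneg ?_ fun l hl _ => ?_
    · rw [visits_union i.ge i.le]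
      exact Finset.subset_union_left
    · have hl' := (mem_visits.1 hl).1
      exact sub_nonneg.2 ((r.optimism hH g hι good hl'.1 hl'.2.le).2 (h + 1) (by omega) _)
  have h3 := stageBonus_le hH hι j
  have h4 : √(stageStart H j : ℝ) ≤ √((m₁ - m₀ : ℕ) : ℝ) := by
    refine Real.sqrt_le_sqrt ?_
    have e1 : stageStart H j ≤ (visits s a h t b m₀ m₁).card := by
      rw [← i.N, i.N_eq]; omega
    have e2 : (visits s a h t b m₀ m₁).card ≤ m₁ - m₀ :=
      (Finset.card_filter_le _ _).trans (by simp)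
    exact_mod_cast e1.trans e2
  have h5 := mul_le_mul_of_nonneg_left h4 (by positivity : (0 : ℝ) ≤ 16 * H * (H + 1) * √p.ι)
  rw [epochBonus]
  linarith

variable (hg : ∀ l, m₀ ≤ l → l < m₁ → ∀ h < H, ∀ b,
  (x l).Q h (s l h) b ≤ (x l).Q h (s l h) (a l h))

include r hg in
theorem V_eq_of_greedy {l : ℕ} (hl : m₀ ≤ l) (hl1 : l < m₁) {h : ℕ} (hh : h < H) :
    (x l).V h (s l h) = (x l).Q h (s l h) (a l h) := by
  rw [r.V_eq_iSup hl hh]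
  exact le_antisymm (ciSup_le fun b => hg l hl hl1 h hh b)
    (le_ciSup (Finite.bddAbove_range _) (a l h))

include r hH g hι good hg in
-- Backward recursion `g_h ≤ 2 g_{h+1} + B`, whose solution from `g_H = 0` is `(2^(H-h) - 1)B`. It
-- closes because at a greedy action `V - V*` is at most `Q - Q*`.
theorem sum_gap_le {h : ℕ} (hh : h < H) (hm : m₀ ≤ m₁) :
    ∑ l ∈ Finset.Ico m₀ m₁,
      ((x l).Q h (s l h) (a l h) - optQ H rb Pb h (s l h) (a l h))
      ≤ (2 ^ (H - h) - 1) *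
        ((Fintype.card S * Fintype.card A) * epochBonus H p.ι (m₁ - m₀ : ℕ)) := by
  set B := (Fintype.card S * Fintype.card A) * epochBonus H p.ι (m₁ - m₀ : ℕ) with hB
  have key : ∀ h < H, ∑ l ∈ Finset.Ico m₀ m₁,
      ((x l).Q h (s l h) (a l h) - optQ H rb Pb h (s l h) (a l h))
      ≤ 2 * ∑ l ∈ Finset.Ico m₀ m₁,
        ((x l).V (h + 1) (s l (h + 1)) - optV H rb Pb (h + 1) (s l (h + 1))) + B := by
    intro h hh
    rw [← sum_visits_univ s a h m₀ m₁ fun l t b => (x l).Q h t b - optQ H rb Pb h t b,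
      ← sum_visits_univ s a h m₀ m₁ fun l _ _ =>
        (x l).V (h + 1) (s l (h + 1)) - optV H rb Pb (h + 1) (s l (h + 1))]
    refine (Finset.sum_le_sum fun t _ => Finset.sum_le_sum fun b _ =>
      r.sum_visits_gap_le hH g hι good hh t b hm).trans (le_of_eq ?_)
    simp only [Finset.sum_add_distrib, ← Finset.mul_sum, Finset.sum_const, Finset.card_univ,
      nsmul_eq_mul]
    rw [hB]
    ring
  have hind : ∀ n h, h + n + 1 = H → ∑ l ∈ Finset.Ico m₀ m₁,
      ((x l).Q h (s l h) (a l h) - optQ H rb Pb h (s l h) (a l h)) ≤ (2 ^ (n + 1) - 1) * B := by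
    intro n
    induction n with
    | zero =>
      intro h hn
      refine (key h (by omega)).trans (le_of_eq ?_)
      have hH1 : h + 1 = H := by omega
      rw [Finset.sum_eq_zero]
      · norm_num
      · intro l hl
        rw [hH1, optV_last, r.V_last (Finset.mem_Ico.1 hl).1, sub_zero]
    | succ n ih =>
      intro h hn
      have h1 := ih (h + 1) (by omega)
      have h2 : ∑ l ∈ Finset.Ico m₀ m₁,
          ((x l).V (h + 1) (s l (h + 1)) - optV H rb Pb (h + 1) (s l (h + 1)))
          ≤ ∑ l ∈ Finset.Ico m₀ m₁, ((x l).Q (h + 1) (s l (h + 1)) (a l (h + 1))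
            - optQ H rb Pb (h + 1) (s l (h + 1)) (a l (h + 1))) := by
        refine Finset.sum_le_sum fun l hl => ?_
        obtain ⟨hl0, hl1⟩ := Finset.mem_Ico.1 hl
        have hh' : h + 1 < H := by omega
        rw [r.V_eq_of_greedy hg hl0 hl1 hh']
        linarith [optQ_le_optV (rb := rb) (Pb := Pb) hh' (s l (h + 1)) (a l (h + 1))]
      have h3 := key h (by omega)
      rw [pow_succ]
      linarith
  have := hind (H - h - 1) h (by omega)
  rwa [show H - h - 1 + 1 = H - h by omega] at this

/-- The regret in a stationary epoch, `W l h` being the value of the policy of agent 1 in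
episode `l`. -/
theorem regret_le (r : IsRun H p m₀ x s a R) (hH : 0 < H) (g : IsMDP rb Pb) (hι : 0 < p.ι)
    (good : GoodEpoch H p.ι m₀ m₁ x s a R rb Pb) (hm : m₀ ≤ m₁)
    (hg : ∀ l, m₀ ≤ l → l < m₁ → ∀ h < H, ∀ b,
      (x l).Q h (s l h) b ≤ (x l).Q h (s l h) (a l h))
    {W : ℕ → ℕ → S → ℝ}
    (hW : ∀ l, m₀ ≤ l → l < m₁ → ∀ h < H, W l h (s l h) =
      rb h (s l h) (a l h) + ∑ y, Pb h (s l h) (a l h) y * W l (h + 1) y)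
    (hW0 : ∀ l, m₀ ≤ l → l < m₁ → ∀ t, W l H t = 0)
    (hc : ∀ h < H, Conc p.ι (Finset.Ico m₀ m₁)
      (fun l => (optV H rb Pb (h + 1) (s l (h + 1)) - W l (h + 1) (s l (h + 1))) / H)
      (fun l => ∑ y, Pb h (s l h) (a l h) y * ((optV H rb Pb (h + 1) y - W l (h + 1) y) / H))) :
    ∑ l ∈ Finset.Ico m₀ m₁, (optV H rb Pb 0 (s l 0) - W l 0 (s l 0)) ≤
      H * (2 ^ H * ((Fintype.card S * Fintype.card A) * epochBonus H p.ι (m₁ - m₀ : ℕ))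
        + H * √((m₁ - m₀ : ℕ) * p.ι)) := by
  have hH0 : (0 : ℝ) < H := by exact_mod_cast hH
  set B := (Fintype.card S * Fintype.card A) * epochBonus H p.ι (m₁ - m₀ : ℕ) with hB
  have hB0 : 0 ≤ B := by rw [hB, epochBonus]; positivity
  have step : ∀ h < H, ∑ l ∈ Finset.Ico m₀ m₁, (optV H rb Pb h (s l h) - W l h (s l h)) ≤
      ∑ l ∈ Finset.Ico m₀ m₁,
        (optV H rb Pb (h + 1) (s l (h + 1)) - W l (h + 1) (s l (h + 1)))
      + (2 ^ H * B + H * √((m₁ - m₀ : ℕ) * p.ι)) := by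
    intro h hh
    have h1 := r.sum_gap_le hH g hι good hg hh hm
    have h2 := (abs_le.1 (hc h hh).1).1
    rw [Nat.card_Ico] at h2
    -- Optimism and greediness give `V* ≤ Q`, and the Bellman equations then give `V* - W ≤ (Q - Q*)
    -- + P(V* - W)`. The last term is the realized next-state value minus a martingale difference.
    have h3 : ∑ l ∈ Finset.Ico m₀ m₁, (optV H rb Pb h (s l h) - W l h (s l h)) ≤
        ∑ l ∈ Finset.Ico m₀ m₁,
          ((x l).Q h (s l h) (a l h) - optQ H rb Pb h (s l h) (a l h))
        + ∑ l ∈ Finset.Ico m₀ m₁,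
          (optV H rb Pb (h + 1) (s l (h + 1)) - W l (h + 1) (s l (h + 1)))
        - H * ∑ l ∈ Finset.Ico m₀ m₁,
          ((optV H rb Pb (h + 1) (s l (h + 1)) - W l (h + 1) (s l (h + 1))) / H
          - ∑ y, Pb h (s l h) (a l h) y
            * ((optV H rb Pb (h + 1) y - W l (h + 1) y) / H)) := by
      rw [Finset.mul_sum, ← Finset.sum_add_distrib, ← Finset.sum_sub_distrib]
      refine Finset.sum_le_sum fun l hl => ?_
      obtain ⟨hl0, hl1⟩ := Finset.mem_Ico.1 hl
      have e1 := (r.optimism hH g hι good hl0 hl1.le).2 h hh.le (s l h)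
      rw [r.V_eq_of_greedy hg hl0 hl1 hh] at e1
      have e2 : H * ((optV H rb Pb (h + 1) (s l (h + 1)) - W l (h + 1) (s l (h + 1))) / H
          - ∑ y, Pb h (s l h) (a l h) y * ((optV H rb Pb (h + 1) y - W l (h + 1) y) / H))
          = (optV H rb Pb (h + 1) (s l (h + 1)) - W l (h + 1) (s l (h + 1)))
          - (∑ y, Pb h (s l h) (a l h) y * optV H rb Pb (h + 1) y
            - ∑ y, Pb h (s l h) (a l h) y * W l (h + 1) y) := by
        rw [mul_sub, mul_div_cancel₀ _ hH0.ne', ← Finset.sum_sub_distrib, Finset.mul_sum]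
        congr 1
        refine Finset.sum_congr rfl fun y _ => ?_
        field_simp
      rw [e2, hW l hl0 hl1 h hh, optQ]
      linarith
    have h4 : ((2 : ℝ) ^ (H - h) - 1) * B ≤ 2 ^ H * B := by
      refine mul_le_mul_of_nonneg_right ?_ hB0
      have : (2 : ℝ) ^ (H - h) ≤ 2 ^ H := pow_le_pow_right₀ (by norm_num) (Nat.sub_le _ _)
      linarith
    have h5 := mul_le_mul_of_nonneg_left h2 hH0.le
    linarith
  have hsum : ∀ n, n ≤ H → ∑ l ∈ Finset.Ico m₀ m₁, (optV H rb Pb 0 (s l 0) - W l 0 (s l 0)) ≤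
      ∑ l ∈ Finset.Ico m₀ m₁, (optV H rb Pb n (s l n) - W l n (s l n))
      + n * (2 ^ H * B + H * √((m₁ - m₀ : ℕ) * p.ι)) := by
    intro n
    induction n with
    | zero => intro _; simp
    | succ n ih =>
      intro hn
      have := step n (by omega)
      have := ih (by omega)
      push_cast
      linarith
  refine (hsum H le_rfl).trans (le_of_eq ?_)
  rw [Finset.sum_eq_zero, zero_add]
  intro l hl
  obtain ⟨hl0, hl1⟩ := Finset.mem_Ico.1 hl
  rw [optV_last, hW0 l hl0 hl1, sub_zero]

end IsRun
end Regret

/-! ### The decision process faced by agent 1 -/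

section TeamMDP

variable {S A₁ A₂ : Type*} [Fintype S] [Fintype A₂]

/-- Mean reward of agent 1's action against a policy of agent 2. -/
def Team.rbar (G : Team S A₁ A₂) (π₂ : Policy S A₂) (h : ℕ) (t : S) (b : A₁) : ℝ :=
  ∑ b₂, π₂ h t b₂ * G.r h t b b₂

/-- Transition probabilities of agent 1's action against a policy of agent 2. -/
def Team.Pbar (G : Team S A₁ A₂) (π₂ : Policy S A₂) (h : ℕ) (t : S) (b : A₁) (y : S) : ℝ :=
  ∑ b₂, π₂ h t b₂ * G.P h t b b₂ y

theorem Team.isMDP (G : Team S A₁ A₂) (π₂ : Policy S A₂) : IsMDP (G.rbar π₂) (G.Pbar π₂) where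
  r_nonneg h t b := Finset.sum_nonneg fun b₂ _ =>
    mul_nonneg (stdSimplex.zero_le _ _) (G.r_mem h t b b₂).1
  r_le h t b := by
    calc G.rbar π₂ h t b ≤ ∑ b₂, π₂ h t b₂ := Finset.sum_le_sum fun b₂ _ =>
          mul_le_of_le_one_right (stdSimplex.zero_le _ _) (G.r_mem h t b b₂).2
      _ = 1 := stdSimplex.sum_eq_one _
  P_nonneg h t b y := Finset.sum_nonneg fun b₂ _ =>
    mul_nonneg (stdSimplex.zero_le _ _) (stdSimplex.zero_le _ _)
  P_sum h t b := by
    unfold Team.Pbar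
    rw [Finset.sum_comm]
    simp_rw [← Finset.mul_sum, stdSimplex.sum_eq_one, mul_one]
    exact stdSimplex.sum_eq_one _

variable [Fintype A₁]

theorem Team.meanReward_eq (G : Team S A₁ A₂) (π₁ : Policy S A₁) (π₂ : Policy S A₂) (h : ℕ)
    (t : S) : G.meanReward π₁ π₂ h t = ∑ b, π₁ h t b * G.rbar π₂ h t b := by
  unfold Team.meanReward Team.rbar
  simp_rw [Finset.mul_sum, mul_assoc]

theorem Team.trans_eq (G : Team S A₁ A₂) (π₁ : Policy S A₁) (π₂ : Policy S A₂) (h : ℕ)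
    (t y : S) : G.trans π₁ π₂ h t y = ∑ b, π₁ h t b * G.Pbar π₂ h t b y := by
  unfold Team.trans Team.Pbar
  simp_rw [Finset.mul_sum, mul_assoc]

variable [DecidableEq S]

theorem Team.value_last (G : Team S A₁ A₂) (H : ℕ) (π₁ : Policy S A₁) (π₂ : Policy S A₂) (t : S) :
    G.value H π₁ π₂ H t = 0 := by
  simp [Team.value]

theorem Team.value_eq_sum (G : Team S A₁ A₂) {H : ℕ} (π₁ : Policy S A₁) (π₂ : Policy S A₂) {h : ℕ}
    (hh : h < H) (t : S) : G.value H π₁ π₂ h t = ∑ b, π₁ h t b *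
      (G.rbar π₂ h t b + ∑ y, G.Pbar π₂ h t b y * G.value H π₁ π₂ (h + 1) y) := by
  rw [G.value_eq H π₁ π₂ hh, G.meanReward_eq]
  simp_rw [G.trans_eq, Finset.sum_mul, mul_add, Finset.sum_add_distrib, Finset.mul_sum]
  rw [Finset.sum_comm (γ := S)]
  simp_rw [mul_assoc]

theorem Team.value_ofDet [DecidableEq A₁] (G : Team S A₁ A₂) {H : ℕ} (f : ℕ → S → A₁)
    (π₂ : Policy S A₂) {h : ℕ} (hh : h < H) (t : S) :
    G.value H (Policy.ofDet f) π₂ h t = G.rbar π₂ h t (f h t)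
      + ∑ y, G.Pbar π₂ h t (f h t) y * G.value H (Policy.ofDet f) π₂ (h + 1) y := by
  rw [G.value_eq_sum _ _ hh, Finset.sum_eq_single (f h t)]
  · simp [Policy.ofDet]
  · intro b _ hb
    simp [Policy.ofDet, Pi.single_eq_of_ne hb]
  · simp

theorem Team.value_le_optV [Nonempty A₁] (G : Team S A₁ A₂) {H : ℕ} (π₁ : Policy S A₁)
    (π₂ : Policy S A₂) {h : ℕ} (hh : h ≤ H) (t : S) :
    G.value H π₁ π₂ h t ≤ optV H (G.rbar π₂) (G.Pbar π₂) h t := by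
  induction hh using Nat.decreasingInduction generalizing t with
  | self => rw [G.value_last, optV_last]
  | of_succ h hh ih =>
    rw [G.value_eq_sum _ _ hh]
    calc _ ≤ ∑ b, π₁ h t b * optV H (G.rbar π₂) (G.Pbar π₂) h t := by
          refine Finset.sum_le_sum fun b _ =>
            mul_le_mul_of_nonneg_left ?_ (stdSimplex.zero_le _ _)
          refine le_trans ?_ (optQ_le_optV hh t b)
          exact add_le_add le_rfl ((G.isMDP π₂).mean_mono ih h t b)
      _ = _ := by rw [← Finset.sum_mul, stdSimplex.sum_eq_one, one_mul]

theorem Team.value_nonneg (G : Team S A₁ A₂) {H : ℕ} (π₁ : Policy S A₁)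
    (π₂ : Policy S A₂) {h : ℕ} (hh : h ≤ H) (t : S) : 0 ≤ G.value H π₁ π₂ h t := by
  induction hh using Nat.decreasingInduction generalizing t with
  | self => rw [G.value_last]
  | of_succ h hh ih =>
    rw [G.value_eq_sum _ _ hh]
    exact Finset.sum_nonneg fun b _ => mul_nonneg (stdSimplex.zero_le _ _)
      (add_nonneg ((G.isMDP π₂).r_nonneg _ _ _) ((G.isMDP π₂).le_mean ih h t b))

omit [Fintype A₁] [DecidableEq S] in
-- Only steps below `H` matter, and these are all that the switching cost sees.
theorem Team.optV_congr (G : Team S A₁ A₂) {H : ℕ} {π π' : Policy S A₂}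
    (hπ : ∀ h < H, ∀ t, π h t = π' h t) {h : ℕ} (hh : h ≤ H) (t : S) :
    optV H (G.rbar π) (G.Pbar π) h t = optV H (G.rbar π') (G.Pbar π') h t := by
  induction hh using Nat.decreasingInduction generalizing t with
  | self => rw [optV_last, optV_last]
  | of_succ h hh ih =>
    rw [optV_eq hh, optV_eq hh]
    simp_rw [optQ, ih, Team.rbar, Team.Pbar, hπ h hh t]

end TeamMDP

/-! ### Measurability of the tables -/

section Measurability

variable {Ω : Type*}

/-- States and actions carry no σ-algebra; measurability in them is expressed by the events that
they take given values. -/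
theorem measurable_of_finite_cases {m : MeasurableSpace Ω} {κ : Type*} [Finite κ] {β : Type*}
    [MeasurableSpace β] {k : Ω → κ} (hk : ∀ i, MeasurableSet {ω | k ω = i}) {Φ : κ → Ω → β}
    (hΦ : ∀ i, Measurable (Φ i)) : Measurable fun ω => Φ (k ω) ω := by
  intro B hB
  have : (fun ω => Φ (k ω) ω) ⁻¹' B = ⋃ i, {ω | k ω = i} ∩ Φ i ⁻¹' B := by
    ext ω
    simp
  rw [this]
  exact MeasurableSet.iUnion fun i => (hk i).inter (hΦ i hB)

theorem measurableSet_eq_pair {m : MeasurableSpace Ω} {κ κ' : Type*} {k : Ω → κ} {k' : Ω → κ'}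
    (hk : ∀ i, MeasurableSet {ω | k ω = i}) (hk' : ∀ i, MeasurableSet {ω | k' ω = i})
    (i : κ × κ') : MeasurableSet {ω | (k ω, k' ω) = i} := by
  have : {ω | (k ω, k' ω) = i} = {ω | k ω = i.1} ∩ {ω | k' ω = i.2} := by
    ext ω
    simp [Prod.ext_iff]
  rw [this]
  exact (hk _).inter (hk' _)

variable {S A : Type*} [Fintype S] [DecidableEq S] [Fintype A] [DecidableEq A]

set_option linter.unusedSectionVars false

/-- All entries of a random table are measurable. -/
structure MeasTables (m : MeasurableSpace Ω) (x : Ω → Tables S A) : Prop where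
  Q : ∀ h t b, Measurable fun ω => (x ω).Q h t b
  V : ∀ h t, Measurable fun ω => (x ω).V h t
  N : ∀ h t b, Measurable fun ω => (x ω).N h t b
  Nc : ∀ h t b, Measurable fun ω => (x ω).Nc h t b
  rc : ∀ h t b, Measurable fun ω => (x ω).rc h t b
  vc : ∀ h t b, Measurable fun ω => (x ω).vc h t b
  muc : ∀ h t b, Measurable fun ω => (x ω).muc h t b
  sigc : ∀ h t b, Measurable fun ω => (x ω).sigc h t b
  muref : ∀ h t b, Measurable fun ω => (x ω).muref h t b
  sigref : ∀ h t b, Measurable fun ω => (x ω).sigref h t b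
  Vref : ∀ h t, Measurable fun ω => (x ω).Vref h t

theorem MeasTables.const (m : MeasurableSpace Ω) (x : Tables S A) :
    MeasTables m fun _ => x := by
  constructor <;> intros <;> exact measurable_const

theorem MeasTables.mono {m m' : MeasurableSpace Ω} (hm : m ≤ m') {x : Ω → Tables S A}
    (g : MeasTables m x) : MeasTables m' x := by
  constructor <;> intros
  · exact (g.Q _ _ _).mono hm le_rfl
  · exact (g.V _ _).mono hm le_rfl
  · exact (g.N _ _ _).mono hm le_rfl
  · exact (g.Nc _ _ _).mono hm le_rfl
  · exact (g.rc _ _ _).mono hm le_rfl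
  · exact (g.vc _ _ _).mono hm le_rfl
  · exact (g.muc _ _ _).mono hm le_rfl
  · exact (g.sigc _ _ _).mono hm le_rfl
  · exact (g.muref _ _ _).mono hm le_rfl
  · exact (g.sigref _ _ _).mono hm le_rfl
  · exact (g.Vref _ _).mono hm le_rfl

theorem MeasTables.of_cases {m : MeasurableSpace Ω} {κ : Type*} [Finite κ] {k : Ω → κ}
    (hk : ∀ i, MeasurableSet {ω | k ω = i}) {x : κ → Ω → Tables S A}
    (hx : ∀ i, MeasTables m (x i)) : MeasTables m fun ω => x (k ω) ω := by
  constructor <;> intros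
  · exact measurable_of_finite_cases hk fun i => (hx i).Q _ _ _
  · exact measurable_of_finite_cases hk fun i => (hx i).V _ _
  · exact measurable_of_finite_cases hk fun i => (hx i).N _ _ _
  · exact measurable_of_finite_cases hk fun i => (hx i).Nc _ _ _
  · exact measurable_of_finite_cases hk fun i => (hx i).rc _ _ _
  · exact measurable_of_finite_cases hk fun i => (hx i).vc _ _ _
  · exact measurable_of_finite_cases hk fun i => (hx i).muc _ _ _
  · exact measurable_of_finite_cases hk fun i => (hx i).sigc _ _ _
  · exact measurable_of_finite_cases hk fun i => (hx i).muref _ _ _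
  · exact measurable_of_finite_cases hk fun i => (hx i).sigref _ _ _
  · exact measurable_of_finite_cases hk fun i => (hx i).Vref _ _

theorem MeasTables.record {m : MeasurableSpace Ω} {x : Ω → Tables S A} (g : MeasTables m x) (h : ℕ)
    (s : S) (a : A) {R : Ω → ℝ} (hR : Measurable R) (s' : S) :
    MeasTables m fun ω => (x ω).record h s a (R ω) s' := by
  have key : ∀ {β : Type} [MeasurableSpace β] {f : Ω → ℕ → S → A → β} {v : Ω → β},
      (∀ h t b, Measurable fun ω => f ω h t b) → Measurable v →
      ∀ h' t b, Measurable fun ω => setEntry (f ω) h s a (v ω) h' t b := by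
    intro β _ f v hf hv h' t b
    unfold setEntry
    by_cases hc : h' = h ∧ t = s ∧ b = a
    · simpa only [if_pos hc] using hv
    · simpa only [if_neg hc] using hf h' t b
  constructor
  · exact g.Q
  · exact g.V
  · exact key g.N ((g.N _ _ _).add_const 1)
  · exact key g.Nc ((g.Nc _ _ _).add_const 1)
  · exact key g.rc ((g.rc _ _ _).add hR)
  · exact key g.vc ((g.vc _ _ _).add (g.V _ _))
  · exact key g.muc ((g.muc _ _ _).add ((g.V _ _).sub (g.Vref _ _)))
  · exact key g.sigc ((g.sigc _ _ _).add (((g.V _ _).sub (g.Vref _ _)).pow_const 2))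
  · exact key g.muref ((g.muref _ _ _).add (g.Vref _ _))
  · exact key g.sigref ((g.sigref _ _ _).add ((g.Vref _ _).pow_const 2))
  · exact g.Vref

theorem MeasTables.newQ {m : MeasurableSpace Ω} {x : Ω → Tables S A} (g : MeasTables m x) (H : ℕ)
    (p : Params A) (h : ℕ) (s : S) (a : A) :
    Measurable fun ω => newQ H p (x ω) h s a := by
  have hn : Measurable fun ω => ((x ω).N h s a : ℝ) := measurable_from_nat.comp (g.N h s a)
  have hnc : Measurable fun ω => ((x ω).Nc h s a : ℝ) := measurable_from_nat.comp (g.Nc h s a)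
  have h1 := g.Q h s a
  have h2 := g.rc h s a
  have h3 := g.vc h s a
  have h4 := g.muc h s a
  have h5 := g.sigc h s a
  have h6 := g.muref h s a
  have h7 := g.sigref h s a
  have hb1 : Measurable fun ω => hoeffdingBonus H p.ι ((x ω).Nc h s a) := by
    unfold hoeffdingBonus
    fun_prop
  have hb2 : Measurable fun ω => freedmanBonus H p.ι (x ω) h s a := by
    unfold freedmanBonus
    dsimp only
    fun_prop
  have ht : Measurable fun ω => (x ω).rc h s a / ((x ω).Nc h s a : ℝ)
      + (x ω).vc h s a / ((x ω).Nc h s a : ℝ) + hoeffdingBonus H p.ι ((x ω).Nc h s a) :=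
    ((h2.div hnc).add (h3.div hnc)).add hb1
  unfold TeamRL.newQ
  dsimp only
  cases p.bonus
  · exact ht.min h1
  · exact ht.min (((((h2.div hnc).add (h6.div hn)).add (h4.div hnc)).add (hb2.const_mul 2)).min h1)

theorem MeasTables.update {m : MeasurableSpace Ω} {x : Ω → Tables S A} (g : MeasTables m x) (H : ℕ)
    (p : Params A) (h : ℕ) (s : S) (a : A) {R : Ω → ℝ} (hR : Measurable R) (s' : S) :
    MeasTables m fun ω => (x ω).update H p h s a (R ω) s' := by
  have hE : MeasurableSet {ω | (x ω).N h s a + 1 ∈ stageEnds H} :=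
    ((g.N h s a).add_const 1) (MeasurableSet.of_discrete (s := stageEnds H))
  -- From here on the updated tables are known only through their row-wise description by `RowStep`.
  obtain ⟨x', hx'⟩ : ∃ x' : Ω → Tables S A, x' = fun ω => (x ω).update H p h s a (R ω) s' :=
    ⟨_, rfl⟩
  have hne : ∀ ω h', h' ≠ h → (x' ω).RowAgree (x ω) h' := fun ω _ hh => by
    rw [hx']
    exact Tables.update_rowAgree H p (x ω) hh s a (R ω) s'
  have st : ∀ ω, RowStep H p (x ω) (x' ω) h s a (R ω) s' := fun ω => by
    rw [hx']
    exact Tables.rowStep_update H p (x ω) h s a (R ω) s'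
  rw [← hx']
  clear hx'
  have key : ∀ {β : Type} [MeasurableSpace β] {f f' : Tables S A → ℕ → S → A → β}
      {v : Ω → β}, (∀ h t b, Measurable fun ω => f (x ω) h t b) → Measurable v →
      (∀ ω h', h' ≠ h → f' (x' ω) h' = f (x ω) h') →
      (∀ ω t b, f' (x' ω) h t b = if t = s ∧ b = a then v ω else f (x ω) h t b) →
      ∀ h' t b, Measurable fun ω => f' (x' ω) h' t b := by
    intro β _ f f' v hf hv h1 h2 h' t b
    by_cases hh : h' = h
    · subst hh
      simp_rw [h2]
      by_cases hc : t = s ∧ b = a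
      · simpa only [if_pos hc] using hv
      · simpa only [if_neg hc] using hf h' t b
    · simp_rw [h1 _ _ hh]
      exact hf h' t b
  have mN : ∀ h' t b, Measurable fun ω => (x' ω).N h' t b :=
    key (f := Tables.N) (f' := Tables.N) g.N ((g.N h s a).add_const 1)
      (fun ω h' hh => (hne ω _ hh).N) fun ω => (st ω).N
  have mQ : ∀ h' t b, Measurable fun ω => (x' ω).Q h' t b := by
    intro h' t b
    by_cases hh : h' = h
    · subst hh
      simp only [fun ω => (st ω).Q t b]
      by_cases hc : t = s ∧ b = a
      · exact Measurable.ite (by simpa [hc.1, hc.2] using hE) ((g.record h' s a hR s').newQ H p h' s a) (g.Q h' t b)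
      · simpa only [← and_assoc, hc, false_and, if_false] using g.Q h' t b
    · simp only [fun ω => (hne ω _ hh).Q]
      exact g.Q h' t b
  have mV : ∀ h' t, Measurable fun ω => (x' ω).V h' t := by
    intro h' t
    by_cases hh : h' = h
    · subst hh
      simp only [fun ω => (st ω).V t]
      by_cases hc : t = s
      · exact Measurable.ite (by simpa [hc] using hE) (Measurable.iSup fun b => mQ h' s b) (g.V h' t)
      · simpa only [hc, false_and, if_false] using g.V h' t
    · simp only [fun ω => (hne ω _ hh).V]
      exact g.V h' t
  constructor
  · exact mQ
  · exact mV
  · exact mN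
  · exact key (f := Tables.Nc) (f' := Tables.Nc) g.Nc
      (Measurable.ite hE measurable_const ((g.Nc h s a).add_const 1))
      (fun ω h' hh => (hne ω _ hh).Nc) fun ω => (st ω).Nc
  · exact key (f := Tables.rc) (f' := Tables.rc) g.rc
      (Measurable.ite hE measurable_const ((g.rc h s a).add hR))
      (fun ω h' hh => (hne ω _ hh).rc) fun ω => (st ω).rc
  · exact key (f := Tables.vc) (f' := Tables.vc) g.vc
      (Measurable.ite hE measurable_const ((g.vc h s a).add (g.V _ _)))
      (fun ω h' hh => (hne ω _ hh).vc) fun ω => (st ω).vc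
  · exact key (f := Tables.muc) (f' := Tables.muc) g.muc
      (Measurable.ite hE measurable_const ((g.muc h s a).add ((g.V _ _).sub (g.Vref _ _))))
      (fun ω h' hh => (hne ω _ hh).muc) fun ω => (st ω).muc
  · exact key (f := Tables.sigc) (f' := Tables.sigc) g.sigc
      (Measurable.ite hE measurable_const
        ((g.sigc h s a).add (((g.V _ _).sub (g.Vref _ _)).pow_const 2)))
      (fun ω h' hh => (hne ω _ hh).sigc) fun ω => (st ω).sigc
  · exact key (f := Tables.muref) (f' := Tables.muref) g.muref
      ((g.muref h s a).add (g.Vref _ _))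
      (fun ω h' hh => (hne ω _ hh).muref) fun ω => (st ω).muref
  · exact key (f := Tables.sigref) (f' := Tables.sigref) g.sigref
      ((g.sigref h s a).add ((g.Vref _ _).pow_const 2))
      (fun ω h' hh => (hne ω _ hh).sigref) fun ω => (st ω).sigref
  · intro h' t
    by_cases hh : h' = h
    · subst hh
      simp only [fun ω => (st ω).Vref t]
      by_cases hc : t = s
      · simp only [hc, true_and]
        refine Measurable.ite ?_ (mV h' s) (g.Vref h' s)
        exact (Finset.measurable_sum Finset.univ fun b _ => mN h' s b)
          (measurableSet_singleton p.N₀)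
      · simpa only [hc, false_and, if_false] using g.Vref h' t
    · simp only [fun ω => (hne ω _ hh).Vref]
      exact g.Vref h' t

/-- The set of maximizers takes finitely many values, so the event splits according to it and the
tie-breaking rule may be arbitrary. -/
theorem MeasTables.measurableSet_greedy {m : MeasurableSpace Ω} {x : Ω → Tables S A}
    (g : MeasTables m x) (p : Params A) (h : ℕ) (t : S) (b : A) :
    MeasurableSet {ω | greedy p (x ω) h t = b} := by
  have h1 : ∀ c, MeasurableSet {ω | ∀ a', (x ω).Q h t a' ≤ (x ω).Q h t c} := fun c =>
    MeasurableSet.iInter (f := fun a' => {ω | (x ω).Q h t a' ≤ (x ω).Q h t c}) (fun a' =>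
      measurableSet_le (g.Q h t a') (g.Q h t c)) |>.congr (by ext; simp)
  have h2 : ∀ F : Finset A, MeasurableSet
      {ω | (Finset.univ.filter fun c => ∀ a', (x ω).Q h t a' ≤ (x ω).Q h t c) = F} := by
    intro F
    have : {ω | (Finset.univ.filter fun c => ∀ a', (x ω).Q h t a' ≤ (x ω).Q h t c) = F}
        = ⋂ c, {ω | (∀ a', (x ω).Q h t a' ≤ (x ω).Q h t c) ↔ c ∈ F} := by
      ext ω
      simp [Finset.ext_iff]
    rw [this]
    refine MeasurableSet.iInter fun c => ?_
    by_cases hc : c ∈ F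
    · simpa [hc] using h1 c
    · have := (h1 c).compl
      simp only [hc, iff_false]
      exact this
  have h3 : {ω | greedy p (x ω) h t = b} = ⋃ F : Finset A, ⋃ (_ : p.pick F = b),
      {ω | (Finset.univ.filter fun c => ∀ a', (x ω).Q h t a' ≤ (x ω).Q h t c) = F} := by
    ext ω
    simp only [Set.mem_ofPred_eq, Set.mem_iUnion, exists_prop, greedy]
    constructor
    · intro hω
      exact ⟨_, hω, rfl⟩
    · rintro ⟨F, hF, rfl⟩
      exact hF
  rw [h3]
  exact MeasurableSet.iUnion fun F => MeasurableSet.iUnion fun _ => h2 F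

end Measurability

/-! ### Processes attached to a play -/

section PlayProcesses

variable {S A₁ A₂ Ω : Type*} [Fintype S] [DecidableEq S] [Fintype A₁] [DecidableEq A₁]
  [Fintype A₂] [mΩ : MeasurableSpace Ω]

/-- The tables at the beginning of episode `m`. -/
def Play.tables (X : Play S A₁ A₂ Ω) (H : ℕ) (p : Params A₁) (m : ℕ) (ω : Ω) : Tables S A₁ :=
  startOfEpisode H p (fun m h => X.state m h ω) (fun m h => X.act₁ m h ω)
    (fun m h => X.reward m h ω) m

/-- The tables before step `h` of episode `m`. -/
def Play.tablesWithin (X : Play S A₁ A₂ Ω) (H : ℕ) (p : Params A₁) (m h : ℕ) (ω : Ω) :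
    Tables S A₁ :=
  withinEpisode H p (X.tables H p m ω) (fun h => X.state m h ω) (fun h => X.act₁ m h ω)
    (fun h => X.reward m h ω) h

/-- The information before step `h` of the successive episodes. -/
def stepFiltration (ℱ : Filtration ℕ mΩ) (H h : ℕ) : Filtration ℕ mΩ where
  seq l := ℱ (l * H + h)
  mono' _ _ hij := ℱ.mono (by gcongr)
  le' l := ℱ.le _

variable {G : Team S A₁ A₂} {H M : ℕ} {p : Params A₁} {s₁ : ℕ → S} {ℙ : Measure Ω}
  {ℱ : Filtration ℕ mΩ} {X : Play S A₁ A₂ Ω}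

namespace IsPlay

theorem meas_within (hX : IsPlay G H M p s₁ ℙ ℱ X) {m : ℕ} (hm : m < M)
    (h0 : MeasTables (ℱ (m * H)) (X.tables H p m)) :
    ∀ h ≤ H, MeasTables (ℱ (m * H + h)) (X.tablesWithin H p m h) ∧
      (h < H → ∀ b, MeasurableSet[ℱ (m * H + h)] {ω | X.act₁ m h ω = b}) := by
  have hact : ∀ h < H, MeasTables (ℱ (m * H + h)) (X.tablesWithin H p m h) →
      ∀ b, MeasurableSet[ℱ (m * H + h)] {ω | X.act₁ m h ω = b} := by
    intro h hh hT b
    have : {ω | X.act₁ m h ω = b} = ⋃ t, {ω | X.state m h ω = t} ∩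
        {ω | greedy p (X.tablesWithin H p m h ω) h t = b} := by
      ext ω
      simp only [Set.mem_ofPred_eq, Set.mem_iUnion, Set.mem_inter_iff, exists_eq_left']
      rw [hX.act₁_eq m hm h hh ω]
      rfl
    rw [this]
    exact MeasurableSet.iUnion fun t =>
      (hX.state_meas m hm h hh.le t).inter (hT.measurableSet_greedy p h t b)
  intro h
  induction h with
  | zero => exact fun _ => ⟨h0, fun hh => hact 0 hh h0⟩
  | succ h ih =>
    intro hh
    have hT : MeasTables (ℱ (m * H + (h + 1))) (X.tablesWithin H p m (h + 1)) := by
      obtain ⟨i1, i2⟩ := ih (by omega)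
      have hle : ℱ (m * H + h) ≤ ℱ (m * H + (h + 1)) := ℱ.mono (by omega)
      have k1 : ∀ t, MeasurableSet[ℱ (m * H + (h + 1))] {ω | X.state m h ω = t} := fun t =>
        hle _ (hX.state_meas m hm h (by omega) t)
      have k2 : ∀ t, MeasurableSet[ℱ (m * H + (h + 1))] {ω | X.act₁ m h ω = t} := fun t =>
        hle _ (i2 (by omega) t)
      have k3 := hX.state_meas m hm (h + 1) hh
      exact MeasTables.of_cases (k := fun ω => ((X.state m h ω, X.act₁ m h ω), X.state m (h + 1) ω))
        (measurableSet_eq_pair (measurableSet_eq_pair k1 k2) k3)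
        (x := fun i ω => (X.tablesWithin H p m h ω).update H p h i.1.1 i.1.2 (X.reward m h ω) i.2)
        fun i => (i1.mono hle).update H p h i.1.1 i.1.2 (hX.reward_meas m hm h (by omega)) i.2
    exact ⟨hT, fun hh => hact _ hh hT⟩

theorem meas_tables (hX : IsPlay G H M p s₁ ℙ ℱ X) {m : ℕ} (hm : m < M) :
    MeasTables (ℱ (m * H)) (X.tables H p m) := by
  induction m with
  | zero => exact MeasTables.const _ _
  | succ m ih =>
    by_cases hK : p.K ∣ m + 1
    · have : X.tables H p (m + 1) = fun _ => Tables.init S A₁ H := by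
        funext ω
        simp [Play.tables, startOfEpisode, hK]
      rw [this]
      exact MeasTables.const _ _
    · have : X.tables H p (m + 1) = X.tablesWithin H p m H := by
        funext ω
        simp [Play.tables, Play.tablesWithin, startOfEpisode, hK]
      rw [this, Nat.succ_mul]
      exact (hX.meas_within (by omega) (ih (by omega)) H le_rfl).1

theorem act₁_meas (hX : IsPlay G H M p s₁ ℙ ℱ X) {m : ℕ} (hm : m < M) {h : ℕ} (hh : h < H)
    (b : A₁) : MeasurableSet[ℱ (m * H + h)] {ω | X.act₁ m h ω = b} :=
  (hX.meas_within hm (hX.meas_tables hm) h hh.le).2 hh b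

/-- Row `h` is untouched before step `h`, so the actions taken are those of the policy fixed at the
start of the episode, whose value is being bounded. -/
theorem act₁_eq_greedy (hX : IsPlay G H M p s₁ ℙ ℱ X) {m : ℕ} (hm : m < M) {h : ℕ} (hh : h < H)
    (ω : Ω) : X.act₁ m h ω = greedy p (X.tables H p m ω) h (X.state m h ω) :=
  (hX.act₁_eq m hm h hh ω).trans
    (greedy_congr p (withinEpisode_rowAgree_of_le H p _ _ _ _ le_rfl) _)

theorem rbar_meas (hX : IsPlay G H M p s₁ ℙ ℱ X) {m : ℕ} (hm : m < M) {h : ℕ} (hh : h < H)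
    (t : S) (b : A₁) : Measurable[ℱ (m * H)] fun ω => G.rbar (X.pol₂ m ω) h t b :=
  Finset.measurable_sum _ fun b₂ _ => (hX.pol₂_meas m hm h hh t b₂).mul_const _

theorem Pbar_meas (hX : IsPlay G H M p s₁ ℙ ℱ X) {m : ℕ} (hm : m < M) {h : ℕ} (hh : h < H)
    (t : S) (b : A₁) (y : S) : Measurable[ℱ (m * H)] fun ω => G.Pbar (X.pol₂ m ω) h t b y :=
  Finset.measurable_sum _ fun b₂ _ => (hX.pol₂_meas m hm h hh t b₂).mul_const _

theorem optV_meas (hX : IsPlay G H M p s₁ ℙ ℱ X) {m : ℕ} (hm : m < M) {h : ℕ} (hh : h ≤ H)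
    (t : S) : Measurable[ℱ (m * H)] fun ω =>
      optV H (G.rbar (X.pol₂ m ω)) (G.Pbar (X.pol₂ m ω)) h t := by
  induction hh using Nat.decreasingInduction generalizing t with
  | self => simp only [optV_last]; exact measurable_const
  | of_succ h hh ih =>
    simp only [optV_eq hh]
    exact Measurable.iSup fun b => (hX.rbar_meas hm hh t b).add
      (Finset.measurable_sum _ fun y _ => (hX.Pbar_meas hm hh t b y).mul (ih y))

theorem value_meas (hX : IsPlay G H M p s₁ ℙ ℱ X) {m : ℕ} (hm : m < M) {h : ℕ} (hh : h ≤ H)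
    (t : S) : Measurable[ℱ (m * H)] fun ω =>
      G.value H (X.pol₁ H p m ω) (X.pol₂ m ω) h t := by
  induction hh using Nat.decreasingInduction generalizing t with
  | self => simp only [G.value_last]; exact measurable_const
  | of_succ h hh ih =>
    have : (fun ω => G.value H (X.pol₁ H p m ω) (X.pol₂ m ω) h t) = fun ω =>
        (fun b ω => G.rbar (X.pol₂ m ω) h t b + ∑ y, G.Pbar (X.pol₂ m ω) h t b y
          * G.value H (X.pol₁ H p m ω) (X.pol₂ m ω) (h + 1) y)
          (greedy p (X.tables H p m ω) h t) ω := by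
      funext ω
      exact G.value_ofDet _ _ hh t
    rw [this]
    exact measurable_of_finite_cases
      (fun b => (hX.meas_tables hm).measurableSet_greedy p h t b)
      (fun b => (hX.rbar_meas hm hh t b).add
        (Finset.measurable_sum _ fun y _ => (hX.Pbar_meas hm hh t b y).mul (ih y)))

variable [IsProbabilityMeasure ℙ]

/-- Expand over the finitely many pairs of agent 2's action and next state. The function `Φ` is
known before the step and leaves the conditional expectation; summing out agent 2's action produces
`Team.Pbar`. -/
theorem condExp_state (hX : IsPlay G H M p s₁ ℙ ℱ X) {m : ℕ} (hm : m < M) {h : ℕ} (hh : h < H)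
    {Φ : Ω → S → ℝ} (hΦ : ∀ y, Measurable[ℱ (m * H + h)] fun ω => Φ ω y)
    (hb : ∀ ω y, Φ ω y ∈ Set.Icc (0 : ℝ) 1) :
    ℙ[fun ω => Φ ω (X.state m (h + 1) ω) | ℱ (m * H + h)] =ᵐ[ℙ] fun ω =>
      ∑ y, G.Pbar (X.pol₂ m ω) h (X.state m h ω) (X.act₁ m h ω) y * Φ ω y := by
  set E : A₂ × S → Ω → ℝ := fun i =>
    Set.indicator {ω | X.act₂ m h ω = i.1 ∧ X.state m (h + 1) ω = i.2} fun _ => (1 : ℝ) with hE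
  have hset : ∀ i : A₂ × S,
      MeasurableSet {ω | X.act₂ m h ω = i.1 ∧ X.state m (h + 1) ω = i.2} := fun i =>
    (ℱ.le _ _ (hX.act₂_meas m hm h hh i.1)).inter (ℱ.le _ _ (hX.state_meas m hm (h + 1) hh i.2))
  have hEi : ∀ i, Integrable (E i) ℙ := fun i => (integrable_const 1).indicator (hset i)
  have hΦb : ∀ y, ∀ᵐ ω ∂ℙ, ‖Φ ω y‖ ≤ 1 := fun y => ae_of_all _ fun ω => by
    rw [Real.norm_eq_abs, abs_le]
    constructor <;> linarith [(hb ω y).1, (hb ω y).2]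
  have hprod : ∀ i, Integrable ((fun ω => Φ ω i.2) * E i) ℙ := fun i =>
    (hEi i).bdd_mul (((hΦ i.2).mono (ℱ.le _) le_rfl).aestronglyMeasurable) (hΦb i.2)
  have hsum : (fun ω => Φ ω (X.state m (h + 1) ω)) = ∑ i : A₂ × S, (fun ω => Φ ω i.2) * E i := by
    funext ω
    rw [Finset.sum_apply, Finset.sum_eq_single (X.act₂ m h ω, X.state m (h + 1) ω)]
    · simp [hE]
    · rintro ⟨b, y⟩ _ hne
      have : ¬(X.act₂ m h ω = b ∧ X.state m (h + 1) ω = y) := by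
        rintro ⟨rfl, rfl⟩
        exact hne rfl
      simp [hE, this]
    · simp
  rw [hsum]
  have h1 := condExp_finsetSum (μ := ℙ) (s := Finset.univ) (fun i _ => hprod i) (ℱ (m * H + h))
  have h2 : ∀ᵐ ω ∂ℙ, ∀ i, ℙ[(fun ω => Φ ω i.2) * E i | ℱ (m * H + h)] ω
      = Φ ω i.2 * ℙ[E i | ℱ (m * H + h)] ω := by
    rw [ae_all_iff]
    intro i
    exact condExp_stronglyMeasurable_mul_of_bound (ℱ.le _) (hΦ i.2).stronglyMeasurable (hEi i) 1
      (hΦb i.2)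
  have h3 : ∀ᵐ ω ∂ℙ, ∀ i : A₂ × S, ℙ[E i | ℱ (m * H + h)] ω
      = X.pol₂ m ω h (X.state m h ω) i.1 * G.P h (X.state m h ω) (X.act₁ m h ω) i.1 i.2 := by
    rw [ae_all_iff]
    intro i
    exact hX.step_law m hm h hh i.1 i.2
  filter_upwards [h1, h2, h3] with ω e1 e2 e3
  rw [e1, Finset.sum_apply]
  simp_rw [e2, e3, Team.Pbar, Finset.sum_mul]
  rw [Fintype.sum_prod_type_right]
  refine Finset.sum_congr rfl fun y _ => Finset.sum_congr rfl fun b _ => ?_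
  ring

theorem condExp_reward (hX : IsPlay G H M p s₁ ℙ ℱ X) {m : ℕ} (hm : m < M) {h : ℕ} (hh : h < H) :
    ℙ[X.reward m h | ℱ (m * H + h)] =ᵐ[ℙ] fun ω =>
      G.rbar (X.pol₂ m ω) h (X.state m h ω) (X.act₁ m h ω) := by
  have hRi : Integrable (X.reward m h) ℙ := by
    refine Integrable.of_bound ((hX.reward_meas m hm h hh).mono (ℱ.le _)
      le_rfl).aestronglyMeasurable 1 (ae_of_all _ fun ω => ?_)
    have := hX.reward_mem m hm h hh ω
    rw [Real.norm_eq_abs, abs_le]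
    constructor <;> linarith [this.1, this.2]
  have hsum : X.reward m h
      = ∑ b, Set.indicator {ω | X.act₂ m h ω = b} (X.reward m h) := by
    funext ω
    rw [Finset.sum_apply, Finset.sum_eq_single (X.act₂ m h ω)]
    · simp
    · intro b _ hne
      simp [hne.symm]
    · simp
  have h1 := condExp_finsetSum (μ := ℙ) (s := Finset.univ)
    (f := fun b => Set.indicator {ω | X.act₂ m h ω = b} (X.reward m h))
    (fun b _ => hRi.indicator (ℱ.le _ _ (hX.act₂_meas m hm h hh b))) (ℱ (m * H + h))
  rw [← hsum] at h1
  have h3 : ∀ᵐ ω ∂ℙ, ∀ b, ℙ[Set.indicator {ω | X.act₂ m h ω = b} (X.reward m h) |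
      ℱ (m * H + h)] ω = X.pol₂ m ω h (X.state m h ω) b *
        G.r h (X.state m h ω) (X.act₁ m h ω) b := by
    rw [ae_all_iff]
    exact fun b => hX.reward_law m hm h hh b
  filter_upwards [h1, h3] with ω e1 e3
  rw [e1, Finset.sum_apply]
  simp_rw [e3]
  rfl

omit [IsProbabilityMeasure ℙ] in
theorem measurable_step (hX : IsPlay G H M p s₁ ℙ ℱ X) {m : ℕ} (hm : m < M) {h : ℕ} (hh : h < H)
    {Φ : S → A₁ → Ω → ℝ} (hΦ : ∀ t b, Measurable[ℱ (m * H + h)] (Φ t b)) :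
    Measurable[ℱ (m * H + h)] fun ω => Φ (X.state m h ω) (X.act₁ m h ω) ω :=
  measurable_of_finite_cases (k := fun ω => (X.state m h ω, X.act₁ m h ω))
    (measurableSet_eq_pair (hX.state_meas m hm h hh.le) (hX.act₁_meas hm hh))
    (Φ := fun i => Φ i.1 i.2) fun i => hΦ i.1 i.2

/-- For fixed `h`, episodes play the role of time. The next state is known at time `l * H + h + 1`,
no later than step `h` of episode `l + 1`. -/
theorem isUnitProc_state (hX : IsPlay G H M p s₁ ℙ ℱ X) {h : ℕ} (hh : h < H)
    {Φ : ℕ → Ω → S → ℝ} (hΦ : ∀ l < M, ∀ y, Measurable[ℱ (l * H)] fun ω => Φ l ω y)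
    (hb : ∀ l < M, ∀ ω y, Φ l ω y ∈ Set.Icc (0 : ℝ) 1) :
    IsUnitProc ℙ (stepFiltration ℱ H h) M (fun l ω => Φ l ω (X.state l (h + 1) ω))
      (fun l ω => ∑ y, G.Pbar (X.pol₂ l ω) h (X.state l h ω) (X.act₁ l h ω) y * Φ l ω y) where
  U_meas l hl := by
    have hle : l * H + (h + 1) ≤ (l + 1) * H + h := by rw [Nat.succ_mul]; omega
    exact measurable_of_finite_cases (m := ℱ ((l + 1) * H + h)) (k := X.state l (h + 1))
      (fun y => ℱ.mono hle _ (hX.state_meas l hl (h + 1) hh y)) (Φ := fun y ω => Φ l ω y)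
      fun y => (hΦ l hl y).mono (ℱ.mono (by rw [Nat.succ_mul]; omega)) le_rfl
  U_mem l hl ω := hb l hl ω _
  u_meas l hl := hX.measurable_step hl hh (Φ := fun t b ω =>
    ∑ y, G.Pbar (X.pol₂ l ω) h t b y * Φ l ω y) fun t b =>
      (Finset.measurable_sum _ fun y _ => (hX.Pbar_meas hl hh t b y).mul (hΦ l hl y)).mono
        (ℱ.mono (Nat.le_add_right _ _)) le_rfl
  u_mem l hl ω := ⟨(G.isMDP _).le_mean (fun y => (hb l hl ω y).1) _ _ _,
    (G.isMDP _).mean_le (fun y => (hb l hl ω y).2) _ _ _⟩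
  cond l hl := hX.condExp_state hl hh
    (fun y => (hΦ l hl y).mono (ℱ.mono (Nat.le_add_right _ _)) le_rfl) (hb l hl)

theorem isUnitProc_reward (hX : IsPlay G H M p s₁ ℙ ℱ X) {h : ℕ} (hh : h < H) :
    IsUnitProc ℙ (stepFiltration ℱ H h) M (fun l ω => X.reward l h ω)
      (fun l ω => G.rbar (X.pol₂ l ω) h (X.state l h ω) (X.act₁ l h ω)) where
  U_meas l hl := (hX.reward_meas l hl h hh).mono (ℱ.mono (by rw [Nat.succ_mul]; omega)) le_rfl
  U_mem l hl ω := hX.reward_mem l hl h hh ω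
  u_meas l hl := hX.measurable_step hl hh (Φ := fun t b ω => G.rbar (X.pol₂ l ω) h t b)
    fun t b => (hX.rbar_meas hl hh t b).mono (ℱ.mono (Nat.le_add_right _ _)) le_rfl
  u_mem l hl ω := ⟨(G.isMDP _).r_nonneg _ _ _, (G.isMDP _).r_le _ _ _⟩
  cond l hl := hX.condExp_reward hl hh

end IsPlay
end PlayProcesses

/-! ### The regret of an epoch of a play in which agent 2 does not switch -/

theorem Conc.congr {ι : ℝ} {I : Finset ℕ} {U u U' u' : ℕ → ℝ} (c : Conc ι I U u)
    (hU : ∀ l ∈ I, U l = U' l) (hu : ∀ l ∈ I, u l = u' l) : Conc ι I U' u' := by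
  have e1 : ∑ l ∈ I, (U l - u l) = ∑ l ∈ I, (U' l - u' l) :=
    Finset.sum_congr rfl fun l hl => by rw [hU l hl, hu l hl]
  have e2 : ∑ l ∈ I, U l = ∑ l ∈ I, U' l := Finset.sum_congr rfl hU
  have e3 : ∑ l ∈ I, U l ^ 2 = ∑ l ∈ I, U' l ^ 2 :=
    Finset.sum_congr rfl fun l hl => by rw [hU l hl]
  unfold Conc at c ⊢
  rwa [e1, e2, e3] at c

theorem conc_empty {ι : ℝ} (hι : 0 ≤ ι) (U u : ℕ → ℝ) : Conc ι ∅ U u := by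
  constructor
  · simp
  · simp [hι]

section Epoch

variable {S A : Type*} [Fintype S] [DecidableEq S] [Fintype A] [DecidableEq A]

set_option linter.unusedSectionVars false

/-- The tables after `n` episodes of an epoch that starts in episode `m₀` and is never restarted. -/
def epochTables (H : ℕ) (p : Params A) (s : ℕ → ℕ → S) (a : ℕ → ℕ → A) (R : ℕ → ℕ → ℝ) (m₀ : ℕ) :
    ℕ → Tables S A
  | 0 => Tables.init S A H
  | n + 1 => withinEpisode H p (epochTables H p s a R m₀ n) (s (m₀ + n)) (a (m₀ + n)) (R (m₀ + n)) H

theorem isRun_epochTables (H : ℕ) (p : Params A) (s : ℕ → ℕ → S) (a : ℕ → ℕ → A) (R : ℕ → ℕ → ℝ)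
    (m₀ : ℕ) : IsRun H p m₀ (fun m => epochTables H p s a R m₀ (m - m₀)) s a R := by
  have key : ∀ m, m₀ ≤ m → epochTables H p s a R m₀ (m + 1 - m₀) =
      withinEpisode H p (epochTables H p s a R m₀ (m - m₀)) (s m) (a m) (R m) H := by
    intro m hm
    rw [show m + 1 - m₀ = (m - m₀) + 1 by omega, epochTables, show m₀ + (m - m₀) = m by omega]
  constructor
  · simp [epochTables]
  · intro m hm h hh
    rw [key m hm]
    exact rowStep_withinEpisode H p _ _ _ _ hh
  · intro m hm
    rw [key m hm]
    exact withinEpisode_V_ge H p _ _ _ _ le_rfl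

/-- The unrestarted tables agree with the actual ones as long as no multiple of `K` is passed, so
the analysis of a run never mentions restarts. -/
theorem startOfEpisode_eq (H : ℕ) (p : Params A) (s : ℕ → ℕ → S) (a : ℕ → ℕ → A) (R : ℕ → ℕ → ℝ)
    {m₀ : ℕ} (hm₀ : p.K ∣ m₀) {n : ℕ} (hn : n < p.K) :
    startOfEpisode H p s a R (m₀ + n) = epochTables H p s a R m₀ n := by
  induction n with
  | zero =>
    rw [epochTables]
    cases m₀ with
    | zero => rfl
    | succ m => simp [startOfEpisode, hm₀]
  | succ n ih =>
    have hnd : ¬p.K ∣ m₀ + n + 1 := fun hd => by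
      have h1 : p.K ∣ n + 1 := (Nat.dvd_add_right hm₀).1 hd
      exact absurd (Nat.le_of_dvd (Nat.succ_pos n) h1) (by omega)
    rw [← add_assoc, startOfEpisode, if_neg hnd, ih (by omega), epochTables]

theorem Q_le_greedy (p : Params A) (hp : ∀ F : Finset A, F.Nonempty → p.pick F ∈ F) [Nonempty A]
    (x : Tables S A) (h : ℕ) (t : S) (b : A) : x.Q h t b ≤ x.Q h t (greedy p x h t) := by
  obtain ⟨c, hc⟩ := Finite.exists_max (x.Q h t)
  have := hp (Finset.univ.filter fun a => ∀ a', x.Q h t a' ≤ x.Q h t a)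
    ⟨c, Finset.mem_filter.2 ⟨Finset.mem_univ _, hc⟩⟩
  exact (Finset.mem_filter.1 this).2 b

variable {A₂ Ω : Type*} [Fintype A₂] [mΩ : MeasurableSpace Ω]
  {G : Team S A A₂} {H M : ℕ} {p : Params A} {s₁ : ℕ → S} {ℙ : Measure Ω}
  {ℱ : Filtration ℕ mΩ} {X : Play S A A₂ Ω}

/-- The functions of the next state whose sums have to be controlled. -/
def Play.potential (X : Play S A A₂ Ω) (G : Team S A A₂) (H : ℕ) (p : Params A) (h : ℕ) :
    Fin 4 → ℕ → Ω → S → ℝ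
  | 0, l, ω, y => optV H (G.rbar (X.pol₂ l ω)) (G.Pbar (X.pol₂ l ω)) (h + 1) y / H
  | 1, l, ω, y => clip ((X.tables H p l ω).Vref (h + 1) y / H)
  | 2, l, ω, y => clip (((X.tables H p l ω).Vref (h + 1) y - (X.tables H p l ω).V (h + 1) y) / H)
  | 3, l, ω, y => (optV H (G.rbar (X.pol₂ l ω)) (G.Pbar (X.pol₂ l ω)) (h + 1) y
      - G.value H (X.pol₁ H p l ω) (X.pol₂ l ω) (h + 1) y) / H

/-- The controlled processes: the rewards and the potentials of the next state. -/
def Play.sample (X : Play S A A₂ Ω) (G : Team S A A₂) (H : ℕ) (p : Params A) (h : ℕ) :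
    Option (Fin 4) → ℕ → Ω → ℝ
  | none, l, ω => X.reward l h ω
  | some k, l, ω => X.potential G H p h k l ω (X.state l (h + 1) ω)

/-- Conditional means of the controlled processes. -/
def Play.sampleMean (X : Play S A A₂ Ω) (G : Team S A A₂) (H : ℕ) (p : Params A) (h : ℕ) :
    Option (Fin 4) → ℕ → Ω → ℝ
  | none, l, ω => G.rbar (X.pol₂ l ω) h (X.state l h ω) (X.act₁ l h ω)
  | some k, l, ω => ∑ y, G.Pbar (X.pol₂ l ω) h (X.state l h ω) (X.act₁ l h ω) y
      * X.potential G H p h k l ω y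

/-- The episodes of `[l₀, m)`, or those of them with a visit to a state-action pair. -/
def Play.selection (X : Play S A A₂ Ω) (h : ℕ) (l₀ m : ℕ) : Option (S × A) → Ω → Finset ℕ
  | none, _ => Finset.Ico l₀ m
  | some i, ω => visits (fun l h => X.state l h ω) (fun l h => X.act₁ l h ω) h i.1 i.2 l₀ m

/-- The event on which all sums are concentrated. -/
def Play.Good (X : Play S A A₂ Ω) (G : Team S A A₂) (H M : ℕ) (p : Params A) (ω : Ω) : Prop :=
  ∀ (h : Fin H) (k : Option (Fin 4)) (i : Option (S × A)) (l₀ m : Fin (M + 1)),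
    Conc p.ι (X.selection h l₀ m i ω) (fun l => X.sample G H p h k l ω)
      (fun l => X.sampleMean G H p h k l ω)

theorem IsPlay.isUnitProc_sample [IsProbabilityMeasure ℙ] [Nonempty A]
    (hX : IsPlay G H M p s₁ ℙ ℱ X) {h : ℕ} (hh : h < H) (k : Option (Fin 4)) :
    IsUnitProc ℙ (stepFiltration ℱ H h) M (X.sample G H p h k) (X.sampleMean G H p h k) := by
  have hH0 : (0 : ℝ) < H := by exact_mod_cast (show 0 < H by omega)
  have hh1 : h + 1 ≤ H := hh
  cases k with
  | none => exact hX.isUnitProc_reward hh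
  | some k =>
    refine hX.isUnitProc_state hh (Φ := X.potential G H p h k) ?_ ?_
    · intro l hl y
      have hT := hX.meas_tables hl
      fin_cases k
      · exact (hX.optV_meas hl hh1 y).div_const _
      · exact measurable_const.max (measurable_const.min ((hT.Vref (h + 1) y).div_const _))
      · exact measurable_const.max (measurable_const.min
          (((hT.Vref (h + 1) y).sub (hT.V (h + 1) y)).div_const _))
      · exact ((hX.optV_meas hl hh1 y).sub (hX.value_meas hl hh1 y)).div_const _
    · intro l hl ω y
      have g := G.isMDP (A₁ := A) (X.pol₂ l ω)
      fin_cases k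
      · exact ⟨div_nonneg (g.optV_mem hh1 y).1 hH0.le, (div_le_one hH0).2 (g.optV_le hh1 y)⟩
      · exact clip_mem _
      · exact clip_mem _
      · refine ⟨div_nonneg (sub_nonneg.2 (G.value_le_optV _ _ hh1 y)) hH0.le,
          (div_le_one hH0).2 ?_⟩
        have e1 := g.optV_le hh1 y
        have e2 := G.value_nonneg (X.pol₁ H p l ω) (X.pol₂ l ω) hh1 y
        linarith

/-- Union bound over `H` steps, 5 processes, `SA + 1` selections and `(M + 1)²` windows. The windows
are deterministic, which makes the selections predictable. -/
theorem IsPlay.measureReal_not_good_le [IsProbabilityMeasure ℙ] [Nonempty A]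
    (hX : IsPlay G H M p s₁ ℙ ℱ X) (hι : 1 ≤ p.ι) :
    ℙ.real {ω | ¬ X.Good G H M p ω} ≤
      (H * 5 * (Fintype.card S * Fintype.card A + 1) * (M + 1) * (M + 1))
        * (6 * M * Real.exp (-p.ι)) := by
  have hsub : {ω | ¬ X.Good G H M p ω} ⊆
      ⋃ j : (((Fin H × Option (Fin 4)) × Option (S × A)) × Fin (M + 1)) × Fin (M + 1),
        {ω | ¬ Conc p.ι (X.selection j.1.1.1.1 j.1.2 j.2 j.1.1.2 ω)
          (fun l => X.sample G H p j.1.1.1.1 j.1.1.1.2 l ω)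
          (fun l => X.sampleMean G H p j.1.1.1.1 j.1.1.1.2 l ω)} := by
    intro ω hω
    simp only [Play.Good, Set.mem_ofPred_eq, not_forall] at hω
    obtain ⟨h, k, i, l₀, m, hc⟩ := hω
    exact Set.mem_iUnion.2 ⟨((((h, k), i), l₀), m), hc⟩
  refine (measureReal_mono hsub (measure_ne_top _ _)).trans
    ((measureReal_iUnion_fintype_le _).trans ?_)
  refine (Finset.sum_le_card_nsmul _ _ (6 * M * Real.exp (-p.ι)) ?_).trans (le_of_eq ?_)
  · rintro ⟨⟨⟨⟨h, k⟩, i⟩, l₀⟩, m⟩ -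
    refine (hX.isUnitProc_sample h.2 k).measureReal_not_conc_le (I := X.selection h l₀ m i)
      ?_ ?_ hι
    · intro ω l hl
      have hl2 : l < (m : ℕ) := by
        cases i with
        | none => exact (Finset.mem_Ico.1 hl).2
        | some i => exact (mem_visits.1 hl).1.2
      have := m.2
      exact Finset.mem_range.2 (by omega)
    · intro l hl
      cases i with
      | none => exact MeasurableSet.const _
      | some i =>
        have : {ω | l ∈ X.selection h l₀ m (some i) ω} = {ω | (l₀ : ℕ) ≤ l ∧ l < (m : ℕ)} ∩
            ({ω | X.state l h ω = i.1} ∩ {ω | X.act₁ l h ω = i.2}) := by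
          ext ω
          simp only [Play.selection, mem_visits, Set.mem_ofPred_eq, Set.mem_inter_iff,
            eq_comm (a := i.1), eq_comm (a := i.2)]
        rw [this]
        exact (MeasurableSet.const _).inter
          ((hX.state_meas l hl h h.2.le i.1).inter (hX.act₁_meas hl h.2 i.2))
  · simp only [Finset.card_univ, Fintype.card_prod, Fintype.card_fin, Fintype.card_option,
      nsmul_eq_mul]
    push_cast
    ring

theorem IsPlay.epoch_regret_le [Nonempty A] (hX : IsPlay G H M p s₁ ℙ ℱ X) (hH : 0 < H)
    (hp : ∀ F : Finset A, F.Nonempty → p.pick F ∈ F) (hι : 0 < p.ι) {ω : Ω}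
    (good : X.Good G H M p ω) {m₀ m₁ : ℕ} (hm₀ : p.K ∣ m₀) (h01 : m₀ ≤ m₁) (h1K : m₁ ≤ m₀ + p.K)
    (h1M : m₁ ≤ M)
    (hstat : ∀ l, m₀ ≤ l → l < m₁ → ∀ h < H, ∀ t, X.pol₂ l ω h t = X.pol₂ m₀ ω h t) :
    ∑ l ∈ Finset.Ico m₀ m₁, (optV H (G.rbar (X.pol₂ l ω)) (G.Pbar (X.pol₂ l ω)) 0 (s₁ l)
        - G.value H (X.pol₁ H p l ω) (X.pol₂ l ω) 0 (s₁ l)) ≤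
      H * (2 ^ H * ((Fintype.card S * Fintype.card A) * epochBonus H p.ι (m₁ - m₀ : ℕ))
        + H * √((m₁ - m₀ : ℕ) * p.ι)) := by
  set s : ℕ → ℕ → S := fun l h => X.state l h ω with hs
  set a : ℕ → ℕ → A := fun l h => X.act₁ l h ω with ha
  set R : ℕ → ℕ → ℝ := fun l h => X.reward l h ω with hR
  set x : ℕ → Tables S A := fun m => epochTables H p s a R m₀ (m - m₀) with hx
  have run : IsRun H p m₀ x s a R := isRun_epochTables H p s a R m₀
  have hxT : ∀ l, m₀ ≤ l → l < m₁ → X.tables H p l ω = x l := by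
    intro l h1 h2
    have := startOfEpisode_eq H p s a R hm₀ (n := l - m₀) (by omega)
    rwa [show m₀ + (l - m₀) = l by omega] at this
  set rb := G.rbar (A₁ := A) (X.pol₂ m₀ ω) with hrb
  set Pb := G.Pbar (A₁ := A) (X.pol₂ m₀ ω) with hPb
  have g : IsMDP rb Pb := G.isMDP _
  have hrbar : ∀ l, m₀ ≤ l → l < m₁ → ∀ h < H, ∀ t b, G.rbar (X.pol₂ l ω) h t b = rb h t b := by
    intro l h1 h2 h hh t b
    simp only [hrb, Team.rbar, hstat l h1 h2 h hh t]
  have hPbar : ∀ l, m₀ ≤ l → l < m₁ → ∀ h < H, ∀ t b y,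
      G.Pbar (X.pol₂ l ω) h t b y = Pb h t b y := by
    intro l h1 h2 h hh t b y
    simp only [hPb, Team.Pbar, hstat l h1 h2 h hh t]
  have hopt : ∀ l, m₀ ≤ l → l < m₁ → ∀ h ≤ H, ∀ t,
      optV H (G.rbar (X.pol₂ l ω)) (G.Pbar (X.pol₂ l ω)) h t = optV H rb Pb h t := by
    intro l h1 h2 h hh t
    exact G.optV_congr (hstat l h1 h2) hh t
  have hconc : ∀ (k : Option (Fin 4)) (h : ℕ), h < H → ∀ (t : S) (b : A) (l₀ m : ℕ), m₀ ≤ l₀ →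
      m ≤ m₁ → ∀ U u : ℕ → ℝ,
      (∀ l, m₀ ≤ l → l < m₁ → t = s l h → b = a l h → X.sample G H p h k l ω = U l) →
      (∀ l, m₀ ≤ l → l < m₁ → t = s l h → b = a l h → X.sampleMean G H p h k l ω = u l) →
      Conc p.ι (visits s a h t b l₀ m) U u := by
    intro k h hh t b l₀ m hl₀ hm U u hU hu
    -- `Play.Good` covers window starts up to `M`; beyond that the window is empty.
    by_cases hl₀M : l₀ ≤ M
    · have := good ⟨h, hh⟩ k (some (t, b)) ⟨l₀, by omega⟩ ⟨m, by omega⟩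
      refine Conc.congr this (fun l hl => ?_) fun l hl => ?_ <;>
      obtain ⟨⟨e1, e2⟩, e3, e4⟩ := mem_visits.1 hl
      · exact hU l (hl₀.trans e1) (lt_of_lt_of_le e2 hm) e3 e4
      · exact hu l (hl₀.trans e1) (lt_of_lt_of_le e2 hm) e3 e4
    · have : visits s a h t b l₀ m = ∅ := by
        rw [visits, Finset.Ico_eq_empty (by omega), Finset.filter_empty]
      rw [this]
      exact conc_empty hι.le _ _
  have hgood : GoodEpoch H p.ι m₀ m₁ x s a R rb Pb := by
    constructor
    · intro h hh t b l₀ m hl₀ hm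
      refine hconc none h hh t b l₀ m hl₀ hm _ _ (fun l h1 h2 e1 e2 => rfl) fun l h1 h2 e1 e2 => ?_
      rw [Play.sampleMean, hrbar l h1 h2 h hh, e1, e2]
    · intro h hh t b l₀ m hl₀ hm
      refine hconc (some 0) h hh t b l₀ m hl₀ hm _ _ (fun l h1 h2 e1 e2 => ?_)
        fun l h1 h2 e1 e2 => ?_
      · simp only [Play.sample, Play.potential, hopt l h1 h2 (h + 1) hh]
        rfl
      · simp only [Play.sampleMean, Play.potential, hopt l h1 h2 (h + 1) hh, hPbar l h1 h2 h hh,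
          e1, e2]
        rfl
    · intro h hh t b l₀ m hl₀ hm
      refine hconc (some 1) h hh t b l₀ m hl₀ hm _ _ (fun l h1 h2 e1 e2 => ?_)
        fun l h1 h2 e1 e2 => ?_
      · simp only [Play.sample, Play.potential, hxT l h1 h2]
        rfl
      · simp only [Play.sampleMean, Play.potential, hxT l h1 h2, hPbar l h1 h2 h hh, e1, e2]
        rfl
    · intro h hh t b l₀ m hl₀ hm
      refine hconc (some 2) h hh t b l₀ m hl₀ hm _ _ (fun l h1 h2 e1 e2 => ?_)
        fun l h1 h2 e1 e2 => ?_
      · simp only [Play.sample, Play.potential, hxT l h1 h2]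
        rfl
      · simp only [Play.sampleMean, Play.potential, hxT l h1 h2, hPbar l h1 h2 h hh, e1, e2]
        rfl
  have hact : ∀ l, m₀ ≤ l → l < m₁ → ∀ h < H, a l h = greedy p (x l) h (s l h) := by
    intro l h1 h2 h hh
    rw [← hxT l h1 h2]
    exact hX.act₁_eq_greedy (by omega) hh ω
  have hfin := run.regret_le hH g hι hgood h01
    (fun l h1 h2 h hh b => by rw [hact l h1 h2 h hh]; exact Q_le_greedy p hp _ _ _ _)
    (W := fun l => G.value H (X.pol₁ H p l ω) (X.pol₂ l ω))
    (fun l h1 h2 h hh => by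
      have e := G.value_ofDet (greedy p (X.tables H p l ω)) (X.pol₂ l ω) hh (s l h)
      rw [hxT l h1 h2, ← hact l h1 h2 h hh, ← hxT l h1 h2] at e
      simp only [hrbar l h1 h2 h hh, hPbar l h1 h2 h hh] at e
      exact e)
    (fun l _ _ t => G.value_last H _ _ t)
    -- The martingale part of the regret runs over all episodes of the epoch, hence the selection
    -- `none` and the fourth potential.
    (fun h hh => by
      have := good ⟨h, hh⟩ (some 3) none ⟨m₀, by omega⟩ ⟨m₁, by omega⟩
      refine Conc.congr this (fun l hl => ?_) fun l hl => ?_ <;>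
      obtain ⟨h1, h2⟩ := Finset.mem_Ico.1 hl
      · simp only [Play.sample, Play.potential, hopt l h1 h2 (h + 1) hh]
        rfl
      · simp only [Play.sampleMean, Play.potential, hopt l h1 h2 (h + 1) hh, hPbar l h1 h2 h hh]
        rfl)
  refine le_trans (le_of_eq (Finset.sum_congr rfl fun l hl => ?_)) hfin
  obtain ⟨h1, h2⟩ := Finset.mem_Ico.1 hl
  rw [hopt l h1 h2 0 hH.le, show s l 0 = s₁ l from hX.start l (by omega) ω]

end Epoch

/-! ### Summation over the epochs -/

/-- An epoch is either free of internal switches and costs `E`, or contains one and costs at most `K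
* H`, charged to it. A switch between two epochs would not require any payment. -/
theorem sum_le_of_epochs {f : ℕ → ℝ} {σ : ℕ → ℕ} {H E : ℝ} {M K D : ℕ} (hH : 0 ≤ H) (hE : 0 ≤ E)
    (hMD : M ≤ D * K) (hf : ∀ m < M, f m ≤ H)
    (hep : ∀ m₀ m₁, K ∣ m₀ → m₀ ≤ m₁ → m₁ ≤ m₀ + K → m₁ ≤ M →
      (∀ m, m₀ ≤ m → m + 1 < m₁ → σ m = 0) → ∑ m ∈ Finset.Ico m₀ m₁, f m ≤ E) :
    ∑ m ∈ Finset.range M, f m ≤ D * E + (∑ m ∈ Finset.range (M - 1), σ m : ℕ) * (K * H) := by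
  -- The cut-off discards the comparison of the last episode with a nonexistent next one, matching
  -- the range `M - 1` of the switching cost.
  set τ : ℕ → ℝ := fun m => if m + 1 < M then (σ m : ℝ) else 0 with hτ
  have hτ0 : ∀ m, 0 ≤ τ m := fun m => by
    simp only [hτ]
    split_ifs <;> positivity
  have hKH : 0 ≤ K * H := by positivity
  have hone : ∀ m₀ m₁, K ∣ m₀ → m₀ ≤ m₁ → m₁ ≤ m₀ + K → m₁ ≤ M →
      ∑ m ∈ Finset.Ico m₀ m₁, f m ≤ E + K * H * ∑ m ∈ Finset.Ico m₀ m₁, τ m := by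
    intro m₀ m₁ h1 h2 h3 h4
    by_cases hs : ∀ m, m₀ ≤ m → m + 1 < m₁ → σ m = 0
    · have := mul_nonneg hKH (Finset.sum_nonneg fun m (_ : m ∈ Finset.Ico m₀ m₁) => hτ0 m)
      linarith [hep m₀ m₁ h1 h2 h3 h4 hs]
    · push Not at hs
      obtain ⟨m, hm1, hm2, hm3⟩ := hs
      have e1 : 1 ≤ ∑ m ∈ Finset.Ico m₀ m₁, τ m := by
        refine le_trans ?_ (Finset.single_le_sum (fun m _ => hτ0 m)
          (Finset.mem_Ico.2 ⟨hm1, by omega⟩ : m ∈ Finset.Ico m₀ m₁))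
        simp only [hτ]
        rw [if_pos (by omega)]
        exact_mod_cast Nat.one_le_iff_ne_zero.2 hm3
      have e2 : ∑ m ∈ Finset.Ico m₀ m₁, f m ≤ K * H := by
        refine (Finset.sum_le_card_nsmul _ _ H fun m hm => hf m (by
          have := (Finset.mem_Ico.1 hm).2; omega)).trans ?_
        rw [Nat.card_Ico, nsmul_eq_mul]
        exact mul_le_mul_of_nonneg_right (by exact_mod_cast (by omega : m₁ - m₀ ≤ K)) hH
      nlinarith
  have hind : ∀ d : ℕ, ∑ m ∈ Finset.range (min (d * K) M), f m ≤
      d * E + K * H * ∑ m ∈ Finset.range (min (d * K) M), τ m := by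
    intro d
    induction d with
    | zero => simp
    | succ d ih =>
      by_cases hd : M ≤ d * K
      · have e : (d + 1) * K = d * K + K := by ring
        rw [min_eq_right hd] at ih
        rw [min_eq_right (by omega)]
        push_cast
        linarith
      · push Not at hd
        rw [min_eq_left hd.le] at ih
        have e : (d + 1) * K = d * K + K := by ring
        have hle : d * K ≤ min ((d + 1) * K) M := le_min (by omega) hd.le
        have h1 := hone (d * K) (min ((d + 1) * K) M) (Dvd.intro_left d rfl) hle
          ((min_le_left _ _).trans (by omega)) (min_le_right _ _)
        rw [← Finset.sum_range_add_sum_Ico f hle, ← Finset.sum_range_add_sum_Ico τ hle]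
        push_cast
        linarith
  have h := hind D
  rw [min_eq_right hMD] at h
  have hsum : ∑ m ∈ Finset.range M, τ m = ((∑ m ∈ Finset.range (M - 1), σ m : ℕ) : ℝ) := by
    cases M with
    | zero => simp
    | succ M =>
      rw [Finset.sum_range_succ, Nat.add_sub_cancel]
      push_cast
      simp only [hτ, lt_self_iff_false, if_false, add_zero]
      exact Finset.sum_congr rfl fun m hm => by
        rw [if_pos (by have := Finset.mem_range.1 hm; omega)]
  rw [hsum] at h
  linarith

theorem eq_of_nSwitch_eq_zero {S A : Type*} [Finite S] [Fintype A] {H : ℕ} {π π' : Policy S A}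
    (h0 : nSwitch H π π' = 0) {h : ℕ} (hh : h < H) (t : S) : π h t = π' h t := by
  have hfin : {q : ℕ × S | q.1 < H ∧ π q.1 q.2 ≠ π' q.1 q.2}.Finite :=
    ((Set.finite_lt_nat H).prod (Set.finite_univ (α := S))).subset fun q hq => ⟨hq.1, trivial⟩
  unfold nSwitch at h0
  rw [Set.ncard_eq_zero hfin] at h0
  by_contra hne
  have : (h, t) ∈ {q : ℕ × S | q.1 < H ∧ π q.1 q.2 ≠ π' q.1 q.2} := ⟨hh, hne⟩
  rw [h0] at this
  exact this

/-- The bound for the regret of one stationary epoch of at most `n` episodes. -/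
def epochRegret (nS nA H : ℕ) (ι n : ℝ) : ℝ :=
  H * (2 ^ H * ((nS * nA) * epochBonus H ι n) + H * √(n * ι))

theorem epochRegret_nonneg (nS nA H : ℕ) (ι n : ℝ) : 0 ≤ epochRegret nS nA H ι n := by
  unfold epochRegret epochBonus
  positivity

theorem epochRegret_mono (nS nA H : ℕ) {ι n n' : ℝ} (hι : 0 ≤ ι) (hn : n ≤ n') :
    epochRegret nS nA H ι n ≤ epochRegret nS nA H ι n' := by
  unfold epochRegret epochBonus
  gcongr

section Total

variable {S A A₂ Ω : Type*} [Fintype S] [DecidableEq S] [Fintype A] [DecidableEq A]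
  [Fintype A₂] [mΩ : MeasurableSpace Ω]
  {G : Team S A A₂} {H M : ℕ} {p : Params A} {s₁ : ℕ → S} {ℙ : Measure Ω}
  {ℱ : Filtration ℕ mΩ} {X : Play S A A₂ Ω}

theorem IsPlay.total_regret_le [Nonempty A] (hX : IsPlay G H M p s₁ ℙ ℱ X) (hH : 0 < H)
    (hp : ∀ F : Finset A, F.Nonempty → p.pick F ∈ F) (hι : 0 < p.ι) {ω : Ω}
    (good : X.Good G H M p ω) {D : ℕ} (hD : M ≤ D * p.K) :
    ∑ m ∈ Finset.range M, (optV H (G.rbar (X.pol₂ m ω)) (G.Pbar (X.pol₂ m ω)) 0 (s₁ m)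
        - G.value H (X.pol₁ H p m ω) (X.pol₂ m ω) 0 (s₁ m)) ≤
      D * epochRegret (Fintype.card S) (Fintype.card A) H p.ι p.K
        + switchingCost H M (fun m => X.pol₂ m ω) * (p.K * H) := by
  refine sum_le_of_epochs (Nat.cast_nonneg H) (epochRegret_nonneg _ _ _ _ _) hD ?_ ?_
  · intro m _
    have h1 := (G.isMDP (A₁ := A) (X.pol₂ m ω)).optV_le (H := H) (Nat.zero_le H) (s₁ m)
    have h2 := G.value_nonneg (X.pol₁ H p m ω) (X.pol₂ m ω) (Nat.zero_le H) (s₁ m)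
    linarith
  · intro m₀ m₁ h1 h2 h3 h4 hσ
    have hstat : ∀ l, m₀ ≤ l → l < m₁ → ∀ h < H, ∀ t, X.pol₂ l ω h t = X.pol₂ m₀ ω h t := by
      intro l hl
      induction l, hl using Nat.le_induction with
      | base => intros; rfl
      | succ l hl ih =>
        intro hl1 h hh t
        rw [← ih (by omega) h hh t]
        exact (eq_of_nSwitch_eq_zero (hσ l hl hl1) hh t).symm
    refine (hX.epoch_regret_le hH hp hι good h1 h2 h3 h4 hstat).trans ?_
    exact epochRegret_mono _ _ _ hι.le (by exact_mod_cast (by omega : m₁ - m₀ ≤ p.K))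

omit [DecidableEq A] in
/-- From regret to value in a smooth team. -/
theorem smooth_sum_le [Nonempty A] (hH : 0 < H) {lam mu : ℝ} (hsm : G.IsSmooth H lam mu)
    {σ₁ : Policy S A} {σ₂ : Policy S A₂} (hopt : G.IsTeamOptimal H σ₁ σ₂) (s₁ : ℕ → S)
    (π₁ : ℕ → Policy S A) (π₂ : ℕ → Policy S A₂) {B : ℝ}
    (hB : ∑ m ∈ Finset.range M, (optV H (G.rbar (π₂ m)) (G.Pbar (π₂ m)) 0 (s₁ m)
        - G.value H (π₁ m) (π₂ m) 0 (s₁ m)) ≤ B) :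
    lam * ∑ m ∈ Finset.range M, G.value H σ₁ σ₂ 0 (s₁ m) - B
      ≤ (1 + mu) * ∑ m ∈ Finset.range M, G.value H (π₁ m) (π₂ m) 0 (s₁ m) := by
  obtain ⟨τ₁, τ₂, hτ⟩ := hsm
  -- The pair that witnesses smoothness is itself optimal, so its value is that of the given optimal
  -- pair.
  have hval : ∀ t, G.value H τ₁ τ₂ 0 t = G.value H σ₁ σ₂ 0 t := fun t =>
    le_antisymm ((hopt 0 hH t).1 ⟨(τ₁, τ₂), rfl⟩) (hτ σ₁ σ₂ 0 hH t).1
  have key : ∑ m ∈ Finset.range M, (lam * G.value H σ₁ σ₂ 0 (s₁ m)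
      - (1 + mu) * G.value H (π₁ m) (π₂ m) 0 (s₁ m)) ≤ B := by
    refine le_trans (Finset.sum_le_sum fun m _ => ?_) hB
    have h1 := (hτ (π₁ m) (π₂ m) 0 hH (s₁ m)).2
    have h2 := G.value_le_optV τ₁ (π₂ m) (Nat.zero_le H) (s₁ m)
    rw [hval] at h1
    linarith
  rw [Finset.sum_sub_distrib, ← Finset.mul_sum, ← Finset.mul_sum] at key
  linarith

end Total

/-! ### The tuning of the algorithm -/

theorem epochRegret_le {nS nA H : ℕ} {ι n : ℝ} (hS : 1 ≤ nS) (hA : 1 ≤ nA) (hι : 1 ≤ ι)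
    (hn : 1 ≤ n) : epochRegret nS nA H ι n
      ≤ (H * (2 ^ H * ((nS * nA) * (H ^ 2 + 16 * H * (H + 1))) + H)) * (√n * ι) := by
  have hs : √ι ≤ ι := Real.sqrt_le_self_iff.2 (Or.inr hι)
  have hn1 : 1 ≤ √n := Real.one_le_sqrt.2 hn
  have h1 : √ι * √n ≤ √n * ι := by nlinarith
  have h2 : 1 ≤ √n * ι := by nlinarith
  have h3 : epochBonus H ι n ≤ (H ^ 2 + 16 * H * (H + 1)) * (√n * ι) := by
    unfold epochBonus
    have e1 : (H : ℝ) ^ 2 ≤ H ^ 2 * (√n * ι) := le_mul_of_one_le_right (by positivity) h2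
    have e2 : 16 * (H : ℝ) * (H + 1) * (√ι * √n) ≤ 16 * (H : ℝ) * (H + 1) * (√n * ι) :=
      mul_le_mul_of_nonneg_left h1 (by positivity)
    linarith
  have h4 : √(n * ι) ≤ √n * ι := by
    rw [Real.sqrt_mul (by linarith)]
    nlinarith
  unfold epochRegret
  calc _ ≤ (H : ℝ) * (2 ^ H * ((nS * nA) * ((H ^ 2 + 16 * H * (H + 1)) * (√n * ι)))
        + H * (√n * ι)) := by gcongr
    _ = _ := by ring

/-- Number and length of the epochs. -/
theorem epoch_tuning {c β T : ℝ} {M D K : ℕ} (hc : 0 < c) (hβ : 0 < β) (hβ1 : β < 1)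
    (hT : 1 ≤ T) (hM : 1 ≤ M) (hMT : (M : ℝ) ≤ T) (hD : D = ⌈c * T ^ ((2 * β + 1) / 3)⌉₊)
    (hK : K = ⌈(M : ℝ) / D⌉₊) :
    1 ≤ K ∧ M ≤ D * K ∧ (D : ℝ) * √K ≤ 2 * (c + 1) * T ^ ((β + 2) / 3) ∧
      T ^ β * K ≤ (1 / c + 1) * T ^ ((β + 2) / 3) := by
  have hT0 : 0 < T := by linarith
  have hM' : (1 : ℝ) ≤ M := by exact_mod_cast hM
  set a := T ^ ((2 * β + 1) / 3) with ha
  set θ := T ^ ((β + 2) / 3) with hθ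
  have ha1 : 1 ≤ a := Real.one_le_rpow hT (by linarith)
  have haθ : a ≤ θ := Real.rpow_le_rpow_of_exponent_le hT (by linarith)
  have hβθ : T ^ β ≤ θ := Real.rpow_le_rpow_of_exponent_le hT (by linarith)
  have hθ0 : 0 < θ := by linarith
  -- The exponent balance: `aT = θ²` makes √(DM) of order `θ`, and `T^β·T = aθ` makes `T^β·M/D` of
  -- order `θ`.
  have haT : a * T = θ ^ 2 := by
    rw [ha, hθ, pow_two, ← Real.rpow_add hT0, ← Real.rpow_add_one hT0.ne']
    congr 1
    ring
  have hTa : T ^ β * T = a * θ := by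
    rw [ha, hθ, ← Real.rpow_add hT0, ← Real.rpow_add_one hT0.ne']
    congr 1
    ring
  have hca : 0 < c * a := by positivity
  have hDlow : c * a ≤ D := hD ▸ Nat.le_ceil _
  have hDup : (D : ℝ) ≤ (c + 1) * a := by
    have := Nat.ceil_lt_add_one hca.le
    rw [← hD] at this
    linarith
  have hD0 : (0 : ℝ) < D := hca.trans_le hDlow
  have hKlow : (M : ℝ) / D ≤ K := hK ▸ Nat.le_ceil _
  have hKup : (K : ℝ) ≤ M / D + 1 := by
    have := Nat.ceil_lt_add_one (a := (M : ℝ) / D) (by positivity)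
    rw [← hK] at this
    exact this.le
  refine ⟨?_, ?_, ?_, ?_⟩
  · rw [hK]
    exact Nat.one_le_ceil_iff.2 (by positivity)
  · rw [div_le_iff₀ hD0] at hKlow
    have : (M : ℝ) ≤ D * K := by linarith
    exact_mod_cast this
  -- Squaring gives `D²K ≤ DM + D²`; the second term, due to rounding `K` up, is harmless because `a
  -- ≤ θ` for `β < 1`.
  · have h1 : ((D : ℝ) * √K) ^ 2 ≤ (2 * (c + 1) * θ) ^ 2 := by
      rw [mul_pow, Real.sq_sqrt (Nat.cast_nonneg K)]
      have e1 : (D : ℝ) ^ 2 * K ≤ D * M + D ^ 2 := by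
        have := mul_le_mul_of_nonneg_left hKup (sq_nonneg (D : ℝ))
        have e : (D : ℝ) ^ 2 * (M / D + 1) = D * M + D ^ 2 := by field_simp
        linarith
      have e2 : (D : ℝ) * M ≤ (c + 1) * θ ^ 2 := by
        rw [← haT, ← mul_assoc]
        exact mul_le_mul hDup hMT (by linarith) (by positivity)
      have e3 : (D : ℝ) ^ 2 ≤ ((c + 1) * θ) ^ 2 := by
        have : (D : ℝ) ≤ (c + 1) * θ := hDup.trans (by gcongr)
        gcongr
      nlinarith [sq_nonneg θ, sq_nonneg (c * θ), mul_nonneg hc.le (sq_nonneg θ)]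
    exact (pow_le_pow_iff_left₀ (by positivity) (by positivity) two_ne_zero).1 h1
  · have h1 : (M : ℝ) / D ≤ T / (c * a) := by gcongr
    calc T ^ β * K ≤ T ^ β * (T / (c * a) + 1) := by
          gcongr
          linarith
      _ = T ^ β * T / (c * a) + T ^ β := by ring
      _ = 1 / c * θ + T ^ β := by
          rw [hTa]
          field_simp
      _ ≤ (1 / c + 1) * θ := by linarith

/-- The number of epochs as a power of `T = M H`. -/
theorem numEpochs_eq (nS nA H M : ℕ) {cB β : ℝ} (hcB : 0 < cB) (hT : 0 < M * H) :
    numEpochs nS nA H M (cB * ((M * H : ℕ) : ℝ) ^ β) =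
      ⌈((nS : ℝ) ^ (-(1 / 3) : ℝ) * (nA : ℝ) ^ (-(1 / 3) : ℝ) * cB ^ (2 / 3 : ℝ)
        * (H : ℝ) ^ (-(2 / 3) : ℝ)) * ((M * H : ℕ) : ℝ) ^ ((2 * β + 1) / 3)⌉₊ := by
  have hT' : (0 : ℝ) < ((M * H : ℕ) : ℝ) := by exact_mod_cast hT
  unfold numEpochs
  congr 1
  rw [Real.mul_rpow hcB.le (by positivity), ← Real.rpow_mul hT'.le,
    show (2 * β + 1) / 3 = β * (2 / 3) + 1 / 3 by ring, Real.rpow_add hT']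
  ring

theorem one_le_log_div {T δ : ℝ} (hT : 3 ≤ T) (hδ : 0 < δ) (hδ1 : δ < 1) :
    1 ≤ Real.log (T / δ) := by
  have h : 3 ≤ T / δ := by
    rw [le_div_iff₀ hδ]
    nlinarith
  rw [Real.le_log_iff_exp_le (by linarith)]
  linarith [Real.exp_one_lt_d9]

/-- With `B = SAT` lying between `T` and `T²`, the quantity `2B^q/δ` is at least `T/δ` and at most
`(T/δ)^(2q+1)`, so `ι` and `log(T/δ)` agree up to a constant depending on `q`. -/
theorem log_tuning {T δ B : ℝ} {q : ℕ} (hq : 1 ≤ q) (hT : 3 ≤ T) (hδ : 0 < δ) (hδ1 : δ < 1)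
    (hB : T ≤ B) (hB2 : B ≤ T ^ 2) :
    Real.log (T / δ) ≤ Real.log (2 / (δ / B ^ q)) ∧
      Real.log (2 / (δ / B ^ q)) ≤ (2 * q + 1) * Real.log (T / δ) := by
  have hB0 : 0 < B := by linarith
  have e : 2 / (δ / B ^ q) = 2 * B ^ q / δ := by field_simp
  rw [e]
  constructor
  · refine Real.log_le_log (by positivity) ?_
    gcongr
    have := le_self_pow₀ (show 1 ≤ B by linarith) (show q ≠ 0 by omega)
    nlinarith
  · have h : Real.log ((T / δ) ^ (2 * q + 1)) = (2 * q + 1) * Real.log (T / δ) := by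
      rw [Real.log_pow]
      push_cast
      ring
    rw [← h]
    refine Real.log_le_log (by positivity) ?_
    have hTδ : T ≤ T / δ := by
      rw [le_div_iff₀ hδ]
      nlinarith
    calc 2 * B ^ q / δ ≤ T * (T ^ 2) ^ q / δ := by gcongr; linarith
      _ = T ^ (2 * q) * (T / δ) := by rw [← pow_mul]; ring
      _ ≤ (T / δ) ^ (2 * q) * (T / δ) := by gcongr
      _ = _ := (pow_succ _ _).symm

/-- As `exp(-ι) = δ/(2B^q)`, the number of events must be absorbed by `B^q`. It is at most
`120·B·M²` after halving, and `120 ≤ B`, `M ≤ B` bound this by `B⁴`; hence the threshold 120 and the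
exponent 4. -/
theorem failure_prob_le {nS nA H M q : ℕ} {δ : ℝ} (hS : 1 ≤ nS) (hA : 1 ≤ nA)
    (hT : 120 ≤ M * H) (hq : 4 ≤ q) (hδ : 0 < δ) :
    ((H : ℝ) * 5 * (nS * nA + 1) * (M + 1) * (M + 1)) *
      (6 * M * Real.exp (-Real.log (2 / (δ / ((nS * nA * (M * H) : ℕ) : ℝ) ^ q)))) ≤ δ := by
  have hM0 : M ≠ 0 := by rintro rfl; omega
  have hH0 : H ≠ 0 := by rintro rfl; omega
  have hM : (1 : ℝ) ≤ M := by exact_mod_cast Nat.one_le_iff_ne_zero.2 hM0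
  have hH : (1 : ℝ) ≤ H := by exact_mod_cast Nat.one_le_iff_ne_zero.2 hH0
  have hSA : (1 : ℝ) ≤ nS * nA := by exact_mod_cast Nat.mul_le_mul hS hA
  have hT' : (120 : ℝ) ≤ M * H := by exact_mod_cast hT
  push_cast
  set u : ℝ := nS * nA with hu
  set B : ℝ := u * (M * H) with hB
  have hB1 : 1 ≤ B := by nlinarith
  have hB0 : 0 < B := by linarith
  rw [Real.exp_neg, Real.exp_log (by positivity)]
  have e : (2 / (δ / B ^ q))⁻¹ = δ / (2 * B ^ q) := by field_simp
  rw [e]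
  have hkey : (H : ℝ) * 5 * (u + 1) * (M + 1) * (M + 1) * (3 * M) ≤ B ^ q := by
    refine le_trans ?_ (pow_le_pow_right₀ hB1 hq)
    have hMB : (M : ℝ) ≤ B := by
      rw [hB]
      nlinarith [mul_nonneg (show (0 : ℝ) ≤ M by linarith) (sub_nonneg.2 hH),
        mul_nonneg (show (0 : ℝ) ≤ M * H by positivity) (sub_nonneg.2 hSA)]
    calc (H : ℝ) * 5 * (u + 1) * (M + 1) * (M + 1) * (3 * M)
        ≤ H * 5 * (2 * u) * (2 * M) * (2 * M) * (3 * M) := by gcongr <;> linarith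
      _ = 120 * B * M * M := by rw [hB]; ring
      _ ≤ B * B * B * B := by
          gcongr
          rw [hB]
          nlinarith
      _ = B ^ 4 := by ring
  calc _ = δ * (H * 5 * (u + 1) * (M + 1) * (M + 1) * (3 * M)) / B ^ q := by
        field_simp
        ring
    _ ≤ δ * B ^ q / B ^ q := by gcongr
    _ = δ := by field_simp

end TeamRL

end

/-! ### The value guarantee for agent 1. -/

theorem mainTheorem7 :
    -- absolute constants: the power in the confidence parameter and the power of the logarithm
    ∃ q₀ k : ℕ,
    ∀ (S A₁ : Type*) [Fintype S] [DecidableEq S] [Fintype A₁] [DecidableEq A₁]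
      (H : ℕ) (_ : 0 < H)
      (β : ℝ) (_ : 0 < β) (_ : β < 1)
      -- the constant in the switching cost, the constants in the two tunings of the algorithm
      (cSwitch cBudget cRef : ℝ) (_ : 0 < cBudget) (_ : 0 < cRef) (q : ℕ) (_ : q₀ ≤ q)
      (lam : ℝ) (_ : 0 ≤ lam),
    ∃ (C : ℝ) (T₀ : ℕ),
    ∀ (A₂ : Type*) [Fintype A₂] (G : TeamRL.Team S A₁ A₂)
      (mu : ℝ) (_ : -1 < mu) (_ : G.IsSmooth H lam mu)
      (M : ℕ) (_ : T₀ ≤ M * H)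
      (δ : ℝ) (_ : 0 < δ) (_ : δ < 1)
      (bonus : TeamRL.Bonus)
      (pick : Finset A₁ → A₁) (_ : ∀ F : Finset A₁, F.Nonempty → pick F ∈ F)
      (p : TeamRL.Params A₁)
      (_ : p = TeamRL.restartParams bonus pick (Fintype.card S) (Fintype.card A₁) H M
        (cBudget * ((M * H : ℕ) : ℝ) ^ β)
        (δ / ((Fintype.card S * Fintype.card A₁ * (M * H) : ℕ) : ℝ) ^ q) cRef)
      (Ω : Type*) [MeasurableSpace Ω] (ℙ : MeasureTheory.Measure Ω)
      [MeasureTheory.IsProbabilityMeasure ℙ]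
      (ℱ : MeasureTheory.Filtration ℕ (inferInstance : MeasurableSpace Ω))
      (s₁ : ℕ → S) (X : TeamRL.Play S A₁ A₂ Ω) (_ : TeamRL.IsPlay G H M p s₁ ℙ ℱ X)
      (_ : ∀ᵐ ω ∂ℙ, (TeamRL.switchingCost H M (fun m => X.pol₂ m ω) : ℝ)
        ≤ cSwitch * ((M * H : ℕ) : ℝ) ^ β)
      (σ₁ : TeamRL.Policy S A₁) (σ₂ : TeamRL.Policy S A₂) (_ : G.IsTeamOptimal H σ₁ σ₂),
      1 - δ ≤ ℙ.real {ω |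
        lam / (1 + mu) * (∑ m ∈ Finset.range M, G.value H σ₁ σ₂ 0 (s₁ m)
            - C * ((M * H : ℕ) : ℝ) ^ ((β + 2) / 3)
              * Real.log (((M * H : ℕ) : ℝ) / δ) ^ k)
          ≤ ∑ m ∈ Finset.range M, G.value H (X.pol₁ H p m ω) (X.pol₂ m ω) 0 (s₁ m)} := by
  classical
  refine ⟨4, 1, ?_⟩
  intro S A₁ _ _ _ _ H hH β hβ hβ1 cS cB cR hcB hcR q hq lam hlam
  set nS := Fintype.card S with hnS
  set nA := Fintype.card A₁ with hnA
  set c : ℝ := (nS : ℝ) ^ (-(1 / 3) : ℝ) * (nA : ℝ) ^ (-(1 / 3) : ℝ) * cB ^ (2 / 3 : ℝ)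
    * (H : ℝ) ^ (-(2 / 3) : ℝ) with hc
  set E : ℝ := H * (2 ^ H * ((nS * nA) * (H ^ 2 + 16 * H * (H + 1))) + H) with hE
  -- The first summand is the cost of the stationary epochs, the second that of the epochs with a
  -- switch.
  set C' : ℝ := 2 * (c + 1) * E * (2 * q + 1) + |cS| * H * (1 / c + 1) with hC'
  -- Dividing by `lam` cancels the factor `lam` in front of the bracket; for `lam = 0` the value of
  -- the constant is irrelevant. The threshold gives `T ≥ 120` for the failure probability and `SA ≤
  -- T`, hence `B ≤ T²`, for the logarithm.
  refine ⟨C' / lam, 120 + nS * nA, ?_⟩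
  intro A₂ _ G mu hmu hsm M hM δ hδ hδ1 bonus pick hpick p hp Ω _ ℙ _ ℱ s₁ X hX hsw σ₁ σ₂ hopt
  have : Nonempty A₁ := ⟨pick ∅⟩
  have : Nonempty S := ⟨s₁ 0⟩
  have hS1 : 1 ≤ nS := Fintype.card_pos
  have hA1 : 1 ≤ nA := Fintype.card_pos
  have hMH : 120 ≤ M * H := by omega
  have hM1 : 1 ≤ M := Nat.one_le_iff_ne_zero.2 (by rintro rfl; omega)
  have hH' : (1 : ℝ) ≤ H := by exact_mod_cast hH
  set T : ℝ := ((M * H : ℕ) : ℝ) with hT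
  set B : ℝ := ((nS * nA * (M * H) : ℕ) : ℝ) with hB
  have hT120 : (120 : ℝ) ≤ T := by rw [hT]; exact_mod_cast hMH
  have hMT : (M : ℝ) ≤ T := by rw [hT]; exact_mod_cast Nat.le_mul_of_pos_right M hH
  have hTB : T ≤ B := by
    rw [hT, hB]
    exact_mod_cast Nat.le_mul_of_pos_left (M * H) (Nat.mul_pos hS1 hA1)
  have hBT : B ≤ T ^ 2 := by
    rw [pow_two, hT, hB]
    exact_mod_cast Nat.mul_le_mul_right (M * H) (by omega : nS * nA ≤ M * H)
  have hnS0 : (0 : ℝ) < nS := by exact_mod_cast hS1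
  have hnA0 : (0 : ℝ) < nA := by exact_mod_cast hA1
  have hc0 : 0 < c := by positivity
  set L := Real.log (T / δ) with hL
  have hL1 : 1 ≤ L := TeamRL.one_le_log_div (by linarith) hδ hδ1
  obtain ⟨hι1, hι2⟩ :=
    TeamRL.log_tuning (q := q) (by omega) (by linarith : 3 ≤ T) hδ hδ1 hTB hBT
  have hpι : p.ι = Real.log (2 / (δ / B ^ q)) := by rw [hp]; rfl
  rw [← hpι] at hι1 hι2
  set D := TeamRL.numEpochs nS nA H M (cB * T ^ β) with hD
  have hpK : p.K = ⌈(M : ℝ) / D⌉₊ := by rw [hp]; rfl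
  have hppick : p.pick = pick := by rw [hp]; rfl
  obtain ⟨hK1, hMDK, hDK, hTK⟩ := TeamRL.epoch_tuning hc0 hβ hβ1 (by linarith : 1 ≤ T) hM1 hMT
    (TeamRL.numEpochs_eq nS nA H M hcB (by omega)) hpK
  set θ := T ^ ((β + 2) / 3) with hθ
  have hθ0 : 0 < θ := by positivity
  have hE0 : 0 ≤ E := by positivity
  have hpι1 : 1 ≤ p.ι := hL1.trans hι1
  have hmain : ∀ ω, X.Good G H M p ω →
      (TeamRL.switchingCost H M (fun m => X.pol₂ m ω) : ℝ) ≤ cS * T ^ β →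
      lam / (1 + mu) * (∑ m ∈ Finset.range M, G.value H σ₁ σ₂ 0 (s₁ m) - C' / lam * θ * L ^ 1)
        ≤ ∑ m ∈ Finset.range M, G.value H (X.pol₁ H p m ω) (X.pol₂ m ω) 0 (s₁ m) := by
    intro ω good hω
    -- If `lam = 0`, the claimed bound is `0` and values are nonnegative.
    rcases hlam.eq_or_lt with h0 | hlam0
    · rw [← h0, zero_div, zero_mul]
      exact Finset.sum_nonneg fun m _ => G.value_nonneg _ _ (Nat.zero_le H) _
    have hreg := hX.total_regret_le hH (by rw [hppick]; exact hpick) (by linarith) good hMDK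
    have h1 : (D : ℝ) * TeamRL.epochRegret nS nA H p.ι p.K
        ≤ 2 * (c + 1) * E * (2 * q + 1) * (θ * L) := by
      calc (D : ℝ) * TeamRL.epochRegret nS nA H p.ι p.K ≤ D * (E * (√p.K * p.ι)) := by
            gcongr
            exact TeamRL.epochRegret_le hS1 hA1 hpι1 (by exact_mod_cast hK1)
        _ = E * (D * √p.K) * p.ι := by ring
        _ ≤ E * (2 * (c + 1) * θ) * ((2 * q + 1) * L) := by gcongr
        _ = _ := by ring
    have h2 : (TeamRL.switchingCost H M (fun m => X.pol₂ m ω) : ℝ) * (p.K * H)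
        ≤ |cS| * H * (1 / c + 1) * (θ * L) := by
      calc (TeamRL.switchingCost H M (fun m => X.pol₂ m ω) : ℝ) * (p.K * H)
          ≤ |cS| * T ^ β * (p.K * H) := by
            gcongr
            exact hω.trans (by gcongr; exact le_abs_self cS)
        _ = |cS| * H * (T ^ β * p.K) := by ring
        _ ≤ |cS| * H * ((1 / c + 1) * θ) := by gcongr
        _ ≤ |cS| * H * ((1 / c + 1) * θ) * L := le_mul_of_one_le_right (by positivity) hL1
        _ = _ := by ring
    have hle := TeamRL.smooth_sum_le hH hsm hopt s₁ (fun m => X.pol₁ H p m ω)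
      (fun m => X.pol₂ m ω) (hreg.trans (add_le_add h1 h2))
    rw [div_mul_eq_mul_div, div_le_iff₀ (by linarith), mul_comm _ (1 + mu)]
    refine le_trans (le_of_eq ?_) hle
    rw [hC']
    field_simp
  set W := {ω | lam / (1 + mu) * (∑ m ∈ Finset.range M, G.value H σ₁ σ₂ 0 (s₁ m)
      - C' / lam * θ * L ^ 1)
        ≤ ∑ m ∈ Finset.range M, G.value H (X.pol₁ H p m ω) (X.pol₂ m ω) 0 (s₁ m)} with hW
  have hbad : ℙ.real {ω | ¬ X.Good G H M p ω} ≤ δ :=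
    (hX.measureReal_not_good_le hpι1).trans
      (by rw [hpι]; exact TeamRL.failure_prob_le hS1 hA1 hMH hq hδ)
  have hnull : ℙ.real {ω | ¬ (TeamRL.switchingCost H M (fun m => X.pol₂ m ω) : ℝ)
      ≤ cS * T ^ β} = 0 := by
    rw [MeasureTheory.measureReal_eq_zero_iff]
    exact hsw
  -- Covering and subadditivity yield the probability bound without measurability of `W`.
  have hcover : (Set.univ : Set Ω) ⊆ W ∪ ({ω | ¬ X.Good G H M p ω} ∪
      {ω | ¬ (TeamRL.switchingCost H M (fun m => X.pol₂ m ω) : ℝ) ≤ cS * T ^ β}) := by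
    intro ω _
    by_cases g : X.Good G H M p ω
    · by_cases h : (TeamRL.switchingCost H M (fun m => X.pol₂ m ω) : ℝ) ≤ cS * T ^ β
      · exact Or.inl (hmain ω g h)
      · exact Or.inr (Or.inr h)
    · exact Or.inr (Or.inl g)
  have hone : 1 ≤ ℙ.real W + (ℙ.real {ω | ¬ X.Good G H M p ω} +
      ℙ.real {ω | ¬ (TeamRL.switchingCost H M (fun m => X.pol₂ m ω) : ℝ) ≤ cS * T ^ β}) := by
    calc (1 : ℝ) = ℙ.real Set.univ := by simp
      _ ≤ _ := MeasureTheory.measureReal_mono hcover (MeasureTheory.measure_ne_top _ _)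
      _ ≤ _ := MeasureTheory.measureReal_union_le _ _
      _ ≤ _ := add_le_add le_rfl (MeasureTheory.measureReal_union_le _ _)
  linarith
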